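/- \textbf{Setting.} A family of bilinear groups assigns to every security parameter $\lambda$ a distribution on group descriptions. Each description determines groups $\mathbb G,\mathbb G_T$ of the same prime order $p>2^\lambda$ and a map $e:\mathbb G\times\mathbb G\to\mathbb G_T$ with $e(g^a,h^b)=e(g,h)^{ab}$ for all $g,h\in\mathbb G$, $a,b\in\mathbb Z$, and $e(g,h)\neq 1$ whenever $g,h\neq 1$. Elements have unique encodings, and the group operations, the map $e$ and membership in $\mathbb G$ are computable in polynomial time. A PPT algorithm is a randomized program stopped after a number of steps that is a fixed polynomial in $\lambda$. The computational Diffie--Hellman (CDH) assumption for the family says that every PPT algorithm, given $\lambda$, a description, and $(g,g^a,g^b)$ for a random generator $g$ and $a,b$ uniform in $\mathbb Z_p^*$, outputs $g^{ab}$ with probability negligible in $\lambda$. \textbf{Scheme.} \emph{Setup} chooses a random generator $g$ of $\mathbb G$, uniform $h,Y,Z\in\mathbb G$ and $x\in\mathbb Z_p^*$; the public key consists of $g$ and $(X=g^x,Y,Z,h)$, the master secret is $x$. Identities are elements of $\mathbb Z_p$. \emph{Key generation} for $\mathsf{ID}$: the user sends a commitment $R\in\mathbb G$ together with the first message $u\in\mathbb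 G$ of Okamoto's three-move proof of knowledge of $(t_0,\theta)$ such that $R=h^{t_0}X^{\theta}$; the PKG replies with a uniform challenge $c\in\mathbb Z_p$; the user answers with $(s,s')\in\mathbb Z_p^2$. If $h^{s}X^{s'}\neq uR^{c}$ the PKG returns $\bot$. Otherwise it picks $r',t_1$ uniformly in $\mathbb Z_p^*$ and returns $$\big((Y R\,h^{t_1})^{1/x}(g^{\mathsf{ID}}Z)^{r'},\ X^{r'},\ t_1\big).$$ A triple $(d_1,d_2,d_3)\in\mathbb G^2\times\mathbb Z_p$ is a \emph{valid key} for $\mathsf{ID}$ if $$e(d_1,X)=e(Y,g)\,e(h,g)^{d_3}\,e(g^{\mathsf{ID}}Z,d_2);$$ its \emph{family number} is then $d_3$. \textbf{Selective-ID ComputeNewKey game.} Given $\lambda$ and a group description, but before Setup is run, the adversary (the user) announces a target identity $\mathsf{ID}^\star\in\mathbb Z_p$. Setup is run and the adversary receives the public key. She may then run the key generation protocol with the PKG for identities of her choice, including $\mathsf{ID}^\star$, at most once for each identity; the runs may be executed concurrently and interleaved arbitrarily. The PKG answers any message that is malformed or not expected by $\bot$. Finally she outputs two triples, and wins if both are valid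 keys for $\mathsf{ID}^\star$ and their family numbers are distinct. \textbf{Theorem.} If the CDH assumption holds for the family of bilinear groups, then every PPT adversary wins the selective-ID ComputeNewKey game for this scheme with probability negligible in $\lambda$. -/

import Mathlib

noncomputable section

namespace AIBE

/-! ## A probabilistic machine model with a step count -/

/-- The data on which programs operate: binary trees with natural numbers at the leaves. -/
inductive Data : Type
  | num (n : ℕ) : Data
  | pair (a b : Data) : Data
  deriving DecidableEq

namespace Data

/-- Bit size: numbers count with the length of their binary expansion. -/
def size : Data → ℕ
  | num n => Nat.size n + 1
  | pair a b => a.size + b.size + 1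

def fst : Data → Data
  | num _ => num 0
  | pair a _ => a

def snd : Data → Data
  | num _ => num 0
  | pair _ b => b

def toNat : Data → ℕ
  | num n => n
  | pair _ _ => 0

end Data

/-- The deterministic basic instructions. -/
inductive Prim : Type
  | id | const (d : Data) | fst | snd | isNum | eq | add | sub | mul | div | mod

/-- The effect of a basic instruction. The binary ones act on the two components of a pair. -/
def Prim.apply : Prim → Data → Data
  | .id, x => x
  | .const d, _ => d
  | .fst, x => x.fst
  | .snd, x => x.snd
  | .isNum, .num _ => .num 1
  | .isNum, .pair _ _ => .num 0
  | .eq, x => .num (if x.fst = x.snd then 1 else 0)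
  | .add, x => .num (x.fst.toNat + x.snd.toNat)
  | .sub, x => .num (x.fst.toNat - x.snd.toNat)
  | .mul, x => .num (x.fst.toNat * x.snd.toNat)
  | .div, x => .num (x.fst.toNat / x.snd.toNat)
  | .mod, x => .num (x.fst.toNat % x.snd.toNat)

/-- Programs. `rand` draws a uniform number below its argument (so `rand` on `num 2` is a
fair coin), `pair f g` runs `f` and `g` on the same input, `comp f g` runs `g` and then `f`,
`ite c f g` branches on whether `c` returns a value other than `num 0`, and `loop c f` repeats
`f` as long as `c` returns a value other than `num 0`. -/
inductive Code : Type
  | prim (o : Prim) : Code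
  | rand : Code
  | pair (f g : Code) : Code
  | comp (f g : Code) : Code
  | ite (c f g : Code) : Code
  | loop (c f : Code) : Code

/-- Randomized computations with a clock: the state is the number of steps that are still
allowed, and a computation that exceeds it fails. -/
abbrev Timed (α : Type) : Type := StateT ℕ (OptionT PMF) α

namespace Timed

/-- Draw from a distribution, at no cost. -/
def sample {α : Type} (μ : PMF α) : Timed α := StateT.lift (OptionT.lift μ)

/-- Spend `t` steps. -/
def tick (t : ℕ) : Timed Unit := do
  let k ← get
  if k < t then failure else set (k - t)

/-- The distribution of the result when `k` steps are allowed; `none` means that the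
computation was stopped by the clock. -/
def dist {α : Type} (m : Timed α) (k : ℕ) : PMF (Option α) := (StateT.run' m k).run

end Timed

open Timed

/-- A uniform natural number below `n` (and `0` if `n = 0`). -/
def uniformBelow : ℕ → PMF ℕ
  | 0 => pure 0
  | n + 1 => (PMF.uniformOfFintype (Fin (n + 1))).map Fin.val

/-- At most `k` rounds of a while loop. Every round takes a step, so that with `k` the number of
allowed steps the bound on the rounds is never what stops the loop. -/
def loopAux (test body : Data → Timed Data) : ℕ → Data → Timed Data
  | 0, _ => failure
  | k + 1, x => do
    tick 1
    let b ← test x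
    if b = .num 0 then pure x
    else do
      let y ← body x
      loopAux test body k y

/-- Execution of a program. A basic instruction takes as many steps as the bits it reads and
writes; each control construct takes one additional step. -/
def Code.eval : Code → Data → Timed Data
  | .prim o, x => do
    tick (x.size + (o.apply x).size)
    pure (o.apply x)
  | .rand, x => do
    tick (2 * x.size)
    let i ← sample (uniformBelow x.toNat)
    pure (.num i)
  | .pair f g, x => do
    tick 1
    let a ← f.eval x
    let b ← g.eval x
    pure (.pair a b)
  | .comp f g, x => do
    tick 1
    let y ← g.eval x
    f.eval y
  | .ite c f g, x => do
    tick 1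
    let b ← c.eval x
    if b = .num 0 then g.eval x else f.eval x
  | .loop c f, x => do
    let k ← get
    loopAux (fun y => c.eval y) (fun y => f.eval y) k x

/-- On input `x` the program `c` returns `y`, within `k` steps, for all random choices. -/
def Code.Computes (c : Code) (k : ℕ) (x y : Data) : Prop :=
  ∀ o ∈ ((c.eval x).dist k).support, o = some y

/-! ## Bilinear groups -/

/-- Groups `G`, `GT` of the same prime order `p` with a bilinear map, whose elements are
represented by (unique) data. -/
structure BilinearGroup where
  p : ℕ
  prime : p.Prime
  G : Type
  GT : Type
  [groupG : CommGroup G]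
  [groupGT : CommGroup GT]
  [fintypeG : Fintype G]
  [fintypeGT : Fintype GT]
  card_G : Fintype.card G = p
  card_GT : Fintype.card GT = p
  e : G → G → GT
  bilinear : ∀ (g h : G) (a b : ℤ), e (g ^ a) (h ^ b) = e g h ^ (a * b)
  nondegenerate : ∀ g h : G, g ≠ 1 → h ≠ 1 → e g h ≠ 1
  enc : G → Data
  enc_injective : Function.Injective enc
  encT : GT → Data
  encT_injective : Function.Injective encT

attribute [instance] BilinearGroup.groupG BilinearGroup.groupGT BilinearGroup.fintypeG
  BilinearGroup.fintypeGT

instance (𝔾 : BilinearGroup) : Fact 𝔾.p.Prime := ⟨𝔾.prime⟩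

instance (𝔾 : BilinearGroup) : Nontrivial 𝔾.G :=
  Fintype.one_lt_card_iff_nontrivial.mp (𝔾.card_G ▸ 𝔾.prime.one_lt)

instance (𝔾 : BilinearGroup) : Nonempty {g : 𝔾.G // g ≠ 1} :=
  let ⟨g, hg⟩ := exists_ne (1 : 𝔾.G)
  ⟨⟨g, hg⟩⟩

open Classical in
/-- A family of bilinear groups: for the security parameter `n`, the description `d` of a
bilinear group `grp d` of prime order larger than `2 ^ n` is drawn from `gen n`. The group
operations and the pairing are computed, and group elements are recognized, by polynomial-time
programs that are given the description and the order of the group. -/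
structure BilinearFamily where
  gen : ℕ → PMF Data
  grp : Data → BilinearGroup
  order_gt : ∀ n, ∀ d ∈ (gen n).support, 2 ^ n < (grp d).p
  mul_efficient : ∃ (c : Code) (q : Polynomial ℕ), ∀ n, ∀ d ∈ (gen n).support,
    ∀ a b : (grp d).G, c.Computes (q.eval n)
      (.pair (.pair d (.num (grp d).p)) (.pair ((grp d).enc a) ((grp d).enc b)))
      ((grp d).enc (a * b))
  mulT_efficient : ∃ (c : Code) (q : Polynomial ℕ), ∀ n, ∀ d ∈ (gen n).support,
    ∀ a b : (grp d).GT, c.Computes (q.eval n)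
      (.pair (.pair d (.num (grp d).p)) (.pair ((grp d).encT a) ((grp d).encT b)))
      ((grp d).encT (a * b))
  e_efficient : ∃ (c : Code) (q : Polynomial ℕ), ∀ n, ∀ d ∈ (gen n).support,
    ∀ a b : (grp d).G, c.Computes (q.eval n)
      (.pair (.pair d (.num (grp d).p)) (.pair ((grp d).enc a) ((grp d).enc b)))
      ((grp d).encT ((grp d).e a b))
  mem_efficient : ∃ (c : Code) (q : Polynomial ℕ), ∀ n, ∀ d ∈ (gen n).support,
    ∀ y : Data, c.Computes (q.eval (n + y.size))
      (.pair (.pair d (.num (grp d).p)) y)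
      (.num (if y ∈ Set.range (grp d).enc then 1 else 0))

/-- The public description of a group: what `gen` returned, and the order. -/
def BilinearFamily.desc (𝓕 : BilinearFamily) (d : Data) : Data :=
  .pair d (.num (𝓕.grp d).p)

open Classical in
/-- A random generator (the elements other than `1` are the generators). -/
def BilinearGroup.randGenerator (𝔾 : BilinearGroup) : PMF 𝔾.G :=
  (PMF.uniformOfFintype {g : 𝔾.G // g ≠ 1}).map Subtype.val

/-- A function of the security parameter is negligible if it decays faster than the inverse of
every polynomial. -/
def Negligible (f : ℕ → ℝ) : Prop :=
  Asymptotics.SuperpolynomialDecay Filter.atTop (fun n : ℕ => (n : ℝ)) f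

/-! ## The computational Diffie-Hellman assumption -/

open Classical in
/-- The experiment in which `B`, given `g`, `g ^ a`, `g ^ b`, has to find `g ^ (a * b)`. -/
def BilinearFamily.cdhGame (𝓕 : BilinearFamily) (B : Code) (n : ℕ) : Timed Bool := do
  let d ← sample (𝓕.gen n)
  let 𝔾 := 𝓕.grp d
  let g ← sample 𝔾.randGenerator
  let a ← sample (PMF.uniformOfFintype (ZMod 𝔾.p)ˣ)
  let b ← sample (PMF.uniformOfFintype (ZMod 𝔾.p)ˣ)
  let out ← B.eval (.pair (.num n) (.pair (𝓕.desc d) (.pair (𝔾.enc g)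
    (.pair (𝔾.enc (g ^ a.val.val)) (𝔾.enc (g ^ b.val.val))))))
  pure (decide (out = 𝔾.enc (g ^ (a * b).val.val)))

/-- The probability that `B`, with `q n` steps, solves the Diffie-Hellman problem. -/
def BilinearFamily.cdhAdvantage (𝓕 : BilinearFamily) (B : Code) (q : Polynomial ℕ) (n : ℕ) : ℝ :=
  ((𝓕.cdhGame B n).dist (q.eval n) (some true)).toReal

/-- The computational Diffie-Hellman assumption. Probabilistic polynomial-time algorithms are
programs that run under a polynomial clock. -/
def BilinearFamily.CDH (𝓕 : BilinearFamily) : Prop :=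
  ∀ (B : Code) (q : Polynomial ℕ), Negligible (𝓕.cdhAdvantage B q)

/-! ## The scheme -/

/-- Master public key, together with the generator. -/
structure PublicKey (𝔾 : BilinearGroup) where
  g : 𝔾.G
  X : 𝔾.G
  Y : 𝔾.G
  Z : 𝔾.G
  h : 𝔾.G

/-- A triple of the shape of a decryption key. -/
structure Key (𝔾 : BilinearGroup) where
  d₁ : 𝔾.G
  d₂ : 𝔾.G
  d₃ : ZMod 𝔾.p

/-- `Setup` in a given group; the second component is the master secret key `x`. -/
def setup (𝔾 : BilinearGroup) : PMF (PublicKey 𝔾 × (ZMod 𝔾.p)ˣ) := do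
  let g ← 𝔾.randGenerator
  let h ← PMF.uniformOfFintype 𝔾.G
  let Y ← PMF.uniformOfFintype 𝔾.G
  let Z ← PMF.uniformOfFintype 𝔾.G
  let x ← PMF.uniformOfFintype (ZMod 𝔾.p)ˣ
  pure (⟨g, g ^ x.val.val, Y, Z, h⟩, x)

section Scheme

variable {𝔾 : BilinearGroup}

/-- The verification in the proof of knowledge of `(t₀, θ)` with `R = h ^ t₀ * X ^ θ`
(Okamoto's three-move protocol), for the first message `u`, the challenge `c` and the
response `(s, s')`. -/
def okamotoVerify (mpk : PublicKey 𝔾) (R u : 𝔾.G) (c s s' : ZMod 𝔾.p) : Prop :=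
  mpk.h ^ s.val * mpk.X ^ s'.val = u * R ^ c.val

/-- The PKG's final message in the key generation protocol for `ID`, on the commitment `R`. -/
def blindKey (mpk : PublicKey 𝔾) (x : (ZMod 𝔾.p)ˣ) (ID : ZMod 𝔾.p) (R : 𝔾.G) : PMF (Key 𝔾) := do
  let r' ← PMF.uniformOfFintype (ZMod 𝔾.p)ˣ
  let t₁ ← PMF.uniformOfFintype (ZMod 𝔾.p)ˣ
  pure ⟨(mpk.Y * R * mpk.h ^ t₁.val.val) ^ (x⁻¹).val.val * (mpk.g ^ ID.val * mpk.Z) ^ r'.val.val,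
    mpk.X ^ r'.val.val, t₁⟩

/-- Validity of a decryption key for the identity `ID`. -/
def Key.Valid (mpk : PublicKey 𝔾) (ID : ZMod 𝔾.p) (k : Key 𝔾) : Prop :=
  𝔾.e k.d₁ mpk.X =
    𝔾.e mpk.Y mpk.g * 𝔾.e mpk.h mpk.g ^ k.d₃.val * 𝔾.e (mpk.g ^ ID.val * mpk.Z) k.d₂

open Classical in
/-- `Trace`: the family number of a valid key, and `none` for an ill-formed one. -/
def trace (mpk : PublicKey 𝔾) (ID : ZMod 𝔾.p) (k : Key 𝔾) : Option (ZMod 𝔾.p) :=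
  if k.Valid mpk ID then some k.d₃ else none

/-! ## The game -/

variable (𝔾) in
open Classical in
/-- The group element represented by `y`, if there is one. -/
def decG (y : Data) : Option 𝔾.G :=
  if hy : ∃ a, 𝔾.enc a = y then some hy.choose else none

variable (𝔾) in
/-- The residue represented by a number; only the numbers below `p` represent one. -/
def decZ (m : ℕ) : Option (ZMod 𝔾.p) :=
  if m < 𝔾.p then some (m : ZMod 𝔾.p) else none

variable (𝔾) in
def decKey : Data → Option (Key 𝔾)
  | .pair y₁ (.pair y₂ (.num m)) => do
    let d₁ ← decG 𝔾 y₁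
    let d₂ ← decG 𝔾 y₂
    let d₃ ← decZ 𝔾 m
    pure ⟨d₁, d₂, d₃⟩
  | _ => none

def encKey (k : Key 𝔾) : Data :=
  .pair (𝔾.enc k.d₁) (.pair (𝔾.enc k.d₂) (.num k.d₃.val))

def encPublicKey (mpk : PublicKey 𝔾) : Data :=
  .pair (𝔾.enc mpk.g) (.pair (𝔾.enc mpk.X) (.pair (𝔾.enc mpk.Y)
    (.pair (𝔾.enc mpk.Z) (𝔾.enc mpk.h))))

variable (𝔾) in
/-- The messages of the adversary: she opens a run of the key generation protocol for `ID` with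
a commitment `R` and the first message `u` of the proof of knowledge, or answers the challenge
in the run for `ID`, or ends the game with two keys. -/
inductive Message : Type
  | start (ID : ZMod 𝔾.p) (R u : 𝔾.G) : Message
  | respond (ID s s' : ZMod 𝔾.p) : Message
  | output (k₁ k₂ : Key 𝔾) : Message

variable (𝔾) in
def decMessage : Data → Option (Message 𝔾)
  | .pair (.num 0) (.pair (.num i) (.pair y y')) => do
    let ID ← decZ 𝔾 i
    let R ← decG 𝔾 y
    let u ← decG 𝔾 y'
    pure (.start ID R u)
  | .pair (.num 1) (.pair (.num i) (.pair (.num j) (.num j'))) => do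
    let ID ← decZ 𝔾 i
    let s ← decZ 𝔾 j
    let s' ← decZ 𝔾 j'
    pure (.respond ID s s')
  | .pair (.num 2) (.pair y y') => do
    let k₁ ← decKey 𝔾 y
    let k₂ ← decKey 𝔾 y'
    pure (.output k₁ k₂)
  | _ => none

variable (𝔾) in
/-- The status of a run: the challenge `c` has been sent, or the run is over. -/
inductive Session : Type
  | waiting (R u : 𝔾.G) (c : ZMod 𝔾.p) : Session
  | closed : Session

/-- The replies of the PKG: `⊥`, a challenge, a blinded key. -/
def botReply : Data := .num 0

def challengeReply (c : ZMod 𝔾.p) : Data := .pair (.num 1) (.num c.val)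

def keyReply (k : Key 𝔾) : Data := .pair (.num 2) (encKey k)

open Classical in
/-- The PKG's side of all runs of the key generation protocol. The table `S` holds the runs, at
most one for each identity; runs for distinct identities may be interleaved in any way. -/
def pkgStep (mpk : PublicKey 𝔾) (x : (ZMod 𝔾.p)ˣ) (S : ZMod 𝔾.p → Option (Session 𝔾)) :
    Option (Message 𝔾) → PMF (Data × (ZMod 𝔾.p → Option (Session 𝔾)))
  | some (.start ID R u) =>
    match S ID with
    | none => do
      let c ← PMF.uniformOfFintype (ZMod 𝔾.p)
      pure (challengeReply c, Function.update S ID (some (.waiting R u c)))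
    | some _ => pure (botReply, S)
  | some (.respond ID s s') =>
    match S ID with
    | some (.waiting R u c) =>
      if okamotoVerify mpk R u c s s' then do
        let k ← blindKey mpk x ID R
        pure (keyReply k, Function.update S ID (some .closed))
      else pure (botReply, Function.update S ID (some .closed))
    | _ => pure (botReply, S)
  | _ => pure (botReply, S)

/-- Two keys win for `ID` if both are valid and they have distinct family numbers. -/
def Wins (mpk : PublicKey 𝔾) (ID : ZMod 𝔾.p) (k₁ k₂ : Key 𝔾) : Prop :=
  trace mpk ID k₁ ≠ none ∧ trace mpk ID k₂ ≠ none ∧ trace mpk ID k₂ ≠ trace mpk ID k₁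

open Classical in
/-- The interaction of the adversary `A` with the PKG, up to the given number of activations of
`A`. In an activation, `A` maps her state and the incoming message to her new state and
her next message. -/
def interact (A : Code) (mpk : PublicKey 𝔾) (x : (ZMod 𝔾.p)ˣ) (IDstar : ZMod 𝔾.p) :
    ℕ → (ZMod 𝔾.p → Option (Session 𝔾)) → Data → Data → Timed Bool
  | 0, _, _, _ => pure false
  | k + 1, S, st, m => do
    let out ← A.eval (.pair st m)
    match out with
    | .num _ => pure false
    | .pair st' m' =>
      match decMessage 𝔾 m' with
      | some (.output k₁ k₂) => pure (decide (Wins mpk IDstar k₁ k₂))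
      | o => do
        let r ← sample (pkgStep mpk x S o)
        interact A mpk x IDstar k r.2 st' r.1

end Scheme

/-- The selective-ID ComputeNewKey game. Given the description of the group, which
determines the set `ZMod p` of identities, `A` announces the target identity; then the keys of
the PKG are generated, and `A` interacts with the PKG. The clock counts all the steps of `A`;
every activation takes a step, so that the bound `k` on the activations is never what
stops `A`. -/
def BilinearFamily.newKeyGame (𝓕 : BilinearFamily) (A : Code) (n : ℕ) : Timed Bool := do
  let d ← sample (𝓕.gen n)
  let 𝔾 := 𝓕.grp d
  let out ← A.eval (.pair (.num 0) (.pair (.num n) (𝓕.desc d)))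
  match out with
  | .pair st (.num i) =>
    match decZ 𝔾 i with
    | some IDstar => do
      let keys ← sample (setup 𝔾)
      let k ← get
      interact A keys.1 keys.2 IDstar k (fun _ => none) st (encPublicKey keys.1)
    | none => pure false
  | _ => pure false

/-- The probability that `A`, with `q n` steps, wins the selective-ID ComputeNewKey game. -/
def BilinearFamily.newKeyAdvantage (𝓕 : BilinearFamily) (A : Code) (q : Polynomial ℕ) (n : ℕ) :
    ℝ :=
  ((𝓕.newKeyGame A n).dist (q.eval n) (some true)).toReal

end AIBE

end

/-!
Two valid keys for the target identity with distinct family numbers yield the solution of a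
Diffie-Hellman challenge. Let `X, X ^ a, X ^ b` be given, and let the public key have `g = X ^ a`,
`h = X ^ b` and `Z = g ^ (-IDstar) * X ^ z`, so that the master secret is `a⁻¹`. Then the equation
of validity determines `d₁ * d₂ ^ (-z)` as `(Y * h ^ d₃) ^ a`, and the quotient of two such
elements is a known power of `h ^ a = X ^ (a * b)` (`AIBE.Wins.solve_eq`).

The key authority has to be simulated without `a`. For identities other than `IDstar` the element
`g ^ ID * Z` is a nonzero power of `g` times a known power of `X`, and the exponent `r'` of the key
can be shifted so that the unknown factor cancels. For `IDstar` that is impossible; instead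
`Y = X ^ y * h ^ (-t)`, so that exactly one family number can be served: if `R = h ^ t₀ * X ^ θ`, a
key with family number `t - t₀` only requires `X ^ (a * (y + θ)) = g ^ (y + θ)`. The exponents
`t₀, θ` come from rewinding the adversary to the challenge in the run for `IDstar`. As `t` is
independent of the public key, this family number is uniform.

The rewinding is analysed without a forking lemma for the whole game. At the state in which the
adversary receives the challenge, either she answers a random challenge with probability at least
`ε`, in which case a single rewinding costs a factor `ε`; or she does not, in which case the
run for `IDstar` may be stopped at a cost of `ε` (`AIBE.mul_ex_value_waiting_le`). Thus, if `α` and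
`β` are the probabilities of success in the game and against the challenge,
`ε * α ≤ β + ε ^ 2 + δ` for every `ε ≤ 1`, where `δ` is negligible, and `ε = α / 2` gives
`α ^ 2 ≤ 4 * (β + δ)` (`AIBE.exists_advantage_sq_le`).

The other half of the argument is that the simulation is a program of the machine model which
respects a polynomial clock. Randomized computations are compared through the expectation
`AIBE.Timed.ev` of functions of the result and of the steps that are left. A family of
computations is efficient (`AIBE.Eff`) if a single program, on data that represent the index,
dominates it at the price of polynomially many additional steps. Efficient families are
closed under composition, branching and bounded iteration (`AIBE.Eff.bind`, `AIBE.Eff.cases`,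
`AIBE.Eff.loop`), and `AIBE.exists_code_solver` puts the reduction together from such pieces.
-/

noncomputable section

namespace AIBE

open scoped ENNReal
open Timed

variable {𝓕 : BilinearFamily}

/-! ### Expectations under a clock -/

/-- The expectation of a nonnegative function. -/
def ex {α : Type} (μ : PMF α) (f : α → ℝ≥0∞) : ℝ≥0∞ := ∑' a, μ a * f a

theorem ex_pure {α : Type} (a : α) (f : α → ℝ≥0∞) : ex (pure a : PMF α) f = f a := by
  unfold ex
  rw [tsum_eq_single a]
  · change PMF.pure a a * _ = _
    simp
  · intro b hb
    change PMF.pure a b * _ = _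
    simp [hb]

theorem ex_bind {α β : Type} (μ : PMF α) (g : α → PMF β) (f : β → ℝ≥0∞) :
    ex (μ >>= g) f = ex μ fun a => ex (g a) f := by
  unfold ex
  change ∑' b, (μ.bind g) b * f b = _
  simp only [PMF.bind_apply, ← ENNReal.tsum_mul_right, ← ENNReal.tsum_mul_left]
  rw [ENNReal.tsum_comm]
  simp only [mul_assoc]

theorem ex_map {α β : Type} (μ : PMF α) (g : α → β) (f : β → ℝ≥0∞) :
    ex (μ.map g) f = ex μ fun a => f (g a) := by
  change ex (μ >>= fun a => pure (g a)) f = _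
  simp only [ex_bind, ex_pure]

theorem ex_mono_support {α : Type} {μ : PMF α} {f g : α → ℝ≥0∞}
    (h : ∀ a ∈ μ.support, f a ≤ g a) : ex μ f ≤ ex μ g := by
  refine ENNReal.tsum_le_tsum fun a => ?_
  by_cases ha : μ a = 0
  · simp [ha]
  · exact mul_le_mul_right (h a ((PMF.mem_support_iff _ _).2 ha)) _

theorem ex_mono {α : Type} {μ : PMF α} {f g : α → ℝ≥0∞} (h : ∀ a, f a ≤ g a) :
    ex μ f ≤ ex μ g :=
  ex_mono_support fun a _ => h a

theorem ex_add {α : Type} (μ : PMF α) (f g : α → ℝ≥0∞) :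
    ex μ (fun a => f a + g a) = ex μ f + ex μ g := by
  simp only [ex, mul_add, ENNReal.tsum_add]

theorem ex_const_mul {α : Type} (μ : PMF α) (c : ℝ≥0∞) (f : α → ℝ≥0∞) :
    ex μ (fun a => c * f a) = c * ex μ f := by
  simp only [ex, ← ENNReal.tsum_mul_left]
  exact tsum_congr fun a => by ring

theorem ex_const {α : Type} (μ : PMF α) (c : ℝ≥0∞) : ex μ (fun _ => c) = c := by
  simp only [ex, ENNReal.tsum_mul_right, PMF.tsum_coe, one_mul]

theorem ex_comm {α β : Type} (μ : PMF α) (ν : PMF β) (f : α → β → ℝ≥0∞) :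
    ex μ (fun a => ex ν fun b => f a b) = ex ν fun b => ex μ fun a => f a b := by
  simp only [ex, ← ENNReal.tsum_mul_left]
  rw [ENNReal.tsum_comm]
  exact tsum_congr fun b => tsum_congr fun a => by ring

theorem ex_le_one {α : Type} {μ : PMF α} {f : α → ℝ≥0∞} (h : ∀ a, f a ≤ 1) : ex μ f ≤ 1 :=
  (ex_mono h).trans_eq (ex_const μ 1)

theorem le_ex_of_support {α : Type} {μ : PMF α} {f : α → ℝ≥0∞} {c : ℝ≥0∞}
    (h : ∀ a ∈ μ.support, c ≤ f a) : c ≤ ex μ f :=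
  (ex_const μ c).symm.trans_le (ex_mono_support h)

namespace Timed

variable {α β : Type}

/-- All outcomes of a timed computation: the result with the steps that are left, or a stop. -/
def law (m : Timed α) (k : ℕ) : PMF (Option (α × ℕ)) := (m.run k).run

/-- Extends a function of the result and the remaining steps by `0` to stopped computations. -/
def optVal (f : α → ℕ → ℝ≥0∞) : Option (α × ℕ) → ℝ≥0∞
  | none => 0
  | some (a, k) => f a k

/-- The expectation of `f (result) (remaining steps)` when `k` steps are allowed; stopped
computations contribute `0`. -/
def ev (m : Timed α) (f : α → ℕ → ℝ≥0∞) (k : ℕ) : ℝ≥0∞ := ex (m.law k) (optVal f)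

/-- With `k` steps allowed, the result can be `a` with `k'` steps left. -/
def Reach (m : Timed α) (k : ℕ) (a : α) (k' : ℕ) : Prop := some (a, k') ∈ (m.law k).support

theorem law_bind (m : Timed α) (g : α → Timed β) (k : ℕ) :
    (m >>= g).law k = (m.law k) >>= fun o => match o with
      | none => pure none
      | some (a, k') => (g a).law k' := by
  unfold law
  rw [StateT.run_bind, OptionT.run_bind, Option.elimM]
  congr 1
  funext o
  cases o <;> rfl

theorem law_pure (a : α) (k : ℕ) : (pure a : Timed α).law k = pure (some (a, k)) := rfl

theorem law_sample (μ : PMF α) (k : ℕ) :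
    (sample μ).law k = μ >>= fun a => pure (some (a, k)) := by
  change ((μ >>= fun a => pure (some a) : PMF (Option α)) >>= fun o => match o with
      | some p => pure (some (p, k))
      | none => pure none : PMF (Option (α × ℕ))) = _
  simp only [bind_assoc, pure_bind]

theorem law_failure (k : ℕ) : (failure : Timed α).law k = pure none := rfl

theorem law_tick (t k : ℕ) :
    (tick t).law k = if k < t then pure none else pure (some ((), k - t)) := by
  have : (tick t).law k = ((if k < t then failure else set (k - t)) : Timed Unit).law k := by
    change ((get : Timed ℕ) >>= fun j => if j < t then failure else set (j - t)).law k = _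
    rw [law_bind]
    change ((pure (some (k, k)) : PMF (Option (ℕ × ℕ))) >>= _) = _
    rw [pure_bind]
  rw [this]
  split_ifs <;> rfl

theorem law_get (k : ℕ) : (get : Timed ℕ).law k = pure (some (k, k)) := rfl

@[simp] theorem ev_bind (m : Timed α) (g : α → Timed β) (f : β → ℕ → ℝ≥0∞) (k : ℕ) :
    ev (m >>= g) f k = ev m (fun a k' => ev (g a) f k') k := by
  unfold ev
  rw [law_bind, ex_bind]
  congr 1
  funext o
  cases o with
  | none => simp [ex_pure, optVal]
  | some p => rfl

@[simp] theorem ev_pure (a : α) (f : α → ℕ → ℝ≥0∞) (k : ℕ) : ev (pure a) f k = f a k := by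
  simp [ev, law_pure, ex_pure, optVal]

@[simp] theorem ev_map (g : α → β) (m : Timed α) (f : β → ℕ → ℝ≥0∞) (k : ℕ) :
    ev (g <$> m) f k = ev m (fun a => f (g a)) k := by
  have : g <$> m = m >>= fun a => pure (g a) := by
    funext k
    rfl
  rw [this, ev_bind]
  simp only [ev_pure]

@[simp] theorem ev_sample (μ : PMF α) (f : α → ℕ → ℝ≥0∞) (k : ℕ) :
    ev (sample μ) f k = ex μ fun a => f a k := by
  unfold ev
  rw [law_sample, ex_bind]
  simp only [ex_pure, optVal]

@[simp] theorem ev_failure (f : α → ℕ → ℝ≥0∞) (k : ℕ) : ev failure f k = 0 := by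
  simp [ev, law_failure, ex_pure, optVal]

@[simp] theorem ev_tick (t : ℕ) (f : Unit → ℕ → ℝ≥0∞) (k : ℕ) :
    ev (tick t) f k = if k < t then 0 else f () (k - t) := by
  unfold ev
  rw [law_tick]
  split_ifs <;> simp [ex_pure, optVal]

@[simp] theorem ev_get (f : ℕ → ℕ → ℝ≥0∞) (k : ℕ) : ev get f k = f k k := by
  simp [ev, law_get, ex_pure, optVal]

theorem ev_mono_reach {m : Timed α} {f g : α → ℕ → ℝ≥0∞} {k : ℕ}
    (h : ∀ a k', Reach m k a k' → f a k' ≤ g a k') : ev m f k ≤ ev m g k := by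
  refine ex_mono_support fun o ho => ?_
  match o with
  | none => exact le_rfl
  | some (a, k') => exact h a k' ho

theorem ev_mono {m : Timed α} {f g : α → ℕ → ℝ≥0∞} {k : ℕ}
    (h : ∀ a k', f a k' ≤ g a k') : ev m f k ≤ ev m g k :=
  ev_mono_reach fun a k' _ => h a k'

theorem ev_add (m : Timed α) (f g : α → ℕ → ℝ≥0∞) (k : ℕ) :
    ev m (fun a k' => f a k' + g a k') k = ev m f k + ev m g k := by
  unfold ev
  rw [← ex_add]
  congr 1
  funext o
  match o with
  | none => simp [optVal]
  | some (a, k') => rfl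

theorem ev_const_mul (m : Timed α) (c : ℝ≥0∞) (f : α → ℕ → ℝ≥0∞) (k : ℕ) :
    ev m (fun a k' => c * f a k') k = c * ev m f k := by
  unfold ev
  rw [← ex_const_mul]
  congr 1
  funext o
  match o with
  | none => simp [optVal]
  | some (a, k') => rfl

theorem ev_const_le (m : Timed α) (c : ℝ≥0∞) (k : ℕ) : ev m (fun _ _ => c) k ≤ c := by
  refine (ex_mono (g := fun _ => c) fun o => ?_).trans_eq (ex_const _ c)
  match o with
  | none => exact zero_le
  | some (a, k') => exact le_rfl

theorem ev_le_one {m : Timed α} {f : α → ℕ → ℝ≥0∞} {k : ℕ} (h : ∀ a k', f a k' ≤ 1) :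
    ev m f k ≤ 1 :=
  (ev_mono h).trans (ev_const_le m 1 k)

theorem ev_ex (m : Timed α) (μ : PMF β) (f : β → α → ℕ → ℝ≥0∞) (k : ℕ) :
    ev m (fun a k' => ex μ fun b => f b a k') k = ex μ fun b => ev m (f b) k := by
  unfold ev
  rw [ex_comm]
  congr 1
  funext o
  match o with
  | none => simp [optVal, ex_const]
  | some (a, k') => rfl

theorem reach_bind {m : Timed α} {g : α → Timed β} {k : ℕ} {b : β} {k' : ℕ} :
    Reach (m >>= g) k b k' ↔ ∃ a j, Reach m k a j ∧ Reach (g a) j b k' := by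
  unfold Reach
  rw [law_bind]
  change some (b, k') ∈ (PMF.bind _ _).support ↔ _
  rw [PMF.mem_support_bind_iff]
  constructor
  · rintro ⟨o, ho, h⟩
    match o, ho, h with
    | none, _, h => exact absurd ((PMF.mem_support_pure_iff _ _).1 h) (by simp)
    | some (a, j), ho, h => exact ⟨a, j, ho, h⟩
  · rintro ⟨a, j, h1, h2⟩
    exact ⟨some (a, j), h1, h2⟩

theorem reach_pure {a b : α} {k k' : ℕ} : Reach (pure a) k b k' ↔ b = a ∧ k' = k := by
  unfold Reach
  rw [law_pure]
  change _ ∈ (PMF.pure _).support ↔ _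
  simp

theorem reach_sample {μ : PMF α} {b : α} {k k' : ℕ} :
    Reach (sample μ) k b k' ↔ b ∈ μ.support ∧ k' = k := by
  unfold Reach
  rw [law_sample]
  change _ ∈ (PMF.bind _ _).support ↔ _
  rw [PMF.mem_support_bind_iff]
  constructor
  · rintro ⟨a, ha, h⟩
    have := (PMF.mem_support_pure_iff _ _).1 h
    simp only [Option.some.injEq, Prod.mk.injEq] at this
    exact ⟨this.1 ▸ ha, this.2⟩
  · rintro ⟨h, rfl⟩
    exact ⟨b, h, (PMF.mem_support_pure_iff _ _).2 rfl⟩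

theorem reach_failure {b : α} {k k' : ℕ} : ¬ Reach failure k b k' := by
  unfold Reach
  rw [law_failure]
  change ¬ _ ∈ (PMF.pure _).support
  simp

theorem reach_tick {t : ℕ} {b : Unit} {k k' : ℕ} : Reach (tick t) k b k' ↔ k' + t = k := by
  unfold Reach
  rw [law_tick]
  split_ifs with h
  · change _ ∈ (PMF.pure _).support ↔ _
    simp only [PMF.support_pure, Set.mem_singleton_iff, reduceCtorEq, false_iff]
    omega
  · change _ ∈ (PMF.pure _).support ↔ _
    simp only [PMF.support_pure, Set.mem_singleton_iff, Option.some.injEq, Prod.mk.injEq]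
    constructor
    · rintro ⟨-, h⟩
      omega
    · intro h
      exact ⟨trivial, by omega⟩

/-- If every outcome of nonzero probability satisfies a property, so does one that witnesses a
positive expectation. -/
theorem exists_reach_of_ev_pos {m : Timed α} {f : α → ℕ → ℝ≥0∞} {k : ℕ} (h : 0 < ev m f k) :
    ∃ a k', Reach m k a k' ∧ 0 < f a k' := by
  by_contra hn
  push Not at hn
  have : ev m f k ≤ ev m (fun _ _ => 0) k := ev_mono_reach fun a k' hr => hn a k' hr
  exact absurd (this.trans (ev_const_le m 0 k)) (not_le.2 h)

theorem le_ev_of_reach {m : Timed α} {f : α → ℕ → ℝ≥0∞} {k : ℕ} {a : α} {k' : ℕ}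
    (h : Reach m k a k') (hf : 0 < f a k') : 0 < ev m f k := by
  unfold ev ex
  have h1 : m.law k (some (a, k')) ≠ 0 := (PMF.mem_support_iff _ _).1 h
  refine lt_of_lt_of_le ?_ (ENNReal.le_tsum (some (a, k')))
  exact ENNReal.mul_pos h1 hf.ne'

theorem dist_some (m : Timed α) (k : ℕ) (a : α) :
    m.dist k (some a) = ev m (fun b _ => open Classical in if b = a then 1 else 0) k := by
  classical
  have : m.dist k = (m.law k).map (Option.map Prod.fst) := by
    unfold dist law
    rw [StateT.run'_eq, OptionT.run_map]
    rfl
  have h2 : ∀ μ : PMF (Option α), μ (some a) = ex μ fun o => if o = some a then 1 else 0 := by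
    intro μ
    unfold ex
    rw [tsum_eq_single (some a)]
    · simp
    · intro b hb
      simp [hb]
  rw [h2, this, ex_map]
  unfold ev
  congr 1
  funext o
  match o with
  | none => simp [optVal]
  | some (b, j) => simp [optVal]

end Timed

/-! ### Clocks and sizes of programs -/

namespace Timed

variable {α β : Type}

/-- The behaviour of computations that use the clock only to pay for steps: further steps are
left over or used, and never hurt, and the clock does not run backwards. -/
structure Clocked (m : Timed α) : Prop where
  shift : ∀ (f : α → ℕ → ℝ≥0∞) (k e : ℕ), ev m (fun a k' => f a (k' + e)) k ≤ ev m f (k + e)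
  le : ∀ {k a k'}, Reach m k a k' → k' ≤ k

theorem Clocked.pure (a : α) : Clocked (pure a : Timed α) :=
  ⟨fun f k e => by simp, fun h => (reach_pure.1 h).2.le⟩

theorem Clocked.sample (μ : PMF α) : Clocked (sample μ) :=
  ⟨fun f k e => by simp, fun h => (reach_sample.1 h).2.le⟩

theorem Clocked.failure : Clocked (failure : Timed α) :=
  ⟨fun f k e => by simp, fun h => (reach_failure h).elim⟩

theorem Clocked.tick (t : ℕ) : Clocked (tick t) := by
  refine ⟨fun f k e => ?_, fun h => by have := reach_tick.1 h; omega⟩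
  rw [ev_tick, ev_tick]
  split_ifs with h1 h2 h2
  · exact le_rfl
  · exact zero_le
  · omega
  · rw [show k - t + e = k + e - t by omega]

theorem Clocked.bind {m : Timed α} {g : α → Timed β} (hm : Clocked m) (hg : ∀ a, Clocked (g a)) :
    Clocked (m >>= g) := by
  refine ⟨fun f k e => ?_, fun h => ?_⟩
  · rw [ev_bind, ev_bind]
    exact (ev_mono fun a k' => (hg a).shift f k' e).trans
      (hm.shift (fun a k' => ev (g a) f k') k e)
  · obtain ⟨a, j, h1, h2⟩ := reach_bind.1 h
    exact ((hg a).le h2).trans (hm.le h1)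

/-- The expectation of a monotone function of the clock is monotone in the clock. -/
theorem Clocked.mono {m : Timed α} (hm : Clocked m) {f : α → ℕ → ℝ≥0∞}
    (hf : ∀ a, Monotone (f a)) : Monotone (ev m f) := by
  intro k k' hk
  obtain ⟨e, rfl⟩ := Nat.exists_eq_add_of_le hk
  exact (ev_mono fun a j => hf a (Nat.le_add_right j e)).trans (hm.shift f k e)

end Timed

theorem loopAux_clocked {test body : Data → Timed Data} (ht : ∀ x, Clocked (test x))
    (hb : ∀ x, Clocked (body x)) (n : ℕ) (x : Data) : Clocked (loopAux test body n x) := by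
  induction n generalizing x with
  | zero => exact Clocked.failure
  | succ n ih =>
    refine (Clocked.tick 1).bind fun _ => (ht x).bind fun b => ?_
    split_ifs
    · exact Clocked.pure x
    · exact (hb x).bind fun y => ih y

theorem ev_loopAux_le_succ {test body : Data → Timed Data} (f : Data → ℕ → ℝ≥0∞) (n : ℕ)
    (x : Data) (k : ℕ) :
    ev (loopAux test body n x) f k ≤ ev (loopAux test body (n + 1) x) f k := by
  induction n generalizing x k with
  | zero => simp [loopAux]
  | succ n ih =>
    rw [loopAux, loopAux, ev_bind, ev_bind]
    refine ev_mono fun _ k1 => ?_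
    rw [ev_bind, ev_bind]
    refine ev_mono fun b k2 => ?_
    split_ifs
    · exact le_rfl
    · rw [ev_bind, ev_bind]
      exact ev_mono fun y k3 => ih y k3

theorem ev_loopAux_mono {test body : Data → Timed Data} (f : Data → ℕ → ℝ≥0∞) (x : Data) (k : ℕ) :
    Monotone fun n => ev (loopAux test body n x) f k :=
  monotone_nat_of_le_succ fun n => ev_loopAux_le_succ f n x k

theorem eval_loop_law (c f : Code) (x : Data) (k : ℕ) :
    ((Code.loop c f).eval x).law k =
      (loopAux (fun y => c.eval y) (fun y => f.eval y) k x).law k := by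
  rw [Code.eval, law_bind, law_get, pure_bind]

theorem ev_loop (c f : Code) (x : Data) (φ : Data → ℕ → ℝ≥0∞) (k : ℕ) :
    ev ((Code.loop c f).eval x) φ k =
      ev (loopAux (fun y => c.eval y) (fun y => f.eval y) k x) φ k := by
  unfold ev
  rw [eval_loop_law]

theorem size_uniformBelow_le {n i : ℕ} (h : i ∈ (uniformBelow n).support) :
    Nat.size i ≤ Nat.size n := by
  cases n with
  | zero =>
    have : i = 0 := (PMF.mem_support_pure_iff _ _).1 h
    simp [this]
  | succ n =>
    obtain ⟨j, -, rfl⟩ := (PMF.mem_support_map_iff _ _ _).1 h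
    exact Nat.size_le_size j.2.le

/-- A program pays for reading its input and for writing its output. -/
theorem Code.reach_size (c : Code) {x : Data} {k : ℕ} {y : Data} {k' : ℕ}
    (h : Reach (c.eval x) k y k') : x.size + k' ≤ k ∧ y.size + k' ≤ k := by
  induction c generalizing x k y k' with
  | prim o =>
    rw [Code.eval] at h
    obtain ⟨_, j, h1, h2⟩ := reach_bind.1 h
    have := reach_tick.1 h1
    obtain ⟨rfl, rfl⟩ := reach_pure.1 h2
    omega
  | rand =>
    rw [Code.eval] at h
    obtain ⟨_, j, h1, h⟩ := reach_bind.1 h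
    obtain ⟨i, j', h2, h3⟩ := reach_bind.1 h
    have := reach_tick.1 h1
    obtain ⟨hi, rfl⟩ := reach_sample.1 h2
    obtain ⟨rfl, rfl⟩ := reach_pure.1 h3
    have hs := size_uniformBelow_le hi
    have : Nat.size x.toNat + 1 ≤ x.size := by
      cases x with
      | num n => exact le_rfl
      | pair a b => simp [Data.toNat, Data.size]
    simp only [Data.size]
    omega
  | pair f g ihf ihg =>
    rw [Code.eval] at h
    obtain ⟨_, j, h1, h⟩ := reach_bind.1 h
    obtain ⟨a, j1, h2, h⟩ := reach_bind.1 h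
    obtain ⟨b, j2, h3, h4⟩ := reach_bind.1 h
    have := reach_tick.1 h1
    have := ihf h2
    have := ihg h3
    obtain ⟨rfl, rfl⟩ := reach_pure.1 h4
    simp only [Data.size]
    omega
  | comp f g ihf ihg =>
    rw [Code.eval] at h
    obtain ⟨_, j, h1, h⟩ := reach_bind.1 h
    obtain ⟨a, j1, h2, h3⟩ := reach_bind.1 h
    have := reach_tick.1 h1
    have := ihg h2
    have := ihf h3
    omega
  | ite c f g ihc ihf ihg =>
    rw [Code.eval] at h
    obtain ⟨_, j, h1, h⟩ := reach_bind.1 h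
    obtain ⟨a, j1, h2, h3⟩ := reach_bind.1 h
    have := reach_tick.1 h1
    have := ihc h2
    split_ifs at h3
    · have := ihg h3
      omega
    · have := ihf h3
      omega
  | loop c f ihc ihf =>
    have key : ∀ (n : ℕ) {x k}, Reach (loopAux (fun y => c.eval y) (fun y => f.eval y) n x) k y k' →
        x.size + k' ≤ k ∧ y.size + k' ≤ k := by
      intro n
      induction n with
      | zero => exact fun h => (reach_failure h).elim
      | succ n ih =>
        intro x k h
        rw [loopAux] at h
        obtain ⟨_, j, h1, h⟩ := reach_bind.1 h
        obtain ⟨a, j1, h2, h3⟩ := reach_bind.1 h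
        have := reach_tick.1 h1
        have := ihc h2
        split_ifs at h3
        · obtain ⟨rfl, rfl⟩ := reach_pure.1 h3
          omega
        · obtain ⟨z, j2, h4, h5⟩ := reach_bind.1 h3
          have := ihf h4
          have := ih h5
          omega
    exact key k (by unfold Reach at h ⊢; rwa [eval_loop_law] at h)

theorem Code.eval_clocked (c : Code) (x : Data) : Clocked (c.eval x) := by
  refine ⟨?_, fun h => by have := c.reach_size h; omega⟩
  induction c generalizing x with
  | prim o =>
    rw [Code.eval]
    exact ((Clocked.tick _).bind fun _ => Clocked.pure _).shift
  | rand =>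
    rw [Code.eval]
    exact ((Clocked.tick _).bind fun _ => (Clocked.sample _).bind fun _ => Clocked.pure _).shift
  | pair f g ihf ihg =>
    have hf : ∀ x, Clocked (f.eval x) := fun x =>
      ⟨ihf x, fun h => by have := f.reach_size h; omega⟩
    have hg : ∀ x, Clocked (g.eval x) := fun x =>
      ⟨ihg x, fun h => by have := g.reach_size h; omega⟩
    rw [Code.eval]
    exact ((Clocked.tick _).bind fun _ => (hf x).bind fun _ => (hg x).bind fun _ =>
      Clocked.pure _).shift
  | comp f g ihf ihg =>
    have hf : ∀ x, Clocked (f.eval x) := fun x =>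
      ⟨ihf x, fun h => by have := f.reach_size h; omega⟩
    have hg : ∀ x, Clocked (g.eval x) := fun x =>
      ⟨ihg x, fun h => by have := g.reach_size h; omega⟩
    rw [Code.eval]
    exact ((Clocked.tick _).bind fun _ => (hg x).bind fun y => hf y).shift
  | ite c f g ihc ihf ihg =>
    have hc : ∀ x, Clocked (c.eval x) := fun x =>
      ⟨ihc x, fun h => by have := c.reach_size h; omega⟩
    have hf : ∀ x, Clocked (f.eval x) := fun x =>
      ⟨ihf x, fun h => by have := f.reach_size h; omega⟩
    have hg : ∀ x, Clocked (g.eval x) := fun x =>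
      ⟨ihg x, fun h => by have := g.reach_size h; omega⟩
    rw [Code.eval]
    refine ((Clocked.tick _).bind fun _ => (hc x).bind fun b => ?_).shift
    split_ifs
    · exact hg x
    · exact hf x
  | loop c f ihc ihf =>
    have hc : ∀ x, Clocked (c.eval x) := fun x =>
      ⟨ihc x, fun h => by have := c.reach_size h; omega⟩
    have hf : ∀ x, Clocked (f.eval x) := fun x =>
      ⟨ihf x, fun h => by have := f.reach_size h; omega⟩
    intro φ k e
    rw [ev_loop, ev_loop]
    exact ((loopAux_clocked (fun y => hc y) (fun y => hf y) k x).shift φ k e).trans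
      (ev_loopAux_mono φ x (k + e) (Nat.le_add_right k e))

/-! ### Implementations of timed computations by programs -/

/-- On input `x` the program `c` does at least as well as the computation `m`, whose results are
encoded by `enc`, if it is granted `T` further steps. The relation is one-sided, because a reduction
only needs a lower bound on its success, so that where `m` fails `c` may do anything. Only clocks up
to `M` are considered, which bounds the results of `m`. -/
structure Impl {V : Type} (c : Code) (x : Data) (enc : V → Data) (m : Timed V) (M T : ℕ) : Prop
    where
  le : ∀ {k v k'}, k ≤ M → Reach m k v k' → k' ≤ k
  ev_le : ∀ k ≤ M, ∀ (e : ℕ) (f : Data → ℕ → ℝ≥0∞), (∀ y, Monotone (f y)) →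
    ev m (fun v k' => f (enc v) (k' + e)) k ≤ ev (c.eval x) f (k + e + T)

namespace Impl

variable {V W : Type} {c c' : Code} {x : Data} {enc : V → Data} {m : Timed V} {M T : ℕ}

theorem mono (h : Impl c x enc m M T) {T' : ℕ} (hT : T ≤ T') : Impl c x enc m M T' :=
  ⟨h.le, fun k hk e f hf => (h.ev_le k hk e f hf).trans
    ((c.eval_clocked x).mono hf (by omega))⟩

/-- The size of a result is bounded by the steps spent on it. -/
theorem size_le (h : Impl c x enc m M T) {k : ℕ} (hk : k ≤ M) {v : V} {k' : ℕ}
    (hr : Reach m k v k') : (enc v).size + k' ≤ k + T ∧ x.size + k' ≤ k + T := by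
  classical
  let f : Data → ℕ → ℝ≥0∞ := fun y j => if y = enc v ∧ k' ≤ j then 1 else 0
  have hf : ∀ y, Monotone (f y) := by
    intro y i j hij
    simp only [f]
    split_ifs with h1 h2
    · exact le_rfl
    · exact absurd ⟨h1.1, h1.2.trans hij⟩ h2
    · exact zero_le
    · exact le_rfl
  have h0 : 0 < ev m (fun v k' => f (enc v) (k' + 0)) k :=
    le_ev_of_reach hr (by simp [f])
  obtain ⟨y, j, hr', hp⟩ := exists_reach_of_ev_pos (h0.trans_le (h.ev_le k hk 0 f hf))
  have : y = enc v ∧ k' ≤ j := by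
    by_contra hn
    simp [f, hn] at hp
  have := c.reach_size hr'
  obtain ⟨rfl, _⟩ : y = enc v ∧ k' ≤ j := ‹_›
  omega

end Impl

/-- A family of timed computations `m i`, with results encoded by `enc i`, is implemented by one
program, on the inputs `inp i`, with a number of additional steps that is polynomial in `sz i`. -/
def Eff {I : Type} (sz : I → ℕ) (inp : I → Data) {V : I → Type} (enc : ∀ i, V i → Data)
    (m : ∀ i, Timed (V i)) : Prop :=
  ∃ (c : Code) (q : Polynomial ℕ), ∀ i, Impl c (inp i) (enc i) (m i) (sz i) (q.eval (sz i))

/-- The data `out i` can be computed from the data `inp i` in polynomial time. -/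
def Comp {I : Type} (sz : I → ℕ) (inp out : I → Data) : Prop :=
  Eff sz inp (V := fun _ => Data) (fun _ y => y) fun i => pure (out i)

/-- Polynomially bounded size. -/
def Bounded {I : Type} (sz : I → ℕ) (x : I → ℕ) : Prop :=
  ∃ q : Polynomial ℕ, ∀ i, x i ≤ q.eval (sz i)

section Bounded

variable {I : Type} {sz : I → ℕ} {x y : I → ℕ}

theorem polyEval_mono (q : Polynomial ℕ) : Monotone fun n : ℕ => q.eval n := by
  intro a b h
  simp only [Polynomial.eval_eq_sum]
  exact Finset.sum_le_sum fun i _ => Nat.mul_le_mul_left _ (Nat.pow_le_pow_left h i)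

theorem Bounded.of_le (hy : Bounded sz y) (h : ∀ i, x i ≤ y i) : Bounded sz x :=
  let ⟨q, hq⟩ := hy
  ⟨q, fun i => (h i).trans (hq i)⟩

theorem Bounded.const (n : ℕ) : Bounded sz fun _ => n := ⟨Polynomial.C n, fun i => by simp⟩

theorem Bounded.self : Bounded sz sz := ⟨Polynomial.X, fun i => by simp⟩

theorem Bounded.add (hx : Bounded sz x) (hy : Bounded sz y) : Bounded sz fun i => x i + y i :=
  let ⟨q, hq⟩ := hx
  let ⟨r, hr⟩ := hy
  ⟨q + r, fun i => by simpa using Nat.add_le_add (hq i) (hr i)⟩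

theorem Bounded.mul (hx : Bounded sz x) (hy : Bounded sz y) : Bounded sz fun i => x i * y i :=
  let ⟨q, hq⟩ := hx
  let ⟨r, hr⟩ := hy
  ⟨q * r, fun i => by simpa using Nat.mul_le_mul (hq i) (hr i)⟩

theorem Bounded.poly (hx : Bounded sz x) (q : Polynomial ℕ) :
    Bounded sz fun i => q.eval (x i) :=
  let ⟨r, hr⟩ := hx
  ⟨q.comp r, fun i => by
    rw [Polynomial.eval_comp]
    exact polyEval_mono q (hr i)⟩

theorem Bounded.reindex {J : Type} (hx : Bounded sz x) (π : J → I) :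
    Bounded (fun j => sz (π j)) fun j => x (π j) :=
  let ⟨q, hq⟩ := hx
  ⟨q, fun j => hq (π j)⟩

end Bounded

/-! ### Closure properties of polynomial-time implementations -/

theorem ev_prim (o : Prim) (x : Data) (f : Data → ℕ → ℝ≥0∞) (k : ℕ) :
    ev ((Code.prim o).eval x) f (k + (x.size + (o.apply x).size)) = f (o.apply x) k := by
  rw [Code.eval, ev_bind, ev_tick, if_neg (by omega), ev_pure, Nat.add_sub_cancel]

theorem ev_comp (c d : Code) (x : Data) (f : Data → ℕ → ℝ≥0∞) (k : ℕ) :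
    ev ((Code.comp c d).eval x) f (k + 1) = ev (d.eval x) (fun y => ev (c.eval y) f) k := by
  rw [Code.eval, ev_bind, ev_tick, if_neg (by omega), ev_bind, Nat.add_sub_cancel]

theorem ev_pair (c d : Code) (x : Data) (f : Data → ℕ → ℝ≥0∞) (k : ℕ) :
    ev ((Code.pair c d).eval x) f (k + 1) =
      ev (c.eval x) (fun a => ev (d.eval x) fun b => f (.pair a b)) k := by
  rw [Code.eval, ev_bind, ev_tick, if_neg (by omega), ev_bind, Nat.add_sub_cancel]
  simp only [ev_bind, ev_pure]

theorem ev_ite (c d e : Code) (x : Data) (f : Data → ℕ → ℝ≥0∞) (k : ℕ) :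
    ev ((Code.ite c d e).eval x) f (k + 1) =
      ev (c.eval x) (fun b => if b = .num 0 then ev (e.eval x) f else ev (d.eval x) f) k := by
  rw [Code.eval, ev_bind, ev_tick, if_neg (by omega), ev_bind, Nat.add_sub_cancel]
  congr 1
  funext b k
  split_ifs <;> rfl

theorem ev_rand (x : Data) (f : Data → ℕ → ℝ≥0∞) (k : ℕ) :
    ev (Code.rand.eval x) f (k + 2 * x.size) =
      ex (uniformBelow x.toNat) fun i => f (.num i) k := by
  rw [Code.eval, ev_bind, ev_tick, if_neg (by omega), ev_bind, Nat.add_sub_cancel, ev_sample]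
  simp only [ev_pure]

theorem ev_eval_mono (c : Code) (x : Data) {f : Data → ℕ → ℝ≥0∞} (hf : ∀ y, Monotone (f y)) :
    Monotone (ev (c.eval x) f) :=
  (c.eval_clocked x).mono hf

theorem Eff.of_bounded {I : Type} {sz : I → ℕ} {inp : I → Data} {V : I → Type}
    {enc : ∀ i, V i → Data} {m : ∀ i, Timed (V i)} (c : Code) {T : I → ℕ} (hT : Bounded sz T)
    (h : ∀ i, Impl c (inp i) (enc i) (m i) (sz i) (T i)) : Eff sz inp enc m :=
  let ⟨q, hq⟩ := hT
  ⟨c, q, fun i => (h i).mono (hq i)⟩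

theorem Eff.reindex {I J : Type} {sz : I → ℕ} {inp : I → Data} {V : I → Type}
    {enc : ∀ i, V i → Data} {m : ∀ i, Timed (V i)} (h : Eff sz inp enc m) (π : J → I) :
    Eff (fun j => sz (π j)) (fun j => inp (π j)) (fun j => enc (π j)) fun j => m (π j) :=
  let ⟨c, q, hc⟩ := h
  ⟨c, q, fun j => hc (π j)⟩

section

variable {I : Type} {sz : I → ℕ} {inp x y : I → Data}

theorem impl_pure_iff {c : Code} {x y : Data} {M T : ℕ} :
    Impl (V := Data) c x (fun y => y) (pure y) M T ↔
      ∀ (k : ℕ) (f : Data → ℕ → ℝ≥0∞), (∀ y, Monotone (f y)) →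
        f y k ≤ ev (c.eval x) f (k + T) := by
  constructor
  · intro h k f hf
    have := h.ev_le 0 (Nat.zero_le _) k f hf
    simpa using this
  · intro h
    refine ⟨fun _ hr => (reach_pure.1 hr).2.le, fun k _ e f hf => ?_⟩
    rw [ev_pure]
    exact h (k + e) f hf

theorem comp_iff {out : I → Data} :
    Comp sz inp out ↔ ∃ (c : Code) (q : Polynomial ℕ), ∀ (i : I) (k : ℕ) (f : Data → ℕ → ℝ≥0∞),
      (∀ y, Monotone (f y)) → f (out i) k ≤ ev (c.eval (inp i)) f (k + q.eval (sz i)) := by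
  simp only [Comp, Eff, impl_pure_iff]

theorem Comp.of_bounded {out : I → Data} (c : Code) {T : I → ℕ} (hT : Bounded sz T)
    (h : ∀ (i : I) (k : ℕ) (f : Data → ℕ → ℝ≥0∞),
      (∀ y, Monotone (f y)) → f (out i) k ≤ ev (c.eval (inp i)) f (k + T i)) :
    Comp sz inp out :=
  Eff.of_bounded c hT fun i => impl_pure_iff.2 (h i)

theorem Comp.bounded (h : Comp sz inp x) : Bounded sz fun i => (x i).size := by
  obtain ⟨c, q, hq⟩ := h
  refine ⟨q, fun i => ?_⟩
  simpa using ((hq i).size_le (Nat.zero_le _) (reach_pure.2 ⟨rfl, rfl⟩)).1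

theorem Comp.bounded_inp (h : Comp sz inp x) : Bounded sz fun i => (inp i).size := by
  obtain ⟨c, q, hq⟩ := h
  refine ⟨q, fun i => ?_⟩
  simpa using ((hq i).size_le (Nat.zero_le _) (reach_pure.2 ⟨rfl, rfl⟩)).2

theorem Comp.id (h : Bounded sz fun i => (inp i).size) : Comp sz inp inp := by
  refine Comp.of_bounded (.prim .id) (h.add h) fun i k f _ => ?_
  exact (ev_prim .id (inp i) f k).ge

theorem Comp.reindex {J : Type} (h : Comp sz inp x) (π : J → I) :
    Comp (fun j => sz (π j)) (fun j => inp (π j)) fun j => x (π j) :=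
  Eff.reindex h π

theorem Eff.comp {V : I → Type} {enc : ∀ i, V i → Data} {m : ∀ i, Timed (V i)}
    (hx : Comp sz inp x) (h : Eff sz x enc m) : Eff sz inp enc m := by
  obtain ⟨d, r, hd⟩ := comp_iff.1 hx
  obtain ⟨c, q, hc⟩ := h
  refine Eff.of_bounded (.comp c d) (((Bounded.self.poly r).add (Bounded.self.poly q)).add
    (Bounded.const 1)) fun i => ⟨(hc i).le, fun k hk e f hf => ?_⟩
  rw [show k + e + (r.eval (sz i) + q.eval (sz i) + 1) =
    (k + e + q.eval (sz i)) + r.eval (sz i) + 1 by ring, ev_comp]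
  exact ((hc i).ev_le k hk e f hf).trans
    (hd i _ (fun y => ev (c.eval y) f) fun y => ev_eval_mono c y hf)

theorem Comp.comp (hx : Comp sz inp x) (h : Comp sz x y) : Comp sz inp y := Eff.comp hx h

theorem Comp.pair (hx : Comp sz inp x) (hy : Comp sz inp y) :
    Comp sz inp fun i => .pair (x i) (y i) := by
  obtain ⟨c, q, hc⟩ := comp_iff.1 hx
  obtain ⟨d, r, hd⟩ := comp_iff.1 hy
  refine Comp.of_bounded (.pair c d) (((Bounded.self.poly r).add (Bounded.self.poly q)).add
    (Bounded.const 1)) fun i k f hf => ?_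
  rw [← add_assoc, ev_pair, ← add_assoc]
  refine (hd i k (fun b => f (.pair (x i) b)) fun b => hf _).trans ?_
  exact hc i _ (fun a => ev (d.eval (inp i)) fun b => f (.pair a b))
    fun a => ev_eval_mono d _ fun b => hf _

theorem size_toNat (x : Data) : Nat.size x.toNat + 1 ≤ x.size := by
  cases x with
  | num n => exact le_rfl
  | pair a b => simp [Data.toNat, Data.size]

theorem size_fst_snd (x : Data) : x.fst.size + x.snd.size ≤ x.size + 2 := by
  cases x with
  | num n => simp [Data.fst, Data.snd, Data.size]
  | pair a b => simp [Data.fst, Data.snd, Data.size]; omega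

theorem natSize_add_le (a b : ℕ) : Nat.size (a + b) ≤ Nat.size a + Nat.size b + 1 := by
  rw [Nat.size_le]
  have ha := Nat.lt_size_self a
  have hb := Nat.lt_size_self b
  have h1 : 2 ^ a.size ≤ 2 ^ (a.size + b.size) := Nat.pow_le_pow_right (by norm_num) (by omega)
  have h2 : 2 ^ b.size ≤ 2 ^ (a.size + b.size) := Nat.pow_le_pow_right (by norm_num) (by omega)
  rw [pow_succ]
  omega

theorem natSize_mul_le (a b : ℕ) : Nat.size (a * b) ≤ Nat.size a + Nat.size b := by
  rw [Nat.size_le, pow_add]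
  exact Nat.mul_lt_mul'' (Nat.lt_size_self a) (Nat.lt_size_self b)

/-- The result of a basic instruction is not much larger than its input. -/
theorem Prim.exists_size_apply_le (o : Prim) : ∃ C, ∀ x, (o.apply x).size ≤ x.size + C := by
  have h (x : Data) : Nat.size x.fst.toNat + Nat.size x.snd.toNat ≤ x.size := by
    have := size_fst_snd x
    have := size_toNat x.fst
    have := size_toNat x.snd
    omega
  cases o with
  | id => exact ⟨0, fun x => le_rfl⟩
  | const d => exact ⟨d.size, fun x => by simp [Prim.apply]⟩
  | fst => exact ⟨2, fun x => by have := size_fst_snd x; simp only [Prim.apply]; omega⟩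
  | snd => exact ⟨2, fun x => by have := size_fst_snd x; simp only [Prim.apply]; omega⟩
  | isNum => exact ⟨2, fun x => by cases x <;> simp [Prim.apply, Data.size]⟩
  | eq =>
    refine ⟨2, fun x => ?_⟩
    simp only [Prim.apply, Data.size]
    split_ifs <;> simp
  | add =>
    refine ⟨2, fun x => ?_⟩
    have := h x
    have := natSize_add_le x.fst.toNat x.snd.toNat
    simp only [Prim.apply, Data.size]
    omega
  | sub =>
    refine ⟨1, fun x => ?_⟩
    have := h x
    have := Nat.size_le_size (Nat.sub_le x.fst.toNat x.snd.toNat)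
    simp only [Prim.apply, Data.size]
    omega
  | mul =>
    refine ⟨1, fun x => ?_⟩
    have := h x
    have := natSize_mul_le x.fst.toNat x.snd.toNat
    simp only [Prim.apply, Data.size]
    omega
  | div =>
    refine ⟨1, fun x => ?_⟩
    have := h x
    have := Nat.size_le_size (Nat.div_le_self x.fst.toNat x.snd.toNat)
    simp only [Prim.apply, Data.size]
    omega
  | mod =>
    refine ⟨1, fun x => ?_⟩
    have := h x
    have := Nat.size_le_size (Nat.mod_le x.fst.toNat x.snd.toNat)
    simp only [Prim.apply, Data.size]
    omega

theorem Comp.prim (o : Prim) (h : Comp sz inp x) : Comp sz inp fun i => o.apply (x i) := by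
  obtain ⟨C, hC⟩ := o.exists_size_apply_le
  refine h.comp (Comp.of_bounded (.prim o)
    (h.bounded.add (h.bounded.add (Bounded.const C))) fun i k f hf => ?_)
  rw [← ev_prim o (x i) f k]
  exact ev_eval_mono _ _ hf (by have := hC (x i); omega)

theorem Comp.const (h : Comp sz inp x) (d : Data) : Comp sz inp fun _ => d := h.prim (.const d)

theorem Comp.fst (h : Comp sz inp x) : Comp sz inp fun i => (x i).fst := h.prim .fst

theorem Comp.snd (h : Comp sz inp x) : Comp sz inp fun i => (x i).snd := h.prim .snd

theorem Comp.congr {x y : I → Data} (h : Comp sz inp x) (hxy : ∀ i, x i = y i) :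
    Comp sz inp y := by
  rwa [← funext hxy]

section Arithmetic

variable {a b : I → ℕ} (ha : Comp sz inp fun i => .num (a i)) (hb : Comp sz inp fun i => .num (b i))
include ha hb

theorem Comp.natAdd : Comp sz inp fun i => .num (a i + b i) := (ha.pair hb).prim .add
theorem Comp.natSub : Comp sz inp fun i => .num (a i - b i) := (ha.pair hb).prim .sub
theorem Comp.natMul : Comp sz inp fun i => .num (a i * b i) := (ha.pair hb).prim .mul
theorem Comp.natDiv : Comp sz inp fun i => .num (a i / b i) := (ha.pair hb).prim .div
theorem Comp.natMod : Comp sz inp fun i => .num (a i % b i) := (ha.pair hb).prim .mod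

end Arithmetic

/-! ### Decidable conditions -/

open Classical in
/-- The condition `P i` can be decided in polynomial time from the data `inp i`. -/
def CompP (sz : I → ℕ) (inp : I → Data) (P : I → Prop) : Prop :=
  Comp sz inp fun i => .num (if P i then 1 else 0)

theorem CompP.reindex {J : Type} {P : I → Prop} (h : CompP sz inp P) (π : J → I) :
    CompP (fun j => sz (π j)) (fun j => inp (π j)) fun j => P (π j) :=
  Eff.reindex h π

theorem CompP.congr {P Q : I → Prop} (h : CompP sz inp P) (hPQ : ∀ i, P i ↔ Q i) :
    CompP sz inp Q := by
  rwa [← show P = Q from funext fun i => propext (hPQ i)]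

theorem Comp.eqP (hx : Comp sz inp x) (hy : Comp sz inp y) : CompP sz inp fun i => x i = y i :=
  ((hx.pair hy).prim .eq).congr fun i => by simp only [Prim.apply, Data.fst, Data.snd]; congr

theorem CompP.and {P Q : I → Prop} (hP : CompP sz inp P) (hQ : CompP sz inp Q) :
    CompP sz inp fun i => P i ∧ Q i :=
  (Comp.natMul hP hQ).congr fun i => by
    by_cases h1 : P i <;> by_cases h2 : Q i <;> simp [h1, h2]

theorem CompP.not {P : I → Prop} (hP : CompP sz inp P) : CompP sz inp fun i => ¬ P i :=
  (Comp.natSub (hP.const (.num 1)) hP).congr fun i => by by_cases h1 : P i <;> simp [h1]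

theorem CompP.or {P Q : I → Prop} (hP : CompP sz inp P) (hQ : CompP sz inp Q) :
    CompP sz inp fun i => P i ∨ Q i :=
  (hP.not.and hQ.not).not.congr fun i => by tauto

theorem Comp.ltP {a b : I → ℕ} (ha : Comp sz inp fun i => .num (a i))
    (hb : Comp sz inp fun i => .num (b i)) : CompP sz inp fun i => a i < b i :=
  (Comp.eqP (Comp.natSub hb ha) (ha.const (.num 0))).not.congr fun i => by
    simp only [Data.num.injEq]
    omega

theorem Comp.toNat (hx : Comp sz inp x) : Comp sz inp fun i => .num (x i).toNat :=
  ((hx.pair (hx.const (.num 0))).prim .add).congr fun i => by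
    simp [Prim.apply, Data.fst, Data.snd, Data.toNat]

end

/-! ### Sequencing, branching, randomness and calls -/

section

variable {I : Type} {sz : I → ℕ} {inp x : I → Data} {V W : I → Type} {enc : ∀ i, V i → Data}
  {encW : ∀ i, W i → Data} {m : ∀ i, Timed (V i)} {m₂ : ∀ i, V i → Timed (W i)}

theorem Eff.bounded (h : Eff sz inp enc m) {J : Type} (π : J → I) (v : ∀ j, V (π j))
    (hv : ∀ j, ∃ k ≤ sz (π j), ∃ k', Reach (m (π j)) k (v j) k') :
    Bounded (fun j => sz (π j)) fun j => (enc (π j) (v j)).size := by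
  obtain ⟨c, q, hc⟩ := h
  refine ((Bounded.self.add (Bounded.self.poly q))).of_le fun j => ?_
  obtain ⟨k, hk, k', hr⟩ := hv j
  have := ((hc (π j)).size_le hk hr).1
  omega

theorem Impl.bind {V W : Type} {c₁ c₂ : Code} {x : Data} {enc : V → Data} {encW : W → Data}
    {m : Timed V} {m₂ : V → Timed W} {M T₁ T₂ : ℕ} (h₁ : Impl c₁ x enc m M T₁)
    (h₂ : ∀ v, (∃ k ≤ M, ∃ k', Reach m k v k') → Impl c₂ (.pair (enc v) x) encW (m₂ v) M T₂) :
    Impl (.comp c₂ (.pair c₁ (.prim .id))) x encW (m >>= m₂) M (T₁ + T₂ + 2 * x.size + 2) := by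
  constructor
  · intro k w k' hk hr
    obtain ⟨v, j, hr1, hr2⟩ := reach_bind.1 hr
    have h1 := h₁.le hk hr1
    exact ((h₂ v ⟨k, hk, j, hr1⟩).le (h1.trans hk) hr2).trans h1
  · intro k hk e f hf
    rw [show k + e + (T₁ + T₂ + 2 * x.size + 2) = (k + (e + T₂ + 2 * x.size) + T₁) + 1 + 1 by ring,
      ev_comp, ev_pair, ev_bind]
    refine le_trans ?_ (h₁.ev_le k hk (e + T₂ + 2 * x.size) _ fun y =>
      ev_eval_mono _ _ fun b => ev_eval_mono _ _ hf)
    refine ev_mono_reach fun v k' hr => ?_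
    have hk' := h₁.le hk hr
    rw [show k' + (e + T₂ + 2 * x.size) = (k' + e + T₂) + (x.size + x.size) by ring]
    rw [show x.size + x.size = x.size + (Prim.id.apply x).size from rfl, ev_prim]
    exact (h₂ v ⟨k, hk, k', hr⟩).ev_le k' (by omega) e f hf

/-- Sequencing. The second computation starts from an input `inp'` that holds the result of the
first one together with everything that could be computed before. -/
theorem Eff.bind (h₁ : Eff sz inp enc m) (hinp : Comp sz inp x)
    (h₂ : ∀ {J : Type} (π : J → I) (v : ∀ j, V (π j)) (inp' : J → Data),
      (∀ j, ∃ k ≤ sz (π j), ∃ k', Reach (m (π j)) k (v j) k') →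
      Comp (fun j => sz (π j)) inp' (fun j => enc (π j) (v j)) →
      (∀ {y : I → Data}, Comp sz inp y → Comp (fun j => sz (π j)) inp' fun j => y (π j)) →
      Eff (fun j => sz (π j)) inp' (fun j => encW (π j)) fun j => m₂ (π j) (v j)) :
    Eff sz inp encW fun i => m i >>= m₂ i := by
  let J : Type := Σ i, {v : V i // ∃ k ≤ sz i, ∃ k', Reach (m i) k v k'}
  have hid : Comp (fun j : J => sz j.1) (fun j => .pair (enc j.1 j.2.1) (inp j.1))
      fun j => .pair (enc j.1 j.2.1) (inp j.1) := by
    refine Comp.id (((h₁.bounded (fun j : J => j.1) (fun j => j.2.1) fun j => j.2.2).add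
      ((hinp.bounded_inp.reindex (fun j : J => j.1)).add (Bounded.const 1))).of_le fun j => ?_)
    simp only [Data.size]
    omega
  obtain ⟨c₂, q₂, hc₂⟩ := h₂ (fun j : J => j.1) (fun j => j.2.1)
    (fun j => .pair (enc j.1 j.2.1) (inp j.1)) (fun j => j.2.2) hid.fst
    (fun hy => hid.snd.comp (hy.reindex fun j : J => j.1))
  obtain ⟨c₁, q₁, hc₁⟩ := h₁
  refine Eff.of_bounded (.comp c₂ (.pair c₁ (.prim .id))) ((((Bounded.self.poly q₁).add
    (Bounded.self.poly q₂)).add ((Bounded.const 2).mul hinp.bounded_inp)).add (Bounded.const 2))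
    fun i => (hc₁ i).bind fun v hv => hc₂ ⟨i, v, hv⟩

/-- Branching on a condition that can be decided. -/
theorem Eff.cases {P : I → Prop} (hP : CompP sz inp P)
    (h₁ : Eff (fun j : {i // P i} => sz j) (fun j => inp j) (fun j => enc j) fun j => m j)
    (h₂ : Eff (fun j : {i // ¬ P i} => sz j) (fun j => inp j) (fun j => enc j) fun j => m j) :
    Eff sz inp enc m := by
  classical
  obtain ⟨c, q, hc⟩ := comp_iff.1 hP
  obtain ⟨c₁, q₁, hc₁⟩ := h₁
  obtain ⟨c₂, q₂, hc₂⟩ := h₂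
  refine Eff.of_bounded (.ite c c₁ c₂) ((((Bounded.self.poly q₁).add (Bounded.self.poly q₂)).add
    (Bounded.self.poly q)).add (Bounded.const 1)) fun i => ⟨fun hk hr => ?_, fun k hk e f hf => ?_⟩
  · by_cases h : P i
    · exact (hc₁ ⟨i, h⟩).le hk hr
    · exact (hc₂ ⟨i, h⟩).le hk hr
  · rw [← add_assoc, ← add_assoc, ev_ite]
    refine le_trans ?_ (hc i _ _ fun b => ?_)
    · by_cases h : P i
      · simp only [h, if_true, Data.num.injEq, one_ne_zero, if_false]
        exact ((hc₁ ⟨i, h⟩).ev_le k hk e f hf).trans (ev_eval_mono _ _ hf (by simp))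
      · simp only [h, if_true, if_false]
        exact ((hc₂ ⟨i, h⟩).ev_le k hk e f hf).trans (ev_eval_mono _ _ hf (by simp))
    · split_ifs
      · exact ev_eval_mono _ _ hf
      · exact ev_eval_mono _ _ hf

theorem Eff.congr {m' : ∀ i, Timed (V i)} (h : Eff sz inp enc m) (hm : ∀ i, m i = m' i) :
    Eff sz inp enc m' := by
  rwa [← show m = m' from funext hm]

/-- Where the computation fails, a program may do anything; no test is needed. -/
theorem Eff.of_failure (P : I → Prop)
    (h₁ : Eff (fun j : {i // P i} => sz j) (fun j => inp j) (fun j => enc j) fun j => m j)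
    (h₂ : ∀ i, ¬ P i → m i = Alternative.failure) : Eff sz inp enc m := by
  obtain ⟨c, q, hc⟩ := h₁
  refine ⟨c, q, fun i => ?_⟩
  by_cases h : P i
  · exact hc ⟨i, h⟩
  · rw [h₂ i h]
    exact ⟨fun _ hr => (reach_failure hr).elim, fun k _ e f _ => by simp⟩

theorem Eff.pure {v : ∀ i, V i} (h : Comp sz inp fun i => enc i (v i)) :
    Eff sz inp enc fun i => pure (v i) := by
  obtain ⟨c, q, hc⟩ := h
  refine ⟨c, q, fun i => ⟨fun _ hr => (reach_pure.1 hr).2.le, fun k hk e f hf => ?_⟩⟩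
  have := (hc i).ev_le k hk e f hf
  rwa [ev_pure] at this ⊢

/-- Running the adversary. -/
theorem Eff.call (A : Code) (h : Comp sz inp x) :
    Eff sz inp (V := fun _ => Data) (fun _ y => y) fun i => A.eval (x i) :=
  Eff.comp h
    ⟨A, 0, fun i => ⟨fun _ hr => (A.eval_clocked _).le hr, fun k _ e f _ => by
      simpa using (A.eval_clocked (x i)).shift f k e⟩⟩

theorem Eff.rand {n : I → ℕ} (h : Comp sz inp fun i => .num (n i)) :
    Eff sz inp (V := fun _ => ℕ) (fun _ n => .num n) fun i => sample (uniformBelow (n i)) := by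
  refine Eff.comp h (Eff.of_bounded .rand ((Bounded.const 2).mul h.bounded) fun i =>
    ⟨fun _ hr => (reach_sample.1 hr).2.le, fun k _ e f hf => ?_⟩)
  rw [ev_rand, ev_sample]
  exact le_rfl

end

/-! ### Loops -/

/-- Repeats `step` at most the given number of times, until it delivers a result. -/
def iter {S R : Type} (step : S → Timed (S ⊕ R)) : ℕ → S → Timed R
  | 0, _ => failure
  | k + 1, s => do
    match ← step s with
    | .inl s' => iter step k s'
    | .inr r => pure r

/-- The state of a loop: a flag that tells whether to go on, and the data proper. -/
def encSum {S R : Type} (enc : S → Data) (encR : R → Data) : S ⊕ R → Data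
  | .inl s => .pair (.num 1) (enc s)
  | .inr r => .pair (.num 0) (encR r)

theorem Impl.loop {S R : Type} {c : Code} {enc : S → Data} {encR : R → Data}
    {step : S → Timed (S ⊕ R)} {M P Q N : ℕ} (Inv : ℕ → S → Prop)
    (hQ : ∀ k s, Inv k s → (enc s).size ≤ Q)
    (hInv : ∀ k s, Inv (k + 1) s → ∀ j ≤ M, ∀ s' j', Reach (step s) j (.inl s') j' → Inv k s')
    (hc : ∀ k < N, ∀ s, Inv (k + 1) s →
      Impl c (.pair (.num 1) (enc s)) (encSum enc encR) (step s) M P)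
    {s : S} (hs : Inv N s) :
    Impl (.loop (.prim .fst) c) (.pair (.num 1) (enc s)) (fun r => .pair (.num 0) (encR r))
      (iter step N s) M ((N + 2) * (2 * (Q + M + P) + 20)) := by
  constructor
  · have key : ∀ n ≤ N, ∀ s, Inv n s → ∀ {k v k'}, k ≤ M → Reach (iter step n s) k v k' → k' ≤ k := by
      intro n
      induction n with
      | zero => exact fun _ _ _ _ _ _ _ hr => (reach_failure hr).elim
      | succ n ih =>
        intro hn s hs k v k' hk hr
        obtain ⟨o, j, h1, h2⟩ := reach_bind.1 hr
        have hj := (hc n hn s hs).le hk h1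
        match o, h1, h2 with
        | .inl s', h1, h2 =>
          exact (ih (by omega) s' (hInv n s hs k hk s' j h1) (by omega) h2).trans hj
        | .inr r, h1, h2 =>
          rw [(reach_pure.1 h2).2]
          exact hj
    exact fun {k v k'} hk hr => key N le_rfl s hs hk hr
  · set B := 2 * (Q + M + P) + 20 with hB
    have key : ∀ n ≤ N, ∀ s, Inv n s → ∀ k ≤ M, ∀ (e : ℕ) (f : Data → ℕ → ℝ≥0∞),
        (∀ y, Monotone (f y)) → ∀ l, n + 1 ≤ l →
        ev (iter step n s) (fun r k' => f (.pair (.num 0) (encR r)) (k' + e)) k ≤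
          ev (loopAux (fun y => (Code.prim .fst).eval y) (fun y => c.eval y) l
            (.pair (.num 1) (enc s))) f (k + e + (n + 1) * B) := by
      intro n
      induction n with
      | zero =>
        intro _ s _ k _ e f _ l _
        simp [iter]
      | succ n ih =>
        intro hn s hs k hk e f hf l hl
        obtain ⟨l, rfl⟩ : ∃ l', l = l' + 1 := ⟨l - 1, by omega⟩
        have hQs := hQ _ s hs
        have htest : (Data.pair (.num 1) (enc s)).size +
            (Prim.fst.apply (Data.pair (.num 1) (enc s))).size + 1 + P ≤ B := by
          simp only [Data.size, Prim.apply, Data.fst, Nat.size_one, hB]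
          omega
        obtain ⟨d, hd⟩ := Nat.exists_eq_add_of_le htest
        rw [loopAux, ev_bind, ev_tick, if_neg (by rw [add_mul]; omega)]
        rw [show k + e + (n + 1 + 1) * B - 1 = (k + (e + (n + 1) * B) + P + d) +
          ((Data.pair (.num 1) (enc s)).size +
            (Prim.fst.apply (Data.pair (.num 1) (enc s))).size) by
              rw [add_mul (n + 1), one_mul]; omega]
        rw [ev_bind, ev_prim]
        rw [if_neg (by simp [Prim.apply, Data.fst]), ev_bind]
        have hmono : ∀ y, Monotone (ev (loopAux (fun y => (Code.prim .fst).eval y)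
            (fun y => c.eval y) l y) f) := fun y =>
          (loopAux_clocked (fun y => Code.eval_clocked _ y) (fun y => Code.eval_clocked _ y) l y).mono
            hf
        refine le_trans ?_ (ev_eval_mono c _ hmono (Nat.le_add_right _ d))
        refine le_trans ?_ ((hc n hn s hs).ev_le k hk (e + (n + 1) * B) _ hmono)
        rw [iter, ev_bind]
        refine ev_mono_reach fun o k' hr => ?_
        have hk' := (hc n hn s hs).le hk hr
        match o, hr with
        | .inl s', hr =>
          rw [← add_assoc]
          exact ih (by omega) s' (hInv n s hs k hk s' k' hr) k' (by omega) e f hf l (by omega)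
        | .inr r, hr =>
          obtain ⟨l, rfl⟩ : ∃ l', l = l' + 1 := ⟨l - 1, by omega⟩
          have hsize := ((hc n hn s hs).size_le hk hr).1
          simp only [encSum] at hsize ⊢
          have htest' : (Data.pair (.num 0) (encR r)).size +
              (Prim.fst.apply (Data.pair (.num 0) (encR r))).size + 1 ≤ B := by
            simp only [Data.size, Prim.apply, Data.fst, Nat.size_zero, hB] at hsize ⊢
            omega
          obtain ⟨d', hd'⟩ := Nat.exists_eq_add_of_le htest'
          rw [loopAux, ev_bind, ev_tick, if_neg (by rw [add_mul]; omega)]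
          rw [show k' + (e + (n + 1) * B) - 1 = (k' + e + n * B + d') +
            ((Data.pair (.num 0) (encR r)).size +
              (Prim.fst.apply (Data.pair (.num 0) (encR r))).size) by
                rw [add_mul n, one_mul]; omega]
          rw [ev_bind, ev_prim]
          rw [if_pos (by simp [Prim.apply, Data.fst]), ev_pure, ev_pure]
          exact hf _ (by omega)
    intro k hk e f hf
    rw [ev_loop]
    refine (key N le_rfl s hs k hk e f hf (k + e + (N + 2) * B) ?_).trans ?_
    · have : N + 2 ≤ (N + 2) * B := Nat.le_mul_of_pos_right _ (by omega)
      omega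
    · exact (loopAux_clocked (fun y => Code.eval_clocked _ y) (fun y => Code.eval_clocked _ y) _ _).mono
        hf (by gcongr; omega)

theorem Eff.loop {I : Type} {sz : I → ℕ} {S R : I → Type} {enc : ∀ i, S i → Data}
    {encR : ∀ i, R i → Data} {step : ∀ i, S i → Timed (S i ⊕ R i)} {N Q : I → ℕ}
    {s₀ : ∀ i, S i} (Inv : ∀ i, ℕ → S i → Prop) (hN : Bounded sz N) (hQ : Bounded sz Q)
    (hsize : ∀ i k s, Inv i k s → (enc i s).size ≤ Q i)
    (hInv : ∀ i k s, Inv i (k + 1) s → ∀ j ≤ sz i, ∀ s' j',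
      Reach (step i s) j (.inl s') j' → Inv i k s')
    (h₀ : ∀ i, Inv i (N i) (s₀ i))
    (hbody : ∀ {J : Type} (π : J → I) (s : ∀ j, S (π j)) (k : J → ℕ),
      (∀ j, k j < N (π j)) → (∀ j, Inv (π j) (k j + 1) (s j)) →
      Comp (fun j => sz (π j)) (fun j => .pair (.num 1) (enc (π j) (s j)))
        (fun j => enc (π j) (s j)) →
      Eff (fun j => sz (π j)) (fun j => .pair (.num 1) (enc (π j) (s j)))
        (fun j => encSum (enc (π j)) (encR (π j))) fun j => step (π j) (s j))
    {inp : I → Data} (hinp : Comp sz inp fun i => enc i (s₀ i)) :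
    Eff sz inp encR fun i => iter (step i) (N i) (s₀ i) := by
  let J : Type := Σ i, {s : S i // ∃ k < N i, Inv i (k + 1) s}
  have hid : Comp (fun j : J => sz j.1) (fun j => .pair (.num 1) (enc j.1 j.2.1))
      fun j => .pair (.num 1) (enc j.1 j.2.1) := by
    refine Comp.id (((hQ.reindex fun j : J => j.1).add (Bounded.const 10)).of_le fun j => ?_)
    obtain ⟨k, _, hk⟩ := j.2.2
    have := hsize _ _ _ hk
    simp only [Data.size, Nat.size_one]
    omega
  choose kk hkk using fun j : J => j.2.2
  obtain ⟨c, q, hc⟩ := hbody (fun j : J => j.1) (fun j => j.2.1) kk (fun j => (hkk j).1)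
    (fun j => (hkk j).2) hid.snd
  have hloop : Eff sz (fun i => .pair (.num 1) (enc i (s₀ i)))
      (fun i r => .pair (.num 0) (encR i r)) fun i => iter (step i) (N i) (s₀ i) :=
    Eff.of_bounded (.loop (.prim .fst) c) ((hN.add (Bounded.const 2)).mul
      (((Bounded.const 2).mul ((hQ.add Bounded.self).add (Bounded.self.poly q))).add
        (Bounded.const 20))) fun i =>
      Impl.loop (Inv i) (hsize i) (hInv i) (fun k hk s hs => hc ⟨i, s, k, hk, hs⟩) (h₀ i)
  have h1 : Eff sz inp (fun i r => .pair (.num 0) (encR i r))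
      fun i => iter (step i) (N i) (s₀ i) :=
    Eff.comp ((hinp.const (.num 1)).pair hinp) hloop
  refine (h1.bind (m₂ := fun _ => Pure.pure) hinp fun π v inp' _ hv _ => Eff.pure hv.snd).congr
    fun i => bind_pure _

/-! ### Arithmetic in the group and in the field of exponents -/

theorem Eff.toComp {I : Type} {sz : I → ℕ} {inp : I → Data} {V : I → Type}
    {enc : ∀ i, V i → Data} {v : ∀ i, V i} (h : Eff sz inp enc fun i => Pure.pure (v i)) :
    Comp sz inp fun i => enc i (v i) := by
  obtain ⟨c, q, hc⟩ := h
  refine comp_iff.2 ⟨c, q, fun i k f hf => ?_⟩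
  have := (hc i).ev_le 0 (Nat.zero_le _) k f hf
  simpa using this

/-- One step of exponentiation by squaring: it turns `(a, b, k)` into a triple with the same value
of `a * b ^ k`. -/
def powStep {G : Type} [Monoid G] (s : G × G × ℕ) : Timed ((G × G × ℕ) ⊕ G) :=
  pure (if s.2.2 = 0 then .inr s.1
    else .inl (if s.2.2 % 2 = 1 then s.1 * s.2.1 else s.1, s.2.1 * s.2.1, s.2.2 / 2))

theorem natSize_div_two_lt {k : ℕ} (hk : k ≠ 0) : Nat.size (k / 2) < Nat.size k := by
  have h := Nat.size_pos.2 (Nat.pos_of_ne_zero hk)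
  obtain ⟨m, hm⟩ : ∃ m, Nat.size k = m + 1 := ⟨Nat.size k - 1, by omega⟩
  have hlt := Nat.lt_size_self k
  rw [hm, pow_succ] at hlt
  have : Nat.size (k / 2) ≤ m := Nat.size_le.2 (by omega)
  omega

theorem iter_powStep {G : Type} [Monoid G] (n : ℕ) (a b : G) (k : ℕ) (h : Nat.size k < n) :
    iter powStep n (a, b, k) = pure (a * b ^ k) := by
  induction n generalizing a b k with
  | zero => omega
  | succ n ih =>
    rw [iter, powStep, pure_bind]
    by_cases hk : k = 0
    · simp [hk]
    · have hlt := natSize_div_two_lt hk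
      simp only [hk, if_false]
      rw [ih _ _ _ (by omega)]
      congr 1
      have h2 : k = k % 2 + 2 * (k / 2) := (Nat.mod_add_div k 2).symm
      conv_rhs => rw [h2, pow_add, pow_mul, pow_two]
      rcases Nat.mod_two_eq_zero_or_one k with h0 | h1
      · simp [h0]
      · simp [h1, mul_assoc]

section

variable {I : Type} {sz : I → ℕ} {inp ctx : I → Data}

/-- Exponentiation is polynomial-time if multiplication is. -/
theorem Comp.mulPow {G : I → Type} [∀ i, Monoid (G i)] {enc : ∀ i, G i → Data} {Q : I → ℕ}
    (hmul : ∀ {J : Type} (π : J → I) {inp' : J → Data} {a b : ∀ j, G (π j)},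
      Comp (fun j => sz (π j)) inp' (fun j => ctx (π j)) →
      Comp (fun j => sz (π j)) inp' (fun j => enc _ (a j)) →
      Comp (fun j => sz (π j)) inp' (fun j => enc _ (b j)) →
      Comp (fun j => sz (π j)) inp' (fun j => enc _ (a j * b j)))
    (hQ : Bounded sz Q) (henc : ∀ i g, (enc i g).size ≤ Q i)
    {a b : ∀ i, G i} {k : I → ℕ} (hctx : Comp sz inp ctx) (ha : Comp sz inp fun i => enc i (a i))
    (hb : Comp sz inp fun i => enc i (b i)) (hk : Comp sz inp fun i => .num (k i)) :
    Comp sz inp fun i => enc i (a i * b i ^ k i) := by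
  have hkB : Bounded sz fun i => Nat.size (k i) := hk.bounded.of_le fun i => by simp [Data.size]
  let encS : ∀ i, G i × G i × ℕ → Data := fun i s =>
    .pair (ctx i) (.pair (enc i s.1) (.pair (enc i s.2.1) (.num s.2.2)))
  have := Eff.loop (sz := sz) (inp := inp) (S := fun i => G i × G i × ℕ) (R := G) (enc := encS)
    (encR := enc) (step := fun i => powStep) (N := fun i => Nat.size (k i) + 1)
    (Q := fun i => (ctx i).size + Q i + Q i + Nat.size (k i) + 5)
    (s₀ := fun i => (a i, b i, k i))
    (fun i n s => Nat.size s.2.2 < n ∧ Nat.size s.2.2 ≤ Nat.size (k i))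
    (hkB.add (Bounded.const 1))
    ((((hctx.bounded.add hQ).add hQ).add hkB).add (Bounded.const 5))
    (fun i n s h => by
      have := henc i s.1
      have := henc i s.2.1
      simp only [encS, Data.size]
      omega)
    (fun i n s h j hj s' j' hr => by
      have hs := (reach_pure.1 hr).1
      by_cases h0 : s.2.2 = 0
      · rw [if_pos h0] at hs
        cases hs
      rw [if_neg h0] at hs
      have hs' := Sum.inl.inj hs
      have := natSize_div_two_lt h0
      rw [hs']
      dsimp only
      omega)
    (fun i => ⟨Nat.lt_succ_self _, le_rfl⟩)
    (by
      intro J π s n _ _ hs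
      have h2 : Comp _ _ fun j => enc (π j) (s j).1 := hs.snd.fst
      have h3 : Comp _ _ fun j => enc (π j) (s j).2.1 := hs.snd.snd.fst
      have h4 : Comp _ _ fun j => Data.num (s j).2.2 := hs.snd.snd.snd
      have h1 : Comp _ _ fun j => ctx (π j) := hs.fst
      refine Eff.cases (Comp.eqP h4 (h4.const (.num 0))) ?_ ?_
      · refine (Eff.pure (v := fun j : {j // Data.num (s j).2.2 = .num 0} => .inr (s j).1) ?_).congr
          fun j => ?_
        · exact ((h4.const (.num 0)).pair h2).reindex _
        · have : (s j).2.2 = 0 := Data.num.inj j.2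
          simp [powStep, this]
      · refine Eff.cases (P := fun j => Data.num ((s j).2.2 % 2) = .num 1)
          ((Comp.eqP (Comp.natMod h4 (h4.const (.num 2))) (h4.const (.num 1))).reindex _) ?_ ?_
        · refine (Eff.pure (v := fun j => .inl ((s j).1 * (s j).2.1, (s j).2.1 * (s j).2.1,
            (s j).2.2 / 2)) ?_).congr fun j => ?_
          · exact ((h4.const (.num 1)).pair (h1.pair ((hmul π h1 h2 h3).pair ((hmul π h1 h3 h3).pair
              (Comp.natDiv h4 (h4.const (.num 2))))))).reindex _
          · have h0 : (s j).2.2 ≠ 0 := fun h => j.1.2 (by rw [h])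
            have h1 : (s j).2.2 % 2 = 1 := Data.num.inj j.2
            simp [powStep, h0, h1]
        · refine (Eff.pure (v := fun j => .inl ((s j).1, (s j).2.1 * (s j).2.1,
            (s j).2.2 / 2)) ?_).congr fun j => ?_
          · exact ((h4.const (.num 1)).pair (h1.pair (h2.pair ((hmul π h1 h3 h3).pair
              (Comp.natDiv h4 (h4.const (.num 2))))))).reindex _
          · have h0 : (s j).2.2 ≠ 0 := fun h => j.1.2 (by rw [h])
            have h1 : ¬ (s j).2.2 % 2 = 1 := fun h => j.2 (by rw [h])
            simp only [powStep, h0, h1, if_false])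
    (hctx.pair (ha.pair (hb.pair hk)))
  exact (this.congr fun i => iter_powStep _ _ _ _ (Nat.lt_succ_self _)).toComp

end

theorem Code.Computes.reach {c : Code} {k : ℕ} {x y : Data} (h : c.Computes k x y)
    {o : Option (Data × ℕ)} (ho : o ∈ ((c.eval x).law k).support) : ∃ k', o = some (y, k') := by
  have hd : (c.eval x).dist k = ((c.eval x).law k).map (Option.map Prod.fst) := by
    unfold Timed.dist law
    rw [StateT.run'_eq, OptionT.run_map]
    rfl
  have := h (o.map Prod.fst) (by
    rw [hd]
    exact (PMF.mem_support_map_iff _ _ _).2 ⟨o, ho, rfl⟩)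
  match o, this with
  | some (z, k'), h => exact ⟨k', by simpa using h⟩

theorem Code.Computes.le_ev {c : Code} {k : ℕ} {x y : Data} (h : c.Computes k x y) (j : ℕ)
    {f : Data → ℕ → ℝ≥0∞} (hf : ∀ y, Monotone (f y)) : f y j ≤ ev (c.eval x) f (j + k) := by
  rw [add_comm]
  refine le_trans ?_ ((c.eval_clocked x).shift f k j)
  refine le_ex_of_support fun o ho => ?_
  obtain ⟨k', rfl⟩ := h.reach ho
  exact hf y (by omega)

theorem Code.Computes.size_le {c : Code} {k : ℕ} {x y : Data} (h : c.Computes k x y) :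
    x.size ≤ k := by
  obtain ⟨o, ho⟩ := ((c.eval x).law k).support_nonempty
  obtain ⟨k', rfl⟩ := h.reach ho
  have := c.reach_size ho
  omega

/-- The data `inp i` determines, by a polynomial-time computation, the description of the group
that belongs to `d i`, which can be drawn for the security parameter `n i ≤ sz i`. -/
structure HasGroup (𝓕 : BilinearFamily) {I : Type} (sz : I → ℕ) (inp : I → Data) (n : I → ℕ)
    (d : I → Data) : Prop where
  mem : ∀ i, d i ∈ (𝓕.gen (n i)).support
  le : ∀ i, n i ≤ sz i
  desc : Comp sz inp fun i => 𝓕.desc (d i)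

namespace HasGroup

variable {𝓕 : BilinearFamily} {I : Type} {sz : I → ℕ} {inp : I → Data} {n : I → ℕ} {d : I → Data}

theorem weaken (H : HasGroup 𝓕 sz inp n d) {J : Type} (π : J → I) {inp' : J → Data}
    (h : Comp (fun j => sz (π j)) inp' fun j => 𝓕.desc (d (π j))) :
    HasGroup 𝓕 (fun j => sz (π j)) inp' (fun j => n (π j)) fun j => d (π j) :=
  ⟨fun _ => H.mem _, fun _ => H.le _, h⟩

theorem mul (H : HasGroup 𝓕 sz inp n d) {a b : ∀ i, (𝓕.grp (d i)).G}
    (ha : Comp sz inp fun i => (𝓕.grp (d i)).enc (a i))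
    (hb : Comp sz inp fun i => (𝓕.grp (d i)).enc (b i)) :
    Comp sz inp fun i => (𝓕.grp (d i)).enc (a i * b i) := by
  obtain ⟨c, q, hc⟩ := 𝓕.mul_efficient
  refine (H.desc.pair (ha.pair hb)).comp (Comp.of_bounded c (Bounded.self.poly q)
    fun i k f hf => ?_)
  exact ((hc (n i) (d i) (H.mem i) (a i) (b i)).le_ev k hf).trans
    (ev_eval_mono _ _ hf (Nat.add_le_add_left (polyEval_mono q (H.le i)) k))

theorem exists_enc_size_le (𝓕 : BilinearFamily) :
    ∃ q : Polynomial ℕ, ∀ n, ∀ d ∈ (𝓕.gen n).support, ∀ a : (𝓕.grp d).G,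
      ((𝓕.grp d).enc a).size ≤ q.eval n := by
  obtain ⟨c, q, hc⟩ := 𝓕.mul_efficient
  refine ⟨q, fun n d hd a => ?_⟩
  have := (hc n d hd a 1).size_le
  simp only [Data.size] at this
  omega

theorem enc_bounded (H : HasGroup 𝓕 sz inp n d) :
    ∃ Q : I → ℕ, Bounded sz Q ∧ ∀ i (a : (𝓕.grp (d i)).G), ((𝓕.grp (d i)).enc a).size ≤ Q i := by
  obtain ⟨q, hq⟩ := exists_enc_size_le 𝓕
  exact ⟨fun i => q.eval (sz i), Bounded.self.poly q, fun i a =>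
    (hq _ _ (H.mem i) a).trans (polyEval_mono q (H.le i))⟩

theorem order (H : HasGroup 𝓕 sz inp n d) : Comp sz inp fun i => .num (𝓕.grp (d i)).p :=
  H.desc.snd

theorem zmod_bounded (H : HasGroup 𝓕 sz inp n d) :
    ∃ Q : I → ℕ, Bounded sz Q ∧ ∀ i (a : ZMod (𝓕.grp (d i)).p), (Data.num a.val).size ≤ Q i :=
  ⟨_, H.order.bounded, fun i a => by
    simp only [Data.size]
    exact Nat.add_le_add_right (Nat.size_le_size (ZMod.val_lt a).le) 1⟩

theorem mulPow (H : HasGroup 𝓕 sz inp n d) {a b : ∀ i, (𝓕.grp (d i)).G} {k : I → ℕ}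
    (ha : Comp sz inp fun i => (𝓕.grp (d i)).enc (a i))
    (hb : Comp sz inp fun i => (𝓕.grp (d i)).enc (b i)) (hk : Comp sz inp fun i => .num (k i)) :
    Comp sz inp fun i => (𝓕.grp (d i)).enc (a i * b i ^ k i) := by
  obtain ⟨Q, hQ, hle⟩ := H.enc_bounded
  exact Comp.mulPow (enc := fun i => (𝓕.grp (d i)).enc) (ctx := fun i => 𝓕.desc (d i))
    (fun π _ _ _ h1 h2 h3 => (H.weaken π h1).mul h2 h3) hQ hle H.desc ha hb hk

theorem pow_order (𝔾 : BilinearGroup) (a : 𝔾.G) : a ^ 𝔾.p = 1 := by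
  rw [← 𝔾.card_G]
  exact pow_card_eq_one

theorem pow (H : HasGroup 𝓕 sz inp n d) {b : ∀ i, (𝓕.grp (d i)).G} {k : I → ℕ}
    (hb : Comp sz inp fun i => (𝓕.grp (d i)).enc (b i)) (hk : Comp sz inp fun i => .num (k i)) :
    Comp sz inp fun i => (𝓕.grp (d i)).enc (b i ^ k i) := by
  refine (H.mulPow hb hb (Comp.natAdd hk (Comp.natSub H.order (hk.const (.num 1))))).congr
    fun i => ?_
  have hp := (𝓕.grp (d i)).prime.pos
  rw [← pow_succ', show k i + ((𝓕.grp (d i)).p - 1) + 1 = k i + (𝓕.grp (d i)).p by omega, pow_add,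
    pow_order, mul_one]

theorem inv (H : HasGroup 𝓕 sz inp n d) {b : ∀ i, (𝓕.grp (d i)).G}
    (hb : Comp sz inp fun i => (𝓕.grp (d i)).enc (b i)) :
    Comp sz inp fun i => (𝓕.grp (d i)).enc (b i)⁻¹ := by
  refine (H.pow hb (Comp.natSub H.order (hb.const (.num 1)))).congr fun i => ?_
  have hp := (𝓕.grp (d i)).prime.pos
  congr 1
  exact eq_inv_of_mul_eq_one_left (by rw [← pow_succ, Nat.sub_add_cancel hp, pow_order])

theorem memP (H : HasGroup 𝓕 sz inp n d) {y : I → Data} (hy : Comp sz inp y) :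
    CompP sz inp fun i => y i ∈ Set.range (𝓕.grp (d i)).enc := by
  obtain ⟨c, q, hc⟩ := 𝓕.mem_efficient
  refine (H.desc.pair hy).comp (Comp.of_bounded c ((Bounded.self.add hy.bounded).poly q)
    fun i k f hf => ?_)
  have h := ((hc (n i) (d i) (H.mem i) (y i)).le_ev k hf).trans
    (ev_eval_mono _ _ hf (Nat.add_le_add_left
      (polyEval_mono q (Nat.add_le_add_right (H.le i) (y i).size)) k))
  by_cases hm : y i ∈ Set.range (𝓕.grp (d i)).enc
  · simp only [hm, if_true] at h ⊢
    exact h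
  · simp only [hm, if_false] at h ⊢
    exact h

section Exponents

variable {a b : ∀ i, ZMod (𝓕.grp (d i)).p}

theorem zmodAdd (H : HasGroup 𝓕 sz inp n d) (ha : Comp sz inp fun i => .num (a i).val)
    (hb : Comp sz inp fun i => .num (b i).val) : Comp sz inp fun i => .num (a i + b i).val :=
  (Comp.natMod (Comp.natAdd ha hb) H.order).congr fun i => by rw [ZMod.val_add]

theorem zmodMul (H : HasGroup 𝓕 sz inp n d) (ha : Comp sz inp fun i => .num (a i).val)
    (hb : Comp sz inp fun i => .num (b i).val) : Comp sz inp fun i => .num (a i * b i).val :=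
  (Comp.natMod (Comp.natMul ha hb) H.order).congr fun i => by rw [ZMod.val_mul]

theorem zmodNeg (H : HasGroup 𝓕 sz inp n d) (ha : Comp sz inp fun i => .num (a i).val) :
    Comp sz inp fun i => .num (-a i).val :=
  (Comp.natMod (Comp.natSub H.order ha) H.order).congr fun i => by rw [ZMod.neg_val']

theorem zmodSub (H : HasGroup 𝓕 sz inp n d) (ha : Comp sz inp fun i => .num (a i).val)
    (hb : Comp sz inp fun i => .num (b i).val) : Comp sz inp fun i => .num (a i - b i).val :=
  (H.zmodAdd ha (H.zmodNeg hb)).congr fun i => by rw [sub_eq_add_neg]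

/-- Inversion in `ZMod p`, by Fermat's little theorem. -/
theorem zmodInv (H : HasGroup 𝓕 sz inp n d) (ha : Comp sz inp fun i => .num (a i).val)
    (h0 : ∀ i, a i ≠ 0) : Comp sz inp fun i => .num ((a i)⁻¹).val := by
  obtain ⟨Q, hQ, hle⟩ := H.zmod_bounded
  have h1 : Comp sz inp fun i => .num (1 : ZMod (𝓕.grp (d i)).p).val :=
    (ha.const (.num 1)).congr fun i => by rw [ZMod.val_one]
  refine (Comp.mulPow (enc := fun i (a : ZMod (𝓕.grp (d i)).p) => .num a.val)
    (ctx := fun i => 𝓕.desc (d i)) (fun π _ _ _ h1 h2 h3 => (H.weaken π h1).zmodMul h2 h3)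
    hQ hle H.desc h1 ha (Comp.natSub H.order (ha.const (.num 2)))).congr fun i => ?_
  have hp := (𝓕.grp (d i)).prime.two_le
  rw [one_mul]
  congr 2
  exact eq_inv_of_mul_eq_one_left (by
    rw [← pow_succ, show (𝓕.grp (d i)).p - 2 + 1 = (𝓕.grp (d i)).p - 1 by omega,
      ZMod.pow_card_sub_one_eq_one (h0 i)])

end Exponents

theorem uniform (H : HasGroup 𝓕 sz inp n d) :
    Eff sz inp (V := fun i => ZMod (𝓕.grp (d i)).p) (fun _ a => .num a.val)
      fun i => sample (PMF.uniformOfFintype (ZMod (𝓕.grp (d i)).p)) := by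
  have key : ∀ p [Fact p.Prime], uniformBelow p = (PMF.uniformOfFintype (ZMod p)).map ZMod.val := by
    intro p hp
    match p, hp with
    | 0, hp => exact absurd hp.out Nat.not_prime_zero
    | p + 1, hp =>
      change (PMF.uniformOfFintype (Fin (p + 1))).map Fin.val = _
      congr
  obtain ⟨c, q, hc⟩ := Eff.rand H.order
  refine ⟨c, q, fun i => ⟨fun _ hr => (reach_sample.1 hr).2.le, fun k hk e f hf => ?_⟩⟩
  have := (hc i).ev_le k hk e f hf
  rw [ev_sample, key, ex_map] at this
  rwa [ev_sample]

end HasGroup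

/-! ### Exponents and uniform distributions -/

section Exponents

variable {𝔾 : BilinearGroup}

theorem pow_val_add (X : 𝔾.G) (e f : ZMod 𝔾.p) : X ^ (e + f).val = X ^ e.val * X ^ f.val := by
  rw [ZMod.val_add, ← pow_add]
  conv_rhs => rw [← Nat.mod_add_div (e.val + f.val) 𝔾.p, pow_add, pow_mul,
    HasGroup.pow_order 𝔾, one_pow, mul_one]

theorem pow_val_mul (X : 𝔾.G) (e f : ZMod 𝔾.p) : X ^ (e * f).val = (X ^ e.val) ^ f.val := by
  rw [ZMod.val_mul, ← pow_mul]
  conv_rhs => rw [← Nat.mod_add_div (e.val * f.val) 𝔾.p, pow_add, pow_mul X 𝔾.p,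
    HasGroup.pow_order 𝔾, one_pow, mul_one]

theorem pow_val_neg (X : 𝔾.G) (e : ZMod 𝔾.p) : X ^ (-e).val = (X ^ e.val)⁻¹ := by
  rw [eq_inv_iff_mul_eq_one, ← pow_val_add, neg_add_cancel, ZMod.val_zero, pow_zero]

theorem pow_val_one (X : 𝔾.G) : X ^ (1 : ZMod 𝔾.p).val = X := by
  rw [ZMod.val_one, pow_one]

/-- Every element other than `1` generates the group. -/
theorem pow_val_bijective {X : 𝔾.G} (hX : X ≠ 1) :
    Function.Bijective fun e : ZMod 𝔾.p => X ^ e.val := by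
  rw [Fintype.bijective_iff_injective_and_card, ZMod.card, 𝔾.card_G]
  refine ⟨fun e f h => ?_, rfl⟩
  have ho : orderOf X = 𝔾.p := orderOf_eq_prime (HasGroup.pow_order 𝔾 X) hX
  have := pow_inj_mod.1 h
  rw [ho, Nat.mod_eq_of_lt (ZMod.val_lt e), Nat.mod_eq_of_lt (ZMod.val_lt f)] at this
  exact ZMod.val_injective _ this

theorem exists_pow_val {X : 𝔾.G} (hX : X ≠ 1) (a : 𝔾.G) : ∃ e : ZMod 𝔾.p, a = X ^ e.val :=
  let ⟨e, he⟩ := (pow_val_bijective hX).2 a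
  ⟨e, he.symm⟩

end Exponents

theorem uniform_map_equiv {α β : Type} [Fintype α] [Fintype β] [Nonempty α] [Nonempty β]
    (e : α ≃ β) : (PMF.uniformOfFintype α).map e = PMF.uniformOfFintype β := by
  ext b
  rw [PMF.map_apply, tsum_eq_single (e.symm b)]
  · simp [Fintype.card_congr e]
  · intro a ha
    rw [if_neg]
    rintro rfl
    simp at ha

theorem ex_uniform {α : Type} [Fintype α] [Nonempty α] (f : α → ℝ≥0∞) :
    ex (PMF.uniformOfFintype α) f = (Fintype.card α : ℝ≥0∞)⁻¹ * ∑ a, f a := by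
  simp [ex, tsum_fintype, Finset.mul_sum]

theorem ex_uniform_equiv {α β : Type} [Fintype α] [Fintype β] [Nonempty α] [Nonempty β]
    (e : α ≃ β) (f : β → ℝ≥0∞) :
    ex (PMF.uniformOfFintype α) (fun a => f (e a)) = ex (PMF.uniformOfFintype β) f := by
  rw [← uniform_map_equiv e, ex_map]

theorem ex_uniform_bijective {α β : Type} [Fintype α] [Fintype β] [Nonempty α] [Nonempty β]
    {e : α → β} (he : Function.Bijective e) (f : β → ℝ≥0∞) :
    ex (PMF.uniformOfFintype α) (fun a => f (e a)) = ex (PMF.uniformOfFintype β) f :=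
  ex_uniform_equiv (Equiv.ofBijective e he) f

theorem Timed.ext_law {α : Type} {m m' : Timed α} (h : ∀ k, m.law k = m'.law k) : m = m' :=
  funext h

theorem sample_pure {α : Type} (a : α) : sample (pure a) = (pure a : Timed α) :=
  Timed.ext_law fun k => by rw [law_sample, law_pure, pure_bind]

theorem sample_bind {α β : Type} (μ : PMF α) (g : α → PMF β) :
    sample (μ >>= g) = sample μ >>= fun a => sample (g a) :=
  Timed.ext_law fun k => by
    rw [law_sample, law_bind, law_sample, bind_assoc, bind_assoc]
    congr 1
    funext a
    rw [pure_bind]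
    exact (law_sample (g a) k).symm

/-! ### Messages and their encodings -/

section Messages

variable {𝔾 : BilinearGroup}

theorem decG_eq_some {y : Data} {a : 𝔾.G} : decG 𝔾 y = some a ↔ 𝔾.enc a = y := by
  unfold decG
  split_ifs with h
  · rw [Option.some.injEq]
    constructor
    · rintro rfl
      exact h.choose_spec
    · intro ha
      exact 𝔾.enc_injective (h.choose_spec.trans ha.symm)
  · simp only [false_iff]
    exact fun ha => h ⟨a, ha⟩

theorem decZ_eq_some {m : ℕ} {z : ZMod 𝔾.p} : decZ 𝔾 m = some z ↔ z.val = m := by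
  unfold decZ
  split_ifs with h
  · rw [Option.some.injEq]
    constructor
    · rintro rfl
      exact ZMod.val_cast_of_lt h
    · rintro rfl
      exact ZMod.natCast_zmod_val z
  · simp only [false_iff]
    rintro rfl
    exact h (ZMod.val_lt z)

theorem decKey_eq_some {y : Data} {k : Key 𝔾} : decKey 𝔾 y = some k ↔ encKey k = y := by
  unfold decKey
  split
  · next y₁ y₂ m =>
    simp only [Option.bind_eq_bind, Option.bind_eq_some_iff, decG_eq_some, decZ_eq_some, encKey,
      Data.pair.injEq, Data.num.injEq]
    constructor
    · rintro ⟨d₁, h1, d₂, h2, d₃, h3, h4⟩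
      cases Option.some.inj h4
      exact ⟨h1, h2, h3⟩
    · rintro ⟨h1, h2, h3⟩
      exact ⟨_, h1, _, h2, _, h3, rfl⟩
  · next h =>
    simp only [reduceCtorEq, false_iff]
    rintro rfl
    exact h _ _ _ rfl

/-- The data that represent a message. -/
def encMessage : Message 𝔾 → Data
  | .start ID R u => .pair (.num 0) (.pair (.num ID.val) (.pair (𝔾.enc R) (𝔾.enc u)))
  | .respond ID s s' => .pair (.num 1) (.pair (.num ID.val) (.pair (.num s.val) (.num s'.val)))
  | .output k₁ k₂ => .pair (.num 2) (.pair (encKey k₁) (encKey k₂))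

theorem decMessage_eq_some {y : Data} {m : Message 𝔾} :
    decMessage 𝔾 y = some m ↔ encMessage m = y := by
  unfold decMessage
  split
  · next i y y' =>
    simp only [Option.bind_eq_bind, Option.bind_eq_some_iff, decG_eq_some, decZ_eq_some]
    constructor
    · rintro ⟨d₁, h1, d₂, h2, d₃, h3, h4⟩
      cases Option.some.inj h4
      simp [encMessage, h1, h2, h3]
    · cases m <;> simp only [encMessage, Data.pair.injEq, Data.num.injEq]
      · rintro ⟨-, h1, h2, h3⟩
        exact ⟨_, h1, _, h2, _, h3, rfl⟩
      · simp
      · simp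
  · next i j j' =>
    simp only [Option.bind_eq_bind, Option.bind_eq_some_iff, decZ_eq_some]
    constructor
    · rintro ⟨d₁, h1, d₂, h2, d₃, h3, h4⟩
      cases Option.some.inj h4
      simp [encMessage, h1, h2, h3]
    · cases m <;> simp only [encMessage, Data.pair.injEq, Data.num.injEq]
      · simp
      · rintro ⟨-, h1, h2, h3⟩
        exact ⟨_, h1, _, h2, _, h3, rfl⟩
      · simp
  · next y y' =>
    simp only [Option.bind_eq_bind, Option.bind_eq_some_iff, decKey_eq_some]
    constructor
    · rintro ⟨d₁, h1, d₂, h2, h4⟩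
      cases Option.some.inj h4
      simp [encMessage, h1, h2]
    · cases m <;> simp only [encMessage, Data.pair.injEq, Data.num.injEq]
      · simp
      · simp
      · rintro ⟨-, h1, h2⟩
        exact ⟨_, h1, _, h2, rfl⟩
  · next h0 h1 h2 =>
    simp only [reduceCtorEq, false_iff]
    rintro rfl
    cases m
    · exact h0 _ _ _ rfl
    · exact h1 _ _ _ rfl
    · exact h2 _ _ rfl

end Messages

/-! ### The simulated key authority -/

section Simulation

variable {𝔾 : BilinearGroup}

/-- The final message of the key authority with given randomness. -/
def keyOf (mpk : PublicKey 𝔾) (x : (ZMod 𝔾.p)ˣ) (ID : ZMod 𝔾.p) (R : 𝔾.G) (r t : ZMod 𝔾.p) :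
    Key 𝔾 :=
  ⟨(mpk.Y * R * mpk.h ^ t.val) ^ (x⁻¹).val.val * (mpk.g ^ ID.val * mpk.Z) ^ r.val,
    mpk.X ^ r.val, t⟩

/-- The final message of the key authority, except that the randomness is drawn from all of `ZMod p`
and not from the units. -/
def keyDist (mpk : PublicKey 𝔾) (x : (ZMod 𝔾.p)ˣ) (ID : ZMod 𝔾.p) (R : 𝔾.G) : PMF (Key 𝔾) := do
  let t ← PMF.uniformOfFintype (ZMod 𝔾.p)
  let r ← PMF.uniformOfFintype (ZMod 𝔾.p)
  pure (keyOf mpk x ID R r t)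

variable (𝔾) in
/-- The runs for identities other than the target, latest status first: the identity with `R`, `u`
and the challenge, or without them if the run is over. -/
abbrev Table : Type := List (ZMod 𝔾.p × Option (𝔾.G × 𝔾.G × ZMod 𝔾.p))

/-- The latest status of the run for `ID`. -/
def Table.find (ID : ZMod 𝔾.p) : Table 𝔾 → Option (Option (𝔾.G × 𝔾.G × ZMod 𝔾.p))
  | [] => none
  | e :: L => if e.1 = ID then some e.2 else Table.find ID L

open Classical in
/-- The answer to a message that does not concern the target identity; messages that do are
answered by `⊥`. -/
def reply (mpk : PublicKey 𝔾) (x : (ZMod 𝔾.p)ˣ) (IDstar : ZMod 𝔾.p) (L : Table 𝔾) :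
    Message 𝔾 → PMF (Data × Table 𝔾)
  | .start ID R u =>
    if ID = IDstar then pure (botReply, L)
    else match L.find ID with
      | none => do
        let c ← PMF.uniformOfFintype (ZMod 𝔾.p)
        pure (challengeReply c, (ID, some (R, u, c)) :: L)
      | some _ => pure (botReply, L)
  | .respond ID s s' =>
    if ID = IDstar then pure (botReply, L)
    else match L.find ID with
      | some (some (R, u, c)) =>
        if okamotoVerify mpk R u c s s' then do
          let k ← keyDist mpk x ID R
          pure (keyReply k, (ID, none) :: L)
        else pure (botReply, (ID, none) :: L)
      | _ => pure (botReply, L)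
  | .output _ _ => pure (botReply, L)

/-- The status of the run for the target identity. -/
inductive Phase : Type
  | fresh | waiting | closed

/-- The messages at which the simulation is interrupted: those that end the game, the one that
opens the run for the target identity, and the answer to the challenge in that run. -/
def Phase.Halts (IDstar : ZMod 𝔾.p) : Phase → Message 𝔾 → Prop
  | _, .output _ _ => True
  | .fresh, .start ID _ _ => ID = IDstar
  | .waiting, .respond ID _ _ => ID = IDstar
  | _, _ => False

open Classical in
/-- An activation of the adversary. The state consists of the table of the runs, the state of the
adversary, and her incoming message; the result is the table, the state of the adversary, and the
message at which the simulation is interrupted. -/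
def runStep (A : Code) (mpk : PublicKey 𝔾) (x : (ZMod 𝔾.p)ˣ) (IDstar : ZMod 𝔾.p) (ph : Phase)
    (σ : Table 𝔾 × Data × Data) : Timed ((Table 𝔾 × Data × Data) ⊕ (Table 𝔾 × Data × Message 𝔾)) := do
  let out ← A.eval (.pair σ.2.1 σ.2.2)
  match out with
  | .num _ => failure
  | .pair st m =>
    match decMessage 𝔾 m with
    | none => pure (.inl (σ.1, st, botReply))
    | some msg =>
      if ph.Halts IDstar msg then pure (.inr (σ.1, st, msg))
      else do
        let r ← sample (reply mpk x IDstar σ.1 msg)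
        pure (.inl (r.2, st, r.1))

/-- At most `N` activations of the adversary, up to an interruption. -/
def run (A : Code) (mpk : PublicKey 𝔾) (x : (ZMod 𝔾.p)ˣ) (IDstar : ZMod 𝔾.p) (N : ℕ) (ph : Phase)
    (σ : Table 𝔾 × Data × Data) : Timed (Table 𝔾 × Data × Message 𝔾) :=
  iter (runStep A mpk x IDstar ph) N σ

section Programs

variable (A : Code) (mpk : PublicKey 𝔾) (x : (ZMod 𝔾.p)ˣ) (IDstar : ZMod 𝔾.p) (N : ℕ)

/-- The game after the run for the target identity is over. -/
def simClosed (σ : Table 𝔾 × Data × Data) : Timed (Key 𝔾 × Key 𝔾) := do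
  let τ ← run A mpk x IDstar N .closed σ
  match τ.2.2 with
  | .output k₁ k₂ => pure (k₁, k₂)
  | _ => failure

open Classical in
/-- The adversary has given a correct answer to the challenge `c` on `R`, `u`, of which `s` is the
first component. She is rewound to the state `(L₀, st₀)` before the challenge and challenged anew;
a second correct answer opens `R`. Then the main run is continued from the state `(L₁, st₁)`, with
a key whose family number is `tstar` less the exponent of `h` in `R`. -/
def simExtract (tstar : ZMod 𝔾.p) (R u : 𝔾.G) (c s : ZMod 𝔾.p) (L₀ : Table 𝔾) (st₀ : Data)
    (L₁ : Table 𝔾) (st₁ : Data) : Timed (Key 𝔾 × Key 𝔾) := do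
  let c' ← sample (PMF.uniformOfFintype (ZMod 𝔾.p))
  let τ ← run A mpk x IDstar N .waiting (L₀, st₀, challengeReply c')
  match τ.2.2 with
  | .respond _ s₂ s₂' =>
    if okamotoVerify mpk R u c' s₂ s₂' ∧ c ≠ c' then do
      let r ← sample (PMF.uniformOfFintype (ZMod 𝔾.p))
      simClosed A mpk x IDstar N
        (L₁, st₁, keyReply (keyOf mpk x IDstar R r (tstar - (s - s₂) / (c - c'))))
    else failure
  | _ => failure

open Classical in
/-- The game after the challenge `c` has been sent in the run for the target identity. -/
def simWaiting (tstar : ZMod 𝔾.p) (R u : 𝔾.G) (L₀ : Table 𝔾) (st₀ : Data) (c : ZMod 𝔾.p) :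
    Timed (Key 𝔾 × Key 𝔾) := do
  let τ ← run A mpk x IDstar N .waiting (L₀, st₀, challengeReply c)
  match τ.2.2 with
  | .output k₁ k₂ => pure (k₁, k₂)
  | .respond _ s s' =>
    if okamotoVerify mpk R u c s s' then
      simExtract A mpk x IDstar N tstar R u c s L₀ st₀ τ.1 τ.2.1
    else simClosed A mpk x IDstar N (τ.1, τ.2.1, botReply)
  | _ => failure

/-- The simulated game, from the state of the adversary in which she receives the public key. -/
def simGame (tstar : ZMod 𝔾.p) (st : Data) : Timed (Key 𝔾 × Key 𝔾) := do
  let τ ← run A mpk x IDstar N .fresh ([], st, encPublicKey mpk)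
  match τ.2.2 with
  | .output k₁ k₂ => pure (k₁, k₂)
  | .start _ R u => do
    let c ← sample (PMF.uniformOfFintype (ZMod 𝔾.p))
    simWaiting A mpk x IDstar N tstar R u τ.1 τ.2.1 c
  | _ => failure

end Programs

end Simulation

/-! ### The simulation runs in polynomial time -/

/-- What the reduction knows, apart from the exponents `a` and `b`: a Diffie-Hellman instance
`X`, `X ^ a`, `X ^ b` for the security parameter `n` and the description `d`, the target identity,
and exponents from which the public key is made. -/
structure Instance (𝓕 : BilinearFamily) where
  n : ℕ
  d : Data
  mem : d ∈ (𝓕.gen n).support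
  X : (𝓕.grp d).G
  X_ne : X ≠ 1
  a : (ZMod (𝓕.grp d).p)ˣ
  b : ZMod (𝓕.grp d).p
  y : ZMod (𝓕.grp d).p
  t : ZMod (𝓕.grp d).p
  z : ZMod (𝓕.grp d).p
  ID : ZMod (𝓕.grp d).p

namespace Instance

/-- The group of an instance. -/
abbrev grp (P : Instance 𝓕) : BilinearGroup := 𝓕.grp P.d

/-- The public key `g = X ^ a`, `h = X ^ b`, `Y = X ^ y * h ^ (-t)`, `Z = g ^ (-ID) * X ^ z`. -/
def mpk (P : Instance 𝓕) : PublicKey P.grp where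
  g := P.X ^ P.a.val.val
  X := P.X
  Y := P.X ^ P.y.val * ((P.X ^ P.b.val) ^ P.t.val)⁻¹
  Z := ((P.X ^ P.a.val.val) ^ P.ID.val)⁻¹ * P.X ^ P.z.val
  h := P.X ^ P.b.val

/-- The master secret key that belongs to the public key. -/
def x (P : Instance 𝓕) : (ZMod P.grp.p)ˣ := P.a⁻¹

/-- What the simulation has at hand. -/
def env (P : Instance 𝓕) : Data :=
  .pair (𝓕.desc P.d) (.pair (encPublicKey P.mpk) (.pair (.num P.y.val) (.pair (.num P.t.val)
    (.pair (.num P.z.val) (.num P.ID.val)))))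

end Instance

/-- The data `inp i` determines what the simulation has at hand in the instance `P i`. -/
structure HasEnv {I : Type} (sz : I → ℕ) (inp : I → Data) (P : I → Instance 𝓕) : Prop where
  le : ∀ i, (P i).n ≤ sz i
  env : Comp sz inp fun i => (P i).env

namespace HasEnv

variable {I : Type} {sz : I → ℕ} {inp : I → Data} {P : I → Instance 𝓕}

theorem weaken (H : HasEnv sz inp P) {J : Type} (π : J → I) {inp' : J → Data}
    (h : Comp (fun j => sz (π j)) inp' fun j => (P (π j)).env) :
    HasEnv (fun j => sz (π j)) inp' fun j => P (π j) :=
  ⟨fun _ => H.le _, h⟩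

theorem reindex (H : HasEnv sz inp P) {J : Type} (π : J → I) :
    HasEnv (fun j => sz (π j)) (fun j => inp (π j)) fun j => P (π j) :=
  ⟨fun _ => H.le _, H.env.reindex π⟩

theorem group (H : HasEnv sz inp P) : HasGroup 𝓕 sz inp (fun i => (P i).n) fun i => (P i).d :=
  ⟨fun i => (P i).mem, H.le, H.env.fst⟩

theorem pk (H : HasEnv sz inp P) : Comp sz inp fun i => encPublicKey (P i).mpk := H.env.snd.fst

theorem g (H : HasEnv sz inp P) : Comp sz inp fun i => (P i).grp.enc (P i).mpk.g := H.pk.fst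

theorem X (H : HasEnv sz inp P) : Comp sz inp fun i => (P i).grp.enc (P i).mpk.X := H.pk.snd.fst

theorem Y (H : HasEnv sz inp P) : Comp sz inp fun i => (P i).grp.enc (P i).mpk.Y :=
  H.pk.snd.snd.fst

theorem Z (H : HasEnv sz inp P) : Comp sz inp fun i => (P i).grp.enc (P i).mpk.Z :=
  H.pk.snd.snd.snd.fst

theorem h (H : HasEnv sz inp P) : Comp sz inp fun i => (P i).grp.enc (P i).mpk.h :=
  H.pk.snd.snd.snd.snd

theorem y (H : HasEnv sz inp P) : Comp sz inp fun i => .num (P i).y.val := H.env.snd.snd.fst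

theorem t (H : HasEnv sz inp P) : Comp sz inp fun i => .num (P i).t.val := H.env.snd.snd.snd.fst

theorem z (H : HasEnv sz inp P) : Comp sz inp fun i => .num (P i).z.val :=
  H.env.snd.snd.snd.snd.fst

theorem ID (H : HasEnv sz inp P) : Comp sz inp fun i => .num (P i).ID.val :=
  H.env.snd.snd.snd.snd.snd

theorem uniform (H : HasEnv sz inp P) :
    Eff sz inp (V := fun i => ZMod (P i).grp.p) (fun _ a => .num a.val)
      fun i => sample (PMF.uniformOfFintype (ZMod (P i).grp.p)) :=
  H.group.uniform

end HasEnv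

theorem Comp.encKey {I : Type} {sz : I → ℕ} {inp : I → Data} {P : I → Instance 𝓕}
    {k : ∀ i, Key (P i).grp}
    (h₁ : Comp sz inp fun i => (P i).grp.enc (k i).d₁)
    (h₂ : Comp sz inp fun i => (P i).grp.enc (k i).d₂)
    (h₃ : Comp sz inp fun i => .num (k i).d₃.val) : Comp sz inp fun i => AIBE.encKey (k i) :=
  h₁.pair (h₂.pair h₃)

/-- The key for an identity other than the target, without the master secret key: with
`W = Y * R * h ^ t` and the factor `W ^ (-1 / (ID - IDstar))` in `d₂`, the unknown root of `W`
cancels in `d₁`. -/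
def bbKey (P : Instance 𝓕) (ID : ZMod P.grp.p) (R : P.grp.G) (r t : ZMod P.grp.p) : Key P.grp :=
  ⟨((P.mpk.Y * R * P.mpk.h ^ t.val) ^ (P.z * (ID - P.ID)⁻¹).val)⁻¹ *
      (P.mpk.g ^ ID.val * P.mpk.Z) ^ r.val,
    P.mpk.X ^ r.val * ((P.mpk.Y * R * P.mpk.h ^ t.val) ^ ((ID - P.ID)⁻¹).val)⁻¹, t⟩

theorem exists_bbKey_eq (P : Instance 𝓕) {ID : ZMod P.grp.p} (hID : ID ≠ P.ID) (R : P.grp.G)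
    (t : ZMod P.grp.p) :
    ∃ w : ZMod P.grp.p, ∀ r, bbKey P ID R r t = keyOf P.mpk P.x ID R (r - w) t := by
  obtain ⟨ρ, rfl⟩ := exists_pow_val P.X_ne R
  have hΔ : ID - P.ID ≠ 0 := sub_ne_zero.2 hID
  refine ⟨(P.y - P.b * P.t + ρ + P.b * t) * (ID - P.ID)⁻¹, fun r => ?_⟩
  simp only [bbKey, keyOf, Instance.mpk, Instance.x, inv_inv, ← pow_val_mul, ← pow_val_neg,
    ← pow_val_add, Key.mk.injEq, and_true]
  constructor
  · congr 2
    field_simp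
    ring
  · congr 2
    ring

theorem keyDist_eq (P : Instance 𝓕) {ID : ZMod P.grp.p} (hID : ID ≠ P.ID) (R : P.grp.G) :
    keyDist P.mpk P.x ID R = PMF.uniformOfFintype (ZMod P.grp.p) >>= fun t =>
      PMF.uniformOfFintype (ZMod P.grp.p) >>= fun r => pure (bbKey P ID R r t) := by
  unfold keyDist
  congr 1
  funext t
  obtain ⟨w, hw⟩ := exists_bbKey_eq P hID R t
  conv_lhs => rw [← uniform_map_equiv (Equiv.subRight w)]
  change PMF.bind (PMF.map _ _) _ = PMF.bind _ _
  rw [PMF.bind_map]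
  congr 1
  funext r
  simp [hw]

/-- The data that represent an entry of the table of runs. -/
def encEntry {𝔾 : BilinearGroup} : Option (𝔾.G × 𝔾.G × ZMod 𝔾.p) → Data
  | none => .num 1
  | some (R, u, c) => .pair (𝔾.enc R) (.pair (𝔾.enc u) (.num c.val))

/-- The data that represent the outcome of a search in the table of runs. -/
def encFind {𝔾 : BilinearGroup} : Option (Option (𝔾.G × 𝔾.G × ZMod 𝔾.p)) → Data
  | none => .num 0
  | some e => encEntry e

/-- The data that represent the table of runs. -/
def encTable {𝔾 : BilinearGroup} : Table 𝔾 → Data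
  | [] => .num 0
  | e :: L => .pair (.pair (.num e.1.val) (encEntry e.2)) (encTable L)

/-- One step of the search for `ID` in the table. -/
def findStep {𝔾 : BilinearGroup} (ID : ZMod 𝔾.p) :
    Table 𝔾 → Timed (Table 𝔾 ⊕ Option (Option (𝔾.G × 𝔾.G × ZMod 𝔾.p)))
  | [] => pure (.inr none)
  | e :: L => pure (if e.1 = ID then .inr (some e.2) else .inl L)

theorem iter_findStep {𝔾 : BilinearGroup} (ID : ZMod 𝔾.p) (L : Table 𝔾) (n : ℕ)
    (h : L.length < n) : iter (findStep ID) n L = pure (L.find ID) := by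
  induction L generalizing n with
  | nil =>
    obtain ⟨n, rfl⟩ : ∃ m, n = m + 1 := ⟨n - 1, by simp at h; omega⟩
    rw [iter, findStep, pure_bind, Table.find]
  | cons e L ih =>
    obtain ⟨n, rfl⟩ : ∃ m, n = m + 1 := ⟨n - 1, by simp at h; omega⟩
    rw [iter, findStep, pure_bind, Table.find]
    split_ifs
    · rfl
    · exact ih n (by simpa using h)

theorem length_le_size_encTable {𝔾 : BilinearGroup} (L : Table 𝔾) :
    L.length ≤ (encTable L).size := by
  induction L with
  | nil => simp
  | cons e L ih =>
    simp only [encTable, Data.size, List.length_cons]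
    omega

theorem num_val_eq_iff {p : ℕ} {a b : ZMod p} (h : p.Prime) :
    Data.num a.val = Data.num b.val ↔ a = b := by
  have := Fact.mk h
  rw [Data.num.injEq]
  exact (ZMod.val_injective p).eq_iff

namespace HasEnv

variable {I : Type} {sz : I → ℕ} {inp : I → Data} {P : I → Instance 𝓕}

theorem keyDist (H : HasEnv sz inp P) {ID : ∀ i, ZMod (P i).grp.p} {R : ∀ i, (P i).grp.G}
    (hne : ∀ i, ID i ≠ (P i).ID) (hID : Comp sz inp fun i => .num (ID i).val)
    (hR : Comp sz inp fun i => (P i).grp.enc (R i)) :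
    Eff sz inp (V := fun i => Key (P i).grp) (fun _ => AIBE.encKey)
      fun i => sample (AIBE.keyDist (P i).mpk (P i).x (ID i) (R i)) := by
  have := Eff.bind (m₂ := fun i t => sample (PMF.uniformOfFintype (ZMod (P i).grp.p)) >>=
    fun r => pure (bbKey (P i) (ID i) (R i) r t)) (encW := fun i (k : Key (P i).grp) => AIBE.encKey k)
    H.uniform H.env
    (fun {J} π t inp' _ ht w => Eff.bind (H.weaken π (w H.env)).uniform ht
      (fun {J'} π' r inp'' _ hr w' => Eff.pure ?_))
  · refine this.congr fun i => ?_
    rw [keyDist_eq (P i) (hne i)]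
    simp only [sample_bind, sample_pure]
  · have H' : HasEnv (fun j => sz (π (π' j))) inp'' fun j => P (π (π' j)) :=
      (H.weaken π (w H.env)).weaken π' (w' (w H.env))
    have hΔ := H'.group.zmodInv (H'.group.zmodSub (w' (w hID)) H'.ID)
      fun j => sub_ne_zero.2 (hne (π (π' j)))
    have hW := H'.group.mul (H'.group.mul H'.Y (w' (w hR))) (H'.group.pow H'.h (w' ht))
    have hF := H'.group.mul (H'.group.pow H'.g (w' (w hID))) H'.Z
    exact Comp.encKey (k := fun j => bbKey (P (π (π' j))) (ID _) (R _) (r j) (t _))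
      (H'.group.mul (H'.group.inv (H'.group.pow hW (H'.group.zmodMul H'.z hΔ)))
        (H'.group.pow hF hr))
      (H'.group.mul (H'.group.pow H'.X hr) (H'.group.inv (H'.group.pow hW hΔ))) (w' ht)

theorem verifyP (H : HasEnv sz inp P) {R u : ∀ i, (P i).grp.G} {c s s' : ∀ i, ZMod (P i).grp.p}
    (hR : Comp sz inp fun i => (P i).grp.enc (R i)) (hu : Comp sz inp fun i => (P i).grp.enc (u i))
    (hc : Comp sz inp fun i => .num (c i).val) (hs : Comp sz inp fun i => .num (s i).val)
    (hs' : Comp sz inp fun i => .num (s' i).val) :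
    CompP sz inp fun i => okamotoVerify (P i).mpk (R i) (u i) (c i) (s i) (s' i) :=
  (Comp.eqP (H.group.mul (H.group.pow H.h hs) (H.group.pow H.X hs'))
    (H.group.mul hu (H.group.pow hR hc))).congr fun i => (P i).grp.enc_injective.eq_iff

theorem find {L : ∀ i, Table (P i).grp} {ID : ∀ i, ZMod (P i).grp.p}
    (hL : Comp sz inp fun i => encTable (L i)) (hID : Comp sz inp fun i => .num (ID i).val) :
    Comp sz inp fun i => encFind ((L i).find (ID i)) := by
  have := Eff.loop (S := fun i => Table (P i).grp) (sz := sz) (inp := inp)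
    (enc := fun i L => .pair (.num (ID i).val) (encTable L)) (encR := fun i => encFind)
    (step := fun i => findStep (ID i)) (N := fun i => (L i).length + 1)
    (Q := fun i => (Data.num (ID i).val).size + (encTable (L i)).size + 1) (s₀ := L)
    (fun i n L' => L'.length < n ∧ (encTable L').size ≤ (encTable (L i)).size)
    ((hL.bounded.of_le fun i => length_le_size_encTable _).add (Bounded.const 1))
    ((hID.bounded.add hL.bounded).add (Bounded.const 1))
    (fun i n L' h => by
      have := h.2
      simp only [Data.size]
      omega)
    (fun i n L' h j hj s' j' hr => by
      cases L' with
      | nil => cases (reach_pure.1 hr).1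
      | cons e L' =>
        have hs := (reach_pure.1 hr).1
        split_ifs at hs
        cases hs
        simp only [encTable, Data.size, List.length_cons] at h
        omega)
    (fun i => ⟨Nat.lt_succ_self _, le_rfl⟩)
    (by
      intro J π L' n _ _ hs
      have h1 : Comp _ _ fun j => Data.num (ID (π j)).val := hs.fst
      have h2 : Comp _ _ fun j => encTable (L' j) := hs.snd
      have hnil : CompP _ _ fun j => L' j = [] := (Comp.eqP h2 (h2.const (.num 0))).congr fun j => by
        cases L' j <;> simp [encTable]
      refine Eff.cases hnil ?_ ?_
      · refine (Eff.pure (v := fun j => .inr none) ?_).congr fun j => ?_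
        · exact ((h1.const (.num 0)).pair (h1.const (.num 0))).reindex _
        · rw [j.2]
          rfl
      · have : ∀ j : {j // ¬ L' j = []}, ∃ e M, L' j = e :: M := fun j => List.exists_cons_of_ne_nil j.2
        choose e M heM using this
        have h3 : Comp _ _ fun j : {j // ¬ L' j = []} => encTable (L' j) := h2.reindex _
        have h3' := h3.congr fun j => congrArg encTable (heM j)
        have he : CompP _ _ fun j => (e j).1 = ID (π j) :=
          (Comp.eqP h3'.fst.fst (h1.reindex _)).congr fun j => num_val_eq_iff (P (π j)).grp.prime
        refine Eff.cases he ?_ ?_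
        · refine (Eff.pure (v := fun j => .inr (some (e j.1).2)) ?_).congr fun j => ?_
          · exact ((h3.const (.num 0)).pair h3'.fst.snd).reindex _
          · rw [heM, findStep, if_pos j.2]
        · refine (Eff.pure (v := fun j => .inl (M j.1)) ?_).congr fun j => ?_
          · exact ((h3.const (.num 1)).pair ((h1.reindex _).pair h3'.snd)).reindex _
          · rw [heM, findStep, if_neg j.2])
    (hID.pair hL)
  exact (this.congr fun i => iter_findStep _ _ _ (Nat.lt_succ_self _)).toComp

end HasEnv

/-- The data that represent an answer and the new table of runs. -/
def encReply {𝔾 : BilinearGroup} (r : Data × Table 𝔾) : Data := .pair r.1 (encTable r.2)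

/-- The data that represent the state of the simulation. -/
def encState {𝔾 : BilinearGroup} (σ : Table 𝔾 × Data × Data) : Data :=
  .pair (encTable σ.1) (.pair σ.2.1 σ.2.2)

/-- The data that represent the state of the simulation at an interruption. -/
def encHalt {𝔾 : BilinearGroup} (τ : Table 𝔾 × Data × Message 𝔾) : Data :=
  .pair (encTable τ.1) (.pair τ.2.1 (encMessage τ.2.2))

theorem encFind_eq_zero_iff {𝔾 : BilinearGroup} {o : Option (Option (𝔾.G × 𝔾.G × ZMod 𝔾.p))} :
    encFind o = .num 0 ↔ o = none := by
  rcases o with _ | _ | ⟨R, u, c⟩ <;> simp [encFind, encEntry]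

theorem encFind_eq_one_iff {𝔾 : BilinearGroup} {o : Option (Option (𝔾.G × 𝔾.G × ZMod 𝔾.p))} :
    encFind o = .num 1 ↔ o = some none := by
  rcases o with _ | _ | ⟨R, u, c⟩ <;> simp [encFind, encEntry]

namespace HasEnv

variable {I : Type} {sz : I → ℕ} {inp : I → Data} {P : I → Instance 𝓕}

theorem eqIDP (H : HasEnv sz inp P) {ID : ∀ i, ZMod (P i).grp.p}
    (hID : Comp sz inp fun i => .num (ID i).val) : CompP sz inp fun i => ID i = (P i).ID :=
  (Comp.eqP hID H.ID).congr fun i => num_val_eq_iff (P i).grp.prime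

theorem replyStart (H : HasEnv sz inp P) {L : ∀ i, Table (P i).grp} {ID : ∀ i, ZMod (P i).grp.p}
    {R u : ∀ i, (P i).grp.G} (hL : Comp sz inp fun i => encTable (L i))
    (hID : Comp sz inp fun i => .num (ID i).val) (hR : Comp sz inp fun i => (P i).grp.enc (R i))
    (hu : Comp sz inp fun i => (P i).grp.enc (u i)) :
    Eff sz inp (V := fun i => Data × Table (P i).grp) (fun _ => encReply)
      fun i => sample (reply (P i).mpk (P i).x (P i).ID (L i) (.start (ID i) (R i) (u i))) := by
  have hbot : Eff sz inp (fun i => encReply) fun i => Pure.pure (botReply, L i) :=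
    Eff.pure ((hL.const botReply).pair hL)
  refine Eff.cases (H.eqIDP hID) ?_ ?_
  · exact Eff.congr (hbot.reindex _) fun j => by rw [reply, if_pos j.2, sample_pure]
  · have hf : CompP sz inp fun i => (L i).find (ID i) = none :=
      (Comp.eqP (find (P := P) hL hID) (hL.const (.num 0))).congr fun i => encFind_eq_zero_iff
    refine Eff.cases (hf.reindex _) ?_ ?_
    · refine (Eff.bind (m₂ := fun j c => Pure.pure (challengeReply c,
        (ID j.1.1, some (R j.1.1, u j.1.1, c)) :: L j.1.1)) ((H.reindex _).reindex _).uniform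
        ((hL.reindex _).reindex _) (fun π c inp' _ hc w => Eff.pure ?_)).congr fun j => ?_
      · exact ((hc.const (.num 1)).pair hc).pair (((w ((hID.reindex _).reindex _)).pair
          ((w ((hR.reindex _).reindex _)).pair ((w ((hu.reindex _).reindex _)).pair hc))).pair
            (w ((hL.reindex _).reindex _)))
      · rw [reply, if_neg j.1.2]
        have := j.2
        simp only [this, sample_bind, sample_pure]
    · refine Eff.congr ((hbot.reindex _).reindex _) fun j => ?_
      rw [reply, if_neg j.1.2]
      obtain ⟨e, he⟩ := Option.ne_none_iff_exists'.1 j.2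
      simp only [he, sample_pure]

theorem replyRespond (H : HasEnv sz inp P) {L : ∀ i, Table (P i).grp}
    {ID s s' : ∀ i, ZMod (P i).grp.p} (hL : Comp sz inp fun i => encTable (L i))
    (hID : Comp sz inp fun i => .num (ID i).val) (hs : Comp sz inp fun i => .num (s i).val)
    (hs' : Comp sz inp fun i => .num (s' i).val) :
    Eff sz inp (V := fun i => Data × Table (P i).grp) (fun _ => encReply)
      fun i => sample (reply (P i).mpk (P i).x (P i).ID (L i) (.respond (ID i) (s i) (s' i))) := by
  have hbot : Eff sz inp (fun i => encReply) fun i => Pure.pure (botReply, L i) :=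
    Eff.pure ((hL.const botReply).pair hL)
  refine Eff.cases (H.eqIDP hID) ?_ ?_
  · exact Eff.congr (hbot.reindex _) fun j => by rw [reply, if_pos j.2, sample_pure]
  have hf : Comp sz inp fun i => encFind ((L i).find (ID i)) := find (P := P) hL hID
  have h0 : CompP sz inp fun i => (L i).find (ID i) = none ∨ (L i).find (ID i) = some none :=
    ((Comp.eqP hf (hL.const (.num 0))).or (Comp.eqP hf (hL.const (.num 1)))).congr fun i =>
      or_congr encFind_eq_zero_iff encFind_eq_one_iff
  refine Eff.cases (h0.reindex _) ?_ ?_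
  · refine Eff.congr ((hbot.reindex _).reindex _) fun j => ?_
    rw [reply, if_neg j.1.2]
    obtain h | h := j.2
    · simp only [h, sample_pure]
    · simp only [h, sample_pure]
  have hex : ∀ j : {j : {i // ¬ ID i = (P i).ID} // ¬ ((L j.1).find (ID j.1) = none ∨
      (L j.1).find (ID j.1) = some none)},
      ∃ R u c, (L j.1.1).find (ID j.1.1) = some (some (R, u, c)) := by
    intro j
    have h := j.2
    match hj : (L j.1.1).find (ID j.1.1) with
    | none => exact absurd (Or.inl hj) h
    | some none => exact absurd (Or.inr hj) h
    | some (some (R, u, c)) => exact ⟨R, u, c, rfl⟩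
  choose R u c hRuc using hex
  have hf' := ((hf.reindex _).reindex _).congr fun j => congrArg encFind (hRuc j)
  have hR := hf'.fst
  have hu := hf'.snd.fst
  have hc := hf'.snd.snd
  have hL' := (hL.reindex fun i : {i // ¬ ID i = (P i).ID} => i.1).reindex
    fun j : {j : {i // ¬ ID i = (P i).ID} // ¬ ((L j.1).find (ID j.1) = none ∨
      (L j.1).find (ID j.1) = some none)} => j.1
  have hID' := (hID.reindex fun i : {i // ¬ ID i = (P i).ID} => i.1).reindex
    fun j : {j : {i // ¬ ID i = (P i).ID} // ¬ ((L j.1).find (ID j.1) = none ∨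
      (L j.1).find (ID j.1) = some none)} => j.1
  have H' := (H.reindex fun i : {i // ¬ ID i = (P i).ID} => i.1).reindex
    fun j : {j : {i // ¬ ID i = (P i).ID} // ¬ ((L j.1).find (ID j.1) = none ∨
      (L j.1).find (ID j.1) = some none)} => j.1
  have hentry := ((hID'.pair (hID'.const (.num 1))).pair hL')
  have hv : CompP _ _ fun j => okamotoVerify (P j.1.1).mpk (R j) (u j) (c j) (s j.1.1) (s' j.1.1) :=
    H'.verifyP hR hu hc ((hs.reindex _).reindex _) ((hs'.reindex _).reindex _)
  refine Eff.cases hv ?_ ?_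
  · refine (Eff.bind (m₂ := fun j k => Pure.pure (keyReply k, (ID j.1.1.1, none) :: L j.1.1.1))
      ((H'.reindex _).keyDist (fun j => j.1.1.2) (hID'.reindex _) (hR.reindex _)) (hL'.reindex _)
      (fun π k inp' _ hk w => Eff.pure ?_)).congr fun j => ?_
    · exact ((hk.const (.num 2)).pair hk).pair (w (hentry.reindex _))
    · rw [reply, if_neg j.1.1.2]
      simp only [hRuc, j.2, if_true, sample_bind, sample_pure]
  · have h : Eff _ _ (fun _ => encReply) fun j : {j : {i // ¬ ID i = (P i).ID} //
        ¬ ((L j.1).find (ID j.1) = none ∨ (L j.1).find (ID j.1) = some none)} =>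
        Pure.pure (botReply, (ID j.1.1, none) :: L j.1.1) := Eff.pure ((hentry.const (.num 0)).pair hentry)
    refine Eff.congr (h.reindex _) fun j => ?_
    · rw [reply, if_neg j.1.1.2]
      simp only [hRuc, j.2, if_false, sample_pure]

end HasEnv

/-! ### Recognition of messages -/

theorem encMessage_start_iff {𝔾 : BilinearGroup} (y : Data) :
    (∃ ID R u, encMessage (𝔾 := 𝔾) (.start ID R u) = y) ↔
      (y = .pair (.num 0) (.pair (.num y.snd.fst.toNat) (.pair y.snd.snd.fst y.snd.snd.snd)) ∧
        y.snd.fst.toNat < 𝔾.p) ∧ y.snd.snd.fst ∈ Set.range 𝔾.enc ∧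
        y.snd.snd.snd ∈ Set.range 𝔾.enc := by
  constructor
  · rintro ⟨ID, R, u, rfl⟩
    exact ⟨⟨rfl, ZMod.val_lt ID⟩, ⟨R, rfl⟩, ⟨u, rfl⟩⟩
  · rintro ⟨⟨h1, h2⟩, ⟨R, hR⟩, ⟨u, hu⟩⟩
    refine ⟨(y.snd.fst.toNat : ZMod 𝔾.p), R, u, ?_⟩
    rw [encMessage, ZMod.val_cast_of_lt h2, hR, hu]
    exact h1.symm

theorem encMessage_respond_iff {𝔾 : BilinearGroup} (y : Data) :
    (∃ ID s s', encMessage (𝔾 := 𝔾) (.respond ID s s') = y) ↔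
      (y = .pair (.num 1) (.pair (.num y.snd.fst.toNat)
        (.pair (.num y.snd.snd.fst.toNat) (.num y.snd.snd.snd.toNat))) ∧
        y.snd.fst.toNat < 𝔾.p) ∧ y.snd.snd.fst.toNat < 𝔾.p ∧ y.snd.snd.snd.toNat < 𝔾.p := by
  constructor
  · rintro ⟨ID, s, s', rfl⟩
    exact ⟨⟨rfl, ZMod.val_lt ID⟩, ZMod.val_lt s, ZMod.val_lt s'⟩
  · rintro ⟨⟨h1, h2⟩, h3, h4⟩
    refine ⟨(y.snd.fst.toNat : ZMod 𝔾.p), (y.snd.snd.fst.toNat : ZMod 𝔾.p),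
      (y.snd.snd.snd.toNat : ZMod 𝔾.p), ?_⟩
    rw [encMessage, ZMod.val_cast_of_lt h2, ZMod.val_cast_of_lt h3, ZMod.val_cast_of_lt h4]
    exact h1.symm

theorem encKey_iff {𝔾 : BilinearGroup} (y : Data) :
    (∃ k : Key 𝔾, encKey k = y) ↔
      (y = .pair y.fst (.pair y.snd.fst (.num y.snd.snd.toNat)) ∧ y.snd.snd.toNat < 𝔾.p) ∧
        y.fst ∈ Set.range 𝔾.enc ∧ y.snd.fst ∈ Set.range 𝔾.enc := by
  constructor
  · rintro ⟨k, rfl⟩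
    exact ⟨⟨rfl, ZMod.val_lt k.d₃⟩, ⟨k.d₁, rfl⟩, ⟨k.d₂, rfl⟩⟩
  · rintro ⟨⟨h1, h2⟩, ⟨d₁, h3⟩, ⟨d₂, h4⟩⟩
    refine ⟨⟨d₁, d₂, (y.snd.snd.toNat : ZMod 𝔾.p)⟩, ?_⟩
    rw [encKey, ZMod.val_cast_of_lt h2, h3, h4]
    exact h1.symm

theorem encMessage_output_iff {𝔾 : BilinearGroup} (y : Data) :
    (∃ k₁ k₂, encMessage (𝔾 := 𝔾) (.output k₁ k₂) = y) ↔
      y = .pair (.num 2) (.pair y.snd.fst y.snd.snd) ∧ (∃ k : Key 𝔾, encKey k = y.snd.fst) ∧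
        ∃ k : Key 𝔾, encKey k = y.snd.snd := by
  constructor
  · rintro ⟨k₁, k₂, rfl⟩
    exact ⟨rfl, ⟨k₁, rfl⟩, ⟨k₂, rfl⟩⟩
  · rintro ⟨h1, ⟨k₁, h2⟩, ⟨k₂, h3⟩⟩
    refine ⟨k₁, k₂, ?_⟩
    rw [encMessage, h2, h3]
    exact h1.symm

namespace HasGroup

variable {I : Type} {sz : I → ℕ} {inp : I → Data} {n : I → ℕ} {d : I → Data} {y : I → Data}

theorem startP (H : HasGroup 𝓕 sz inp n d) (hy : Comp sz inp y) :
    CompP sz inp fun i => ∃ ID R u, encMessage (𝔾 := 𝓕.grp (d i)) (.start ID R u) = y i := by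
  have h := hy.snd
  exact (((Comp.eqP hy ((hy.const (.num 0)).pair (h.fst.toNat.pair (h.snd.fst.pair h.snd.snd)))).and
    (Comp.ltP h.fst.toNat H.order)).and ((H.memP h.snd.fst).and (H.memP h.snd.snd))).congr
    fun i => (encMessage_start_iff (y i)).symm

theorem respondP (H : HasGroup 𝓕 sz inp n d) (hy : Comp sz inp y) :
    CompP sz inp fun i => ∃ ID s s', encMessage (𝔾 := 𝓕.grp (d i)) (.respond ID s s') = y i := by
  have h := hy.snd
  exact (((Comp.eqP hy ((hy.const (.num 1)).pair (h.fst.toNat.pair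
    (h.snd.fst.toNat.pair h.snd.snd.toNat)))).and (Comp.ltP h.fst.toNat H.order)).and
    ((Comp.ltP h.snd.fst.toNat H.order).and (Comp.ltP h.snd.snd.toNat H.order))).congr
    fun i => (encMessage_respond_iff (y i)).symm

theorem keyP (H : HasGroup 𝓕 sz inp n d) (hy : Comp sz inp y) :
    CompP sz inp fun i => ∃ k : Key (𝓕.grp (d i)), encKey k = y i :=
  (((Comp.eqP hy (hy.fst.pair (hy.snd.fst.pair hy.snd.snd.toNat))).and
    (Comp.ltP hy.snd.snd.toNat H.order)).and ((H.memP hy.fst).and (H.memP hy.snd.fst))).congr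
    fun i => (encKey_iff (y i)).symm

theorem outputP (H : HasGroup 𝓕 sz inp n d) (hy : Comp sz inp y) :
    CompP sz inp fun i => ∃ k₁ k₂, encMessage (𝔾 := 𝓕.grp (d i)) (.output k₁ k₂) = y i :=
  ((Comp.eqP hy ((hy.const (.num 2)).pair (hy.snd.fst.pair hy.snd.snd))).and
    ((H.keyP hy.snd.fst).and (H.keyP hy.snd.snd))).congr fun i => (encMessage_output_iff (y i)).symm

end HasGroup

/-! ### One activation of the adversary -/

open Classical in
/-- The part of an activation after a well-formed message of the adversary. -/
def afterMessage {𝔾 : BilinearGroup} (mpk : PublicKey 𝔾) (x : (ZMod 𝔾.p)ˣ) (IDstar : ZMod 𝔾.p)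
    (ph : Phase) (L : Table 𝔾) (st : Data) (msg : Message 𝔾) :
    Timed ((Table 𝔾 × Data × Data) ⊕ (Table 𝔾 × Data × Message 𝔾)) :=
  if ph.Halts IDstar msg then pure (.inr (L, st, msg))
  else do
    let r ← sample (reply mpk x IDstar L msg)
    pure (.inl (r.2, st, r.1))

/-- The part of an activation after a message of the adversary. -/
def afterData {𝔾 : BilinearGroup} (mpk : PublicKey 𝔾) (x : (ZMod 𝔾.p)ˣ) (IDstar : ZMod 𝔾.p)
    (ph : Phase) (L : Table 𝔾) (st m : Data) :
    Timed ((Table 𝔾 × Data × Data) ⊕ (Table 𝔾 × Data × Message 𝔾)) :=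
  match decMessage 𝔾 m with
  | none => pure (.inl (L, st, botReply))
  | some msg => afterMessage mpk x IDstar ph L st msg

/-- The part of an activation after the adversary has returned. -/
def afterOutput {𝔾 : BilinearGroup} (mpk : PublicKey 𝔾) (x : (ZMod 𝔾.p)ˣ) (IDstar : ZMod 𝔾.p)
    (ph : Phase) (L : Table 𝔾) :
    Data → Timed ((Table 𝔾 × Data × Data) ⊕ (Table 𝔾 × Data × Message 𝔾))
  | .num _ => failure
  | .pair st m => afterData mpk x IDstar ph L st m

theorem runStep_eq {𝔾 : BilinearGroup} (A : Code) (mpk : PublicKey 𝔾) (x : (ZMod 𝔾.p)ˣ)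
    (IDstar : ZMod 𝔾.p) (ph : Phase) (σ : Table 𝔾 × Data × Data) :
    runStep A mpk x IDstar ph σ =
      A.eval (.pair σ.2.1 σ.2.2) >>= afterOutput mpk x IDstar ph σ.1 := by
  unfold runStep
  congr 1

/-- The data that represent the outcome of an activation in the instance `P`. -/
def encStep (P : Instance 𝓕) :
    (Table P.grp × Data × Data) ⊕ (Table P.grp × Data × Message P.grp) → Data :=
  encSum (fun σ => .pair P.env (encState σ)) encHalt

namespace HasEnv

variable {I : Type} {sz : I → ℕ} {inp : I → Data} {P : I → Instance 𝓕}

theorem falseP {x : I → Data} (h : Comp sz inp x) : CompP sz inp fun _ => False :=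
  (Comp.eqP (h.const (.num 0)) (h.const (.num 1))).congr fun _ => by simp

theorem trueP {x : I → Data} (h : Comp sz inp x) : CompP sz inp fun _ => True :=
  (falseP h).not.congr fun _ => by simp

theorem afterMessage (H : HasEnv sz inp P) (ph : Phase) {L : ∀ i, Table (P i).grp} {st : I → Data}
    {msg : ∀ i, Message (P i).grp} (hL : Comp sz inp fun i => encTable (L i)) (hst : Comp sz inp st)
    (hmsg : Comp sz inp fun i => encMessage (msg i))
    (hh : CompP sz inp fun i => ph.Halts (P i).ID (msg i))
    (hr : Eff sz inp (V := fun i => Data × Table (P i).grp) (fun _ => encReply)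
      fun i => sample (reply (P i).mpk (P i).x (P i).ID (L i) (msg i))) :
    Eff sz inp (fun i => encStep (P i))
      fun i => AIBE.afterMessage (P i).mpk (P i).x (P i).ID ph (L i) (st i) (msg i) := by
  have h₁ : Eff sz inp (fun i => encStep (P i)) fun i => pure (.inr (L i, st i, msg i)) :=
    Eff.pure ((hL.const (.num 0)).pair (hL.pair (hst.pair hmsg)))
  have h₂ : Eff sz inp (fun i => encStep (P i)) fun i =>
      sample (reply (P i).mpk (P i).x (P i).ID (L i) (msg i)) >>= fun r =>
        pure (.inl (r.2, st i, r.1)) :=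
    Eff.bind hr hst fun π r inp' _ hr w => Eff.pure ((hr.const (.num 1)).pair ((w H.env).pair
      (hr.snd.pair ((w hst).pair hr.fst))))
  refine Eff.cases hh (Eff.congr (h₁.reindex _) fun j => ?_) (Eff.congr (h₂.reindex _) fun j => ?_)
  · rw [AIBE.afterMessage, if_pos j.2]
  · rw [AIBE.afterMessage, if_neg j.2]

theorem afterData (H : HasEnv sz inp P) (ph : Phase) {L : ∀ i, Table (P i).grp} {st m : I → Data}
    (hL : Comp sz inp fun i => encTable (L i)) (hst : Comp sz inp st) (hm : Comp sz inp m) :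
    Eff sz inp (fun i => encStep (P i))
      fun i => AIBE.afterData (P i).mpk (P i).x (P i).ID ph (L i) (st i) (m i) := by
  have key : ∀ {J : Type} (π : J → I) (msg : ∀ j, Message (P (π j)).grp),
      (∀ j, encMessage (msg j) = m (π j)) →
      (CompP (fun j => sz (π j)) (fun j => inp (π j)) fun j => ph.Halts (P (π j)).ID (msg j)) →
      (Eff (fun j => sz (π j)) (fun j => inp (π j)) (V := fun j => Data × Table (P (π j)).grp)
        (fun _ => encReply)
        fun j => sample (reply (P (π j)).mpk (P (π j)).x (P (π j)).ID (L (π j)) (msg j))) →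
      Eff (fun j => sz (π j)) (fun j => inp (π j)) (fun j => encStep (P (π j))) fun j =>
        AIBE.afterData (P (π j)).mpk (P (π j)).x (P (π j)).ID ph (L (π j)) (st (π j))
          (m (π j)) := by
    intro J π msg hmsg hh hr
    refine Eff.congr ((H.reindex π).afterMessage ph (hL.reindex π) (hst.reindex π)
      ((hm.reindex π).congr fun j => (hmsg j).symm) hh hr) fun j => ?_
    rw [AIBE.afterData, decMessage_eq_some.2 (hmsg j)]
  refine Eff.cases (H.group.startP hm) ?_ ?_
  · choose ID R u hmsg using fun j : {i // ∃ ID R u,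
      encMessage (𝔾 := (P i).grp) (.start ID R u) = m i} => j.2
    have hm' := (hm.reindex fun j : {i // ∃ ID R u,
      encMessage (𝔾 := (P i).grp) (.start ID R u) = m i} => j.1).congr fun j => (hmsg j).symm
    have hID := hm'.snd.fst
    refine key _ _ hmsg ?_ ((H.reindex _).replyStart (hL.reindex _) hID hm'.snd.snd.fst
      hm'.snd.snd.snd)
    cases ph
    · exact (H.reindex _).eqIDP hID
    · exact falseP hID
    · exact falseP hID
  refine Eff.cases ((H.group.respondP hm).reindex _) ?_ ?_
  · choose ID s s' hmsg using fun j : {j : {i // ¬ ∃ ID R u,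
      encMessage (𝔾 := (P i).grp) (.start ID R u) = m i} // ∃ ID s s',
      encMessage (𝔾 := (P j.1).grp) (.respond ID s s') = m j.1} => j.2
    have hm' := (hm.reindex fun j : {j : {i // ¬ ∃ ID R u,
      encMessage (𝔾 := (P i).grp) (.start ID R u) = m i} // ∃ ID s s',
      encMessage (𝔾 := (P j.1).grp) (.respond ID s s') = m j.1} => j.1.1).congr
        fun j => (hmsg j).symm
    have hID := hm'.snd.fst
    refine key _ _ hmsg ?_ ((H.reindex _).replyRespond (hL.reindex _) hID hm'.snd.snd.fst
      hm'.snd.snd.snd)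
    cases ph
    · exact falseP hID
    · exact (H.reindex _).eqIDP hID
    · exact falseP hID
  refine Eff.cases (((H.group.outputP hm).reindex _).reindex _) ?_ ?_
  · choose k₁ k₂ hmsg using fun j : {j : {j : {i // ¬ ∃ ID R u,
      encMessage (𝔾 := (P i).grp) (.start ID R u) = m i} // ¬ ∃ ID s s',
      encMessage (𝔾 := (P j.1).grp) (.respond ID s s') = m j.1} // ∃ k₁ k₂,
      encMessage (𝔾 := (P j.1.1).grp) (.output k₁ k₂) = m j.1.1} => j.2
    refine key _ _ hmsg ?_ ?_
    · exact (trueP (hm.reindex _)).congr fun j => by cases ph <;> simp [Phase.Halts]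
    · exact (Eff.pure (V := fun i => Data × Table (P i).grp) (enc := fun _ => encReply)
        (v := fun i => (botReply, L i)) ((hL.const botReply).pair hL)).reindex _ |>.congr
        fun j => by rw [reply, sample_pure]
  · have h : Eff sz inp (fun i => encStep (P i)) fun i => pure (.inl (L i, st i, botReply)) :=
      Eff.pure ((hL.const (.num 1)).pair (H.env.pair (hL.pair (hst.pair (hL.const botReply)))))
    refine Eff.congr (((h.reindex _).reindex _).reindex _) fun j => ?_
    have hnone : decMessage (P j.1.1.1).grp (m j.1.1.1) = none := by
      by_contra hne
      obtain ⟨msg, hmsg⟩ := Option.ne_none_iff_exists'.1 hne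
      have := decMessage_eq_some.1 hmsg
      cases msg with
      | start ID R u => exact j.1.1.2 ⟨_, _, _, this⟩
      | respond ID s s' => exact j.1.2 ⟨_, _, _, this⟩
      | output k₁ k₂ => exact j.2 ⟨_, _, this⟩
    rw [AIBE.afterData, hnone]

theorem runStep (H : HasEnv sz inp P) (A : Code) (ph : Phase)
    {σ : ∀ i, Table (P i).grp × Data × Data} (hσ : Comp sz inp fun i => encState (σ i)) :
    Eff sz inp (fun i => encStep (P i))
      fun i => AIBE.runStep A (P i).mpk (P i).x (P i).ID ph (σ i) := by
  refine Eff.congr (Eff.bind (m₂ := fun i =>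
      afterOutput (P i).mpk (P i).x (P i).ID ph (σ i).1) (Eff.call A hσ.snd) H.env fun π out inp' _ hout w => ?_)
    fun i => (runStep_eq A _ _ _ ph (σ i)).symm
  refine Eff.of_failure (fun j => ∃ st m, out j = .pair st m) ?_ fun j hj => ?_
  · choose st m hsm using fun j : {j // ∃ st m, out j = .pair st m} => j.2
    have hsm' := (hout.reindex fun j : {j // ∃ st m, out j = .pair st m} => j.1).congr hsm
    refine Eff.congr (((H.weaken π (w H.env)).reindex _).afterData ph
      (L := fun j : {j // ∃ st m, out j = .pair st m} => (σ (π j.1)).1)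
      ((w hσ.fst).reindex _) hsm'.fst hsm'.snd) fun j => ?_
    rw [hsm j]
    rfl
  · match hout : out j with
    | .num _ => rfl
    | .pair st m => exact absurd ⟨st, m, hout⟩ hj

end HasEnv

/-! ### The run of the adversary -/

theorem size_encTable_le {𝔾 : BilinearGroup} {Q : ℕ} (hG : ∀ a : 𝔾.G, (𝔾.enc a).size ≤ Q)
    (hZ : ∀ e : ZMod 𝔾.p, (Data.num e.val).size ≤ Q) (L : Table 𝔾) :
    (encTable L).size ≤ L.length * (4 * Q + 8) + 2 := by
  induction L with
  | nil => simp [encTable, Data.size]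
  | cons e L ih =>
    have he : (encEntry e.2).size ≤ 3 * Q + 6 := by
      rcases e with ⟨e, _ | ⟨R, u, c⟩⟩
      · simp [encEntry, Data.size]
      · have := hG R
        have := hG u
        have := hZ c
        simp only [encEntry, Data.size] at this ⊢
        omega
    have := hZ e.1
    simp only [encTable, List.length_cons, add_mul, one_mul] at ih ⊢
    simp only [Data.size] at this ⊢
    omega

/-- The table grows by at most one entry, and the answers are short. -/
theorem reply_support {𝔾 : BilinearGroup} {Q : ℕ} (hG : ∀ a : 𝔾.G, (𝔾.enc a).size ≤ Q)
    (hZ : ∀ e : ZMod 𝔾.p, (Data.num e.val).size ≤ Q) {mpk : PublicKey 𝔾} {x : (ZMod 𝔾.p)ˣ}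
    {IDstar : ZMod 𝔾.p} {L : Table 𝔾} {msg : Message 𝔾} {r : Data × Table 𝔾}
    (hr : r ∈ (reply mpk x IDstar L msg).support) :
    r.2.length ≤ L.length + 1 ∧ r.1.size ≤ 3 * Q + 10 := by
  have hbot : r = (botReply, L) → r.2.length ≤ L.length + 1 ∧ r.1.size ≤ 3 * Q + 10 := by
    rintro rfl
    simp [botReply, Data.size]
  have mem_pure : ∀ {α : Type} {a b : α}, a ∈ (pure b : PMF α).support → a = b := fun h =>
    (PMF.mem_support_pure_iff _ _).1 h
  have h2 : Nat.size 2 = 2 := by decide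
  cases msg with
  | start ID R u =>
    rw [reply] at hr
    split_ifs at hr
    · exact hbot (mem_pure hr)
    · split at hr
      · obtain ⟨c, -, hc⟩ := (PMF.mem_support_bind_iff _ _ _).1 hr
        cases mem_pure hc
        have := hZ c
        simp only [challengeReply, Data.size, List.length_cons, Nat.size_one] at this ⊢
        omega
      · exact hbot (mem_pure hr)
  | respond ID s s' =>
    rw [reply] at hr
    split_ifs at hr
    · exact hbot (mem_pure hr)
    · split at hr
      · split_ifs at hr
        · obtain ⟨k, -, hk⟩ := (PMF.mem_support_bind_iff _ _ _).1 hr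
          cases mem_pure hk
          have h3 := hZ k.d₃
          have := hG k.d₁
          have := hG k.d₂
          simp only [keyReply, encKey, Data.size, List.length_cons, h2] at h3 ⊢
          omega
        · cases mem_pure hr
          simp [botReply, Data.size]
      · exact hbot (mem_pure hr)
  | output k₁ k₂ => exact hbot (mem_pure hr)

namespace HasEnv

variable {I : Type} {sz : I → ℕ} {inp : I → Data} {P : I → Instance 𝓕}

theorem run (H : HasEnv sz inp P) (A : Code) (ph : Phase) {N : I → ℕ} (hN : ∀ i, N i ≤ sz i)
    {σ : ∀ i, Table (P i).grp × Data × Data} (hσ : Comp sz inp fun i => encState (σ i)) :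
    Eff sz inp (V := fun i => Table (P i).grp × Data × Message (P i).grp) (fun _ => encHalt)
      fun i => AIBE.run A (P i).mpk (P i).x (P i).ID (N i) ph (σ i) := by
  obtain ⟨Q₁, hQ₁, hG⟩ := H.group.enc_bounded
  obtain ⟨Q₂, hQ₂, hZ⟩ := H.group.zmod_bounded
  replace hG : ∀ i (a : (P i).grp.G), ((P i).grp.enc a).size ≤ Q₁ i + Q₂ i := fun i a =>
    (hG i a).trans (Nat.le_add_right _ _)
  replace hZ : ∀ i (a : ZMod (P i).grp.p), (Data.num a.val).size ≤ Q₁ i + Q₂ i := fun i a =>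
    (hZ i a).trans (Nat.le_add_left _ _)
  have hNB : Bounded sz N := Bounded.self.of_le hN
  let B : I → ℕ := fun i => (encState (σ i)).size + sz i + (3 * (Q₁ i + Q₂ i) + 10)
  have hB : Bounded sz B := (hσ.bounded.add Bounded.self).add
    (((Bounded.const 3).mul (hQ₁.add hQ₂)).add (Bounded.const 10))
  let M : I → ℕ := fun i => (encState (σ i)).size + N i
  refine Eff.loop (S := fun i => Table (P i).grp × Data × Data)
    (enc := fun i σ => .pair (P i).env (encState σ)) (encR := fun i => encHalt)
    (step := fun i => AIBE.runStep A (P i).mpk (P i).x (P i).ID ph) (N := N)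
    (Q := fun i => (P i).env.size + (M i * (4 * (Q₁ i + Q₂ i) + 8) + 2) + 2 * B i + 3)
    (s₀ := σ)
    (fun i n σ' => σ'.1.length + n ≤ M i ∧ σ'.2.1.size ≤ B i ∧ σ'.2.2.size ≤ B i)
    hNB ?_ ?_ ?_ ?_ ?_ (H.env.pair hσ)
  · exact ((H.env.bounded.add (((hσ.bounded.add hNB).mul (((Bounded.const 4).mul
      (hQ₁.add hQ₂)).add (Bounded.const 8))).add (Bounded.const 2))).add
      ((Bounded.const 2).mul hB)).add (Bounded.const 3)
  · intro i n σ' ⟨h1, h2, h3⟩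
    have := size_encTable_le (hG i) (hZ i) σ'.1
    have : σ'.1.length * (4 * (Q₁ i + Q₂ i) + 8) ≤ M i * (4 * (Q₁ i + Q₂ i) + 8) :=
      Nat.mul_le_mul_right _ (by omega)
    simp only [encState, Data.size] at *
    omega
  · intro i n σ' ⟨h1, h2, h3⟩ k hk σ'' k'' hr
    rw [runStep_eq] at hr
    obtain ⟨out, j, hr1, hr2⟩ := reach_bind.1 hr
    have hsize := A.reach_size hr1
    match out, hr1, hr2, hsize with
    | .num _, _, hr2, _ => exact (reach_failure hr2).elim
    | .pair st m, _, hr2, hsize =>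
      simp only [Data.size] at hsize
      have hst : st.size ≤ B i := by
        simp only [B]
        omega
      rw [afterOutput, AIBE.afterData] at hr2
      split at hr2
      · cases Sum.inl.inj (reach_pure.1 hr2).1
        exact ⟨by dsimp only; omega, hst, by simp [botReply, Data.size, B]; omega⟩
      · rw [AIBE.afterMessage] at hr2
        split_ifs at hr2
        · cases (reach_pure.1 hr2).1
        · obtain ⟨r, j', hr3, hr4⟩ := reach_bind.1 hr2
          cases Sum.inl.inj (reach_pure.1 hr4).1
          have := reply_support (hG i) (hZ i) (reach_sample.1 hr3).1
          refine ⟨by dsimp only; omega, hst, ?_⟩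
          simp only [B]
          omega
  · intro i
    have := length_le_size_encTable (σ i).1
    have h1 : (encTable (σ i).1).size + ((σ i).2.1.size + (σ i).2.2.size + 1) + 1 =
      (encState (σ i)).size := rfl
    simp only [M, B]
    refine ⟨?_, ?_, ?_⟩ <;> omega
  · intro J π σ' n _ _ hs
    have h' : HasEnv (fun j => sz (π j)) (fun j => .pair (.num 1) (.pair (P (π j)).env
      (encState (σ' j)))) fun j => P (π j) := H.weaken π hs.fst
    exact h'.runStep A ph hs.snd

end HasEnv

/-! ### The stages of the simulation -/

/-- The data that represent two keys. -/
def encKeys {𝔾 : BilinearGroup} (k : Key 𝔾 × Key 𝔾) : Data := .pair (encKey k.1) (encKey k.2)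

/-- The key for the target identity, from an opening `(t₀, θ)` of `R`: if `t = P.t - t₀` then
`Y * R * h ^ t = X ^ (y + θ)`, the root of which is `g ^ (y + θ)`. -/
def targetKey (P : Instance 𝓕) (θ r t : ZMod P.grp.p) : Key P.grp :=
  ⟨P.mpk.g ^ (P.y + θ).val * P.mpk.X ^ (P.z * r).val, P.mpk.X ^ r.val, t⟩

/-- Two correct answers to different challenges open `R`. -/
theorem keyOf_eq_targetKey (P : Instance 𝓕) {R u : P.grp.G} {c c' s s' s₂ s₂' : ZMod P.grp.p}
    (h₁ : okamotoVerify P.mpk R u c s s') (h₂ : okamotoVerify P.mpk R u c' s₂ s₂') (hc : c ≠ c')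
    (r : ZMod P.grp.p) :
    keyOf P.mpk P.x P.ID R r (P.t - (s - s₂) / (c - c')) =
      targetKey P ((s' - s₂') / (c - c')) r (P.t - (s - s₂) / (c - c')) := by
  obtain ⟨ρ, rfl⟩ := exists_pow_val P.X_ne R
  obtain ⟨υ, rfl⟩ := exists_pow_val P.X_ne u
  have hcc : c - c' ≠ 0 := sub_ne_zero.2 hc
  simp only [okamotoVerify, Instance.mpk, ← pow_val_mul, ← pow_val_add] at h₁ h₂
  have e₁ : P.b * s + s' = υ + ρ * c := (pow_val_bijective P.X_ne).1 h₁
  have e₂ : P.b * s₂ + s₂' = υ + ρ * c' := (pow_val_bijective P.X_ne).1 h₂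
  simp only [targetKey, keyOf, Instance.mpk, Instance.x, inv_inv, ← pow_val_mul, ← pow_val_neg,
    ← pow_val_add, Key.mk.injEq, and_true]
  congr 2
  have e₃ : ρ = P.b * ((s - s₂) / (c - c')) + (s' - s₂') / (c - c') := by
    field_simp
    linear_combination e₂ - e₁
  linear_combination P.a * e₃

namespace HasEnv

variable {I : Type} {sz : I → ℕ} {inp : I → Data} {P : I → Instance 𝓕}

theorem simClosed (H : HasEnv sz inp P) (A : Code) {N : I → ℕ} (hN : ∀ i, N i ≤ sz i)
    {σ : ∀ i, Table (P i).grp × Data × Data} (hσ : Comp sz inp fun i => encState (σ i)) :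
    Eff sz inp (V := fun i => Key (P i).grp × Key (P i).grp) (fun _ => encKeys)
      fun i => AIBE.simClosed A (P i).mpk (P i).x (P i).ID (N i) (σ i) := by
  refine Eff.bind (H.run A .closed hN hσ) H.env fun {J} π τ inp' _ hτ w => ?_
  refine Eff.of_failure (fun j => ∃ k₁ k₂, (τ j).2.2 = .output k₁ k₂) ?_ fun j hj => ?_
  · choose k₁ k₂ hk using fun j : {j // ∃ k₁ k₂, (τ j).2.2 = .output k₁ k₂} => j.2
    have hm := (hτ.snd.snd.reindex fun j : {j // ∃ k₁ k₂, (τ j).2.2 = .output k₁ k₂} =>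
      j.1).congr fun j => congrArg encMessage (hk j)
    refine Eff.congr (Eff.pure (v := fun j : {j // ∃ k₁ k₂, (τ j).2.2 = .output k₁ k₂} =>
      (k₁ j, k₂ j)) hm.snd) fun j => ?_
    simp only [hk j]
  · split
    · next k₁ k₂ hk => exact absurd ⟨k₁, k₂, hk⟩ hj
    · rfl

theorem simExtract (H : HasEnv sz inp P) (A : Code) {N : I → ℕ} (hN : ∀ i, N i ≤ sz i)
    {R u : ∀ i, (P i).grp.G} {c s s' : ∀ i, ZMod (P i).grp.p} {L₀ L₁ : ∀ i, Table (P i).grp}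
    {st₀ st₁ : I → Data}
    (hv : ∀ i, okamotoVerify (P i).mpk (R i) (u i) (c i) (s i) (s' i))
    (hc : Comp sz inp fun i => .num (c i).val) (hs : Comp sz inp fun i => .num (s i).val)
    (hs' : Comp sz inp fun i => .num (s' i).val) (hL₀ : Comp sz inp fun i => encTable (L₀ i))
    (hst₀ : Comp sz inp st₀) (hL₁ : Comp sz inp fun i => encTable (L₁ i))
    (hst₁ : Comp sz inp st₁) :
    Eff sz inp (V := fun i => Key (P i).grp × Key (P i).grp) (fun _ => encKeys)
      fun i => AIBE.simExtract A (P i).mpk (P i).x (P i).ID (N i) (P i).t (R i) (u i) (c i) (s i)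
        (L₀ i) (st₀ i) (L₁ i) (st₁ i) := by
  refine Eff.bind H.uniform H.env fun {J₁} π₁ c' inp₁ _ hc' w₁ => ?_
  have H₁ := H.weaken π₁ (w₁ H.env)
  refine Eff.bind (H₁.run A .waiting (fun j => hN (π₁ j))
    (σ := fun j => (L₀ (π₁ j), st₀ (π₁ j), challengeReply (c' j)))
    ((w₁ hL₀).pair ((w₁ hst₀).pair ((hc'.const (.num 1)).pair hc')))) H₁.env
    fun {J₂} π₂ τ inp₂ _ hτ w₂ => ?_
  have H₂ := H₁.weaken π₂ (w₂ H₁.env)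
  refine Eff.of_failure (fun j => ∃ ID s₂ s₂', (τ j).2.2 = .respond ID s₂ s₂' ∧
    okamotoVerify (P (π₁ (π₂ j))).mpk (R _) (u _) (c' (π₂ j)) s₂ s₂' ∧
    c (π₁ (π₂ j)) ≠ c' (π₂ j)) ?_ fun j hj => ?_
  · choose ID s₂ s₂' hm hv₂ hcc using fun j : {j // ∃ ID s₂ s₂', (τ j).2.2 = .respond ID s₂ s₂' ∧
      okamotoVerify (P (π₁ (π₂ j))).mpk (R _) (u _) (c' (π₂ j)) s₂ s₂' ∧
      c (π₁ (π₂ j)) ≠ c' (π₂ j)} => j.2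
    set J₃ := {j // ∃ ID s₂ s₂', (τ j).2.2 = .respond ID s₂ s₂' ∧
      okamotoVerify (P (π₁ (π₂ j))).mpk (R _) (u _) (c' (π₂ j)) s₂ s₂' ∧
      c (π₁ (π₂ j)) ≠ c' (π₂ j)}
    have H₃ := H₂.reindex fun j : J₃ => j.1
    have hm' := (hτ.snd.snd.reindex fun j : J₃ => j.1).congr fun j => congrArg encMessage (hm j)
    have hs₂ := hm'.snd.snd.fst
    have hs₂' := hm'.snd.snd.snd
    refine Eff.congr (Eff.bind (m₂ := fun (j : J₃) r => AIBE.simClosed A (P (π₁ (π₂ j.1))).mpk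
      (P (π₁ (π₂ j.1))).x (P (π₁ (π₂ j.1))).ID (N (π₁ (π₂ j.1)))
      (L₁ (π₁ (π₂ j.1)), st₁ (π₁ (π₂ j.1)), keyReply (keyOf (P (π₁ (π₂ j.1))).mpk
        (P (π₁ (π₂ j.1))).x (P (π₁ (π₂ j.1))).ID (R (π₁ (π₂ j.1))) r
        ((P (π₁ (π₂ j.1))).t - (s (π₁ (π₂ j.1)) - s₂ j) / (c (π₁ (π₂ j.1)) - c' (π₂ j.1))))))
      H₃.uniform H₃.env fun {J₄} π₄ r inp₄ _ hr w₄ => ?_) fun j => ?_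
    · have H₄ := H₃.weaken π₄ (w₄ H₃.env)
      refine H₄.simClosed A (fun j => hN _) ?_
      have hinv := w₄ (H₃.group.zmodInv (H₃.group.zmodSub ((w₂ (w₁ hc)).reindex fun j : J₃ => j.1)
        ((w₂ hc').reindex fun j : J₃ => j.1)) fun j => sub_ne_zero.2 (hcc j))
      have ht₀ := H₄.group.zmodMul (H₄.group.zmodSub (w₄ ((w₂ (w₁ hs)).reindex fun j : J₃ => j.1))
        (w₄ hs₂)) hinv
      have hθ := H₄.group.zmodMul (H₄.group.zmodSub (w₄ ((w₂ (w₁ hs')).reindex fun j : J₃ => j.1))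
        (w₄ hs₂')) hinv
      have hkey := Comp.encKey (P := fun j => P (π₁ (π₂ (π₄ j).1))) (k := fun j =>
        targetKey (P (π₁ (π₂ (π₄ j).1))) ((s' _ - s₂' (π₄ j)) * (c _ - c' _)⁻¹) (r j)
          ((P (π₁ (π₂ (π₄ j).1))).t - (s _ - s₂ (π₄ j)) * (c _ - c' _)⁻¹))
        (H₄.group.mul (H₄.group.pow H₄.g (H₄.group.zmodAdd H₄.y hθ))
          (H₄.group.pow H₄.X (H₄.group.zmodMul H₄.z hr)))
        (H₄.group.pow H₄.X hr) (H₄.group.zmodSub H₄.t ht₀)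
      refine ((w₄ ((w₂ (w₁ hL₁)).reindex fun j : J₃ => j.1)).pair
        ((w₄ ((w₂ (w₁ hst₁)).reindex fun j : J₃ => j.1)).pair
          ((hkey.const (.num 2)).pair hkey))).congr fun j => ?_
      rw [keyOf_eq_targetKey _ (hv _) (hv₂ (π₄ j)) (hcc (π₄ j)), div_eq_mul_inv, div_eq_mul_inv]
      rfl
    · simp only [hm j]
      rw [if_pos ⟨hv₂ j, hcc j⟩]
  · split
    · next ID s₂ s₂' hm =>
      rw [if_neg fun h => hj ⟨ID, s₂, s₂', hm, h⟩]
    · rfl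

theorem simWaiting (H : HasEnv sz inp P) (A : Code) {N : I → ℕ} (hN : ∀ i, N i ≤ sz i)
    {R u : ∀ i, (P i).grp.G} {c : ∀ i, ZMod (P i).grp.p} {L₀ : ∀ i, Table (P i).grp}
    {st₀ : I → Data}
    (hR : Comp sz inp fun i => (P i).grp.enc (R i)) (hu : Comp sz inp fun i => (P i).grp.enc (u i))
    (hc : Comp sz inp fun i => .num (c i).val) (hL₀ : Comp sz inp fun i => encTable (L₀ i))
    (hst₀ : Comp sz inp st₀) :
    Eff sz inp (V := fun i => Key (P i).grp × Key (P i).grp) (fun _ => encKeys)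
      fun i => AIBE.simWaiting A (P i).mpk (P i).x (P i).ID (N i) (P i).t (R i) (u i)
        (L₀ i) (st₀ i) (c i) := by
  refine Eff.bind (H.run A .waiting hN (σ := fun j => (L₀ j, st₀ j, challengeReply (c j)))
    (hL₀.pair (hst₀.pair ((hc.const (.num 1)).pair hc)))) H.env
    fun {J₁} π₁ τ inp₁ _ hτ w₁ => ?_
  have H₁ := H.weaken π₁ (w₁ H.env)
  have htag := hτ.snd.snd.fst
  refine Eff.cases (P := fun j => ∃ k₁ k₂, (τ j).2.2 = .output k₁ k₂)
    ((Comp.eqP htag (htag.const (.num 2))).congr fun j => ?_) ?_ ?_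
  · cases hm : (τ j).2.2 <;> simp [encHalt, Data.snd, Data.fst, encMessage, hm]
  · choose k₁ k₂ hk using fun j : {j // ∃ k₁ k₂, (τ j).2.2 = .output k₁ k₂} => j.2
    have hm := (hτ.snd.snd.reindex fun j : {j // ∃ k₁ k₂, (τ j).2.2 = .output k₁ k₂} =>
      j.1).congr fun j => congrArg encMessage (hk j)
    refine Eff.congr (Eff.pure (v := fun j : {j // ∃ k₁ k₂, (τ j).2.2 = .output k₁ k₂} =>
      (k₁ j, k₂ j)) hm.snd) fun j => ?_
    simp only [hk j]
  have H₂ := H₁.reindex fun j : {j // ¬ ∃ k₁ k₂, (τ j).2.2 = .output k₁ k₂} => j.1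
  refine Eff.of_failure (fun j => ∃ ID s s', (τ j.1).2.2 = .respond ID s s') ?_ fun j hj => ?_
  · choose ID s s' hm using fun j : {j : {j // ¬ ∃ k₁ k₂, (τ j).2.2 = .output k₁ k₂} //
      ∃ ID s s', (τ j.1).2.2 = .respond ID s s'} => j.2
    set J₃ := {j : {j // ¬ ∃ k₁ k₂, (τ j).2.2 = .output k₁ k₂} //
      ∃ ID s s', (τ j.1).2.2 = .respond ID s s'}
    have H₃ := H₂.reindex fun j : J₃ => j.1
    have hm' := (hτ.snd.snd.reindex fun j : J₃ => j.1.1).congr fun j => congrArg encMessage (hm j)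
    have hs := hm'.snd.snd.fst
    have hs' := hm'.snd.snd.snd
    have hR' := (w₁ hR).reindex fun j : J₃ => j.1.1
    have hu' := (w₁ hu).reindex fun j : J₃ => j.1.1
    have hc' := (w₁ hc).reindex fun j : J₃ => j.1.1
    have hL₁ := hτ.fst.reindex fun j : J₃ => j.1.1
    have hst₁ := hτ.snd.fst.reindex fun j : J₃ => j.1.1
    refine Eff.cases (H₃.verifyP hR' hu' hc' hs hs') ?_ ?_
    · refine Eff.congr ((H₃.reindex _).simExtract A (fun j => hN _) (fun j => j.2)
        (hc'.reindex _) (hs.reindex _) (hs'.reindex _)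
        (((w₁ hL₀).reindex fun j : J₃ => j.1.1).reindex _)
        (((w₁ hst₀).reindex fun j : J₃ => j.1.1).reindex _)
        (L₁ := fun j => (τ j.1.1.1).1) (hL₁.reindex _) (hst₁.reindex _)) fun j => ?_
      simp only [hm j.1]
      rw [if_pos j.2]
      rfl
    · refine Eff.congr ((H₃.reindex _).simClosed A (fun j => hN _)
        (σ := fun j => ((τ j.1.1.1).1, (τ j.1.1.1).2.1, botReply))
        ((hL₁.pair (hst₁.pair (hst₁.const botReply))).reindex _)) fun j => ?_
      simp only [hm j.1]
      rw [if_neg j.2]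
  · split
    · next k₁ k₂ hk => exact absurd ⟨k₁, k₂, hk⟩ j.2
    · next ID s s' hm => exact absurd ⟨ID, s, s', hm⟩ hj
    · rfl

theorem simGame (H : HasEnv sz inp P) (A : Code) {N : I → ℕ} (hN : ∀ i, N i ≤ sz i)
    {st : I → Data} (hst : Comp sz inp st) :
    Eff sz inp (V := fun i => Key (P i).grp × Key (P i).grp) (fun _ => encKeys)
      fun i => AIBE.simGame A (P i).mpk (P i).x (P i).ID (N i) (P i).t (st i) := by
  refine Eff.bind (H.run A .fresh hN (σ := fun j => ([], st j, encPublicKey (P j).mpk))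
    ((hst.const (.num 0)).pair (hst.pair H.pk))) H.env fun {J₁} π₁ τ inp₁ _ hτ w₁ => ?_
  have H₁ := H.weaken π₁ (w₁ H.env)
  have htag := hτ.snd.snd.fst
  refine Eff.cases (P := fun j => ∃ k₁ k₂, (τ j).2.2 = .output k₁ k₂)
    ((Comp.eqP htag (htag.const (.num 2))).congr fun j => ?_) ?_ ?_
  · cases hm : (τ j).2.2 <;> simp [encHalt, Data.snd, Data.fst, encMessage, hm]
  · choose k₁ k₂ hk using fun j : {j // ∃ k₁ k₂, (τ j).2.2 = .output k₁ k₂} => j.2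
    have hm := (hτ.snd.snd.reindex fun j : {j // ∃ k₁ k₂, (τ j).2.2 = .output k₁ k₂} =>
      j.1).congr fun j => congrArg encMessage (hk j)
    refine Eff.congr (Eff.pure (v := fun j : {j // ∃ k₁ k₂, (τ j).2.2 = .output k₁ k₂} =>
      (k₁ j, k₂ j)) hm.snd) fun j => ?_
    simp only [hk j]
  have H₂ := H₁.reindex fun j : {j // ¬ ∃ k₁ k₂, (τ j).2.2 = .output k₁ k₂} => j.1
  refine Eff.of_failure (fun j => ∃ ID R u, (τ j.1).2.2 = .start ID R u) ?_ fun j hj => ?_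
  · choose ID R u hm using fun j : {j : {j // ¬ ∃ k₁ k₂, (τ j).2.2 = .output k₁ k₂} //
      ∃ ID R u, (τ j.1).2.2 = .start ID R u} => j.2
    set J₃ := {j : {j // ¬ ∃ k₁ k₂, (τ j).2.2 = .output k₁ k₂} //
      ∃ ID R u, (τ j.1).2.2 = .start ID R u}
    have H₃ := H₂.reindex fun j : J₃ => j.1
    have hm' := (hτ.snd.snd.reindex fun j : J₃ => j.1.1).congr fun j => congrArg encMessage (hm j)
    have hL₁ := hτ.fst.reindex fun j : J₃ => j.1.1
    have hst₁ := hτ.snd.fst.reindex fun j : J₃ => j.1.1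
    refine Eff.congr (Eff.bind (m₂ := fun (j : J₃) c => AIBE.simWaiting A (P (π₁ j.1.1)).mpk
      (P (π₁ j.1.1)).x (P (π₁ j.1.1)).ID (N (π₁ j.1.1)) (P (π₁ j.1.1)).t (R j) (u j)
      (τ j.1.1).1 (τ j.1.1).2.1 c) H₃.uniform H₃.env fun {J₄} π₄ c inp₄ _ hc w₄ => ?_) fun j => ?_
    · exact (H₃.weaken π₄ (w₄ H₃.env)).simWaiting A (fun j => hN _) (w₄ hm'.snd.snd.fst)
        (w₄ hm'.snd.snd.snd) hc (L₀ := fun j => (τ (π₄ j).1.1).1) (w₄ hL₁) (w₄ hst₁)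
    · simp only [hm j]
  · split
    · next k₁ k₂ hk => exact absurd ⟨k₁, k₂, hk⟩ j.2
    · next ID s s' hm => exact absurd ⟨ID, s, s', hm⟩ hj
    · rfl

end HasEnv

/-! ### The reduction -/

/-- The input of a Diffie-Hellman solver. -/
structure Challenge (𝓕 : BilinearFamily) where
  n : ℕ
  d : Data
  mem : d ∈ (𝓕.gen n).support
  X : (𝓕.grp d).G
  X_ne : X ≠ 1
  a : (ZMod (𝓕.grp d).p)ˣ
  b : (ZMod (𝓕.grp d).p)ˣ

namespace Challenge

/-- The group of a challenge. -/
abbrev grp (C : Challenge 𝓕) : BilinearGroup := 𝓕.grp C.d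

/-- The data that represent a challenge. -/
def input (C : Challenge 𝓕) : Data :=
  .pair (.num C.n) (.pair (𝓕.desc C.d) (.pair (C.grp.enc C.X)
    (.pair (C.grp.enc (C.X ^ C.a.val.val)) (C.grp.enc (C.X ^ C.b.val.val)))))

/-- A challenge together with a target identity and the randomness of the public key. -/
def toInstance (C : Challenge 𝓕) (ID y t z : ZMod C.grp.p) : Instance 𝓕 :=
  ⟨C.n, C.d, C.mem, C.X, C.X_ne, C.a, C.b.val, y, t, z, ID⟩

end Challenge

/-- The root of `h` that two keys for the target identity with distinct family numbers yield. -/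
def solve {𝔾 : BilinearGroup} (z : ZMod 𝔾.p) (k : Key 𝔾 × Key 𝔾) : 𝔾.G :=
  (k.1.d₁ * k.2.d₁⁻¹ * ((k.1.d₂ * k.2.d₂⁻¹) ^ z.val)⁻¹) ^ ((k.1.d₃ - k.2.d₃)⁻¹).val

/-- The answer from the outcome of the game. -/
def solveKeys {𝔾 : BilinearGroup} (z : ZMod 𝔾.p) (k : Key 𝔾 × Key 𝔾) : Timed 𝔾.G :=
  if k.1.d₃ ≠ k.2.d₃ then pure (solve z k) else failure

/-- The reduction, after the adversary has announced the target identity. -/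
def solveFor (A : Code) (N : ℕ) (C : Challenge 𝓕) (st : Data) (ID : ZMod C.grp.p) :
    Timed C.grp.G :=
  sample (PMF.uniformOfFintype (ZMod C.grp.p)) >>= fun y =>
  sample (PMF.uniformOfFintype (ZMod C.grp.p)) >>= fun t =>
  sample (PMF.uniformOfFintype (ZMod C.grp.p)) >>= fun z =>
  simGame A (C.toInstance ID y t z).mpk (C.toInstance ID y t z).x ID N t st >>= solveKeys z

/-- The reduction, after the first activation of the adversary. -/
def solveAfter (A : Code) (N : ℕ) (C : Challenge 𝓕) : Data → Timed C.grp.G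
  | .pair st (.num i) =>
    match decZ C.grp i with
    | some ID => solveFor A N C st ID
    | none => failure
  | _ => failure

/-- The reduction: a solver of the Diffie-Hellman problem, at most `N` activations of the adversary
in each stage. -/
def solver (A : Code) (N : ℕ) (C : Challenge 𝓕) : Timed C.grp.G :=
  A.eval (.pair (.num 0) (.pair (.num C.n) (𝓕.desc C.d))) >>= solveAfter A N C

theorem Comp.toInstance {I : Type} {sz : I → ℕ} {inp : I → Data} {C : I → Challenge 𝓕}
    (hn : ∀ i, (C i).n ≤ sz i) (hC : Comp sz inp fun i => (C i).input)
    {ID y t z : ∀ i, ZMod (C i).grp.p} (hID : Comp sz inp fun i => .num (ID i).val)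
    (hy : Comp sz inp fun i => .num (y i).val) (ht : Comp sz inp fun i => .num (t i).val)
    (hz : Comp sz inp fun i => .num (z i).val) :
    HasEnv sz inp fun i => (C i).toInstance (ID i) (y i) (t i) (z i) := by
  have H : HasGroup 𝓕 sz inp (fun i => (C i).n) fun i => (C i).d :=
    ⟨fun i => (C i).mem, hn, hC.snd.fst⟩
  have hX : Comp sz inp fun i => (C i).grp.enc (C i).X := hC.snd.snd.fst
  have hg : Comp sz inp fun i => (C i).grp.enc ((C i).X ^ (C i).a.val.val) := hC.snd.snd.snd.fst
  have hh : Comp sz inp fun i => (C i).grp.enc ((C i).X ^ (C i).b.val.val) := hC.snd.snd.snd.snd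
  exact ⟨hn, H.desc.pair ((hg.pair (hX.pair ((H.mul (H.pow hX hy) (H.inv (H.pow hh ht))).pair
    ((H.mul (H.inv (H.pow hg hID)) (H.pow hX hz)).pair hh)))).pair
      (hy.pair (ht.pair (hz.pair hID))))⟩

section

variable {I : Type} {sz : I → ℕ} {inp : I → Data} {C : I → Challenge 𝓕}

theorem solveFor_eff (A : Code) {N : I → ℕ} (hN : ∀ i, N i ≤ sz i) (hn : ∀ i, (C i).n ≤ sz i)
    (hC : Comp sz inp fun i => (C i).input) {st : I → Data} (hst : Comp sz inp st)
    {ID : ∀ i, ZMod (C i).grp.p} (hID : Comp sz inp fun i => .num (ID i).val) :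
    Eff sz inp (fun i => (C i).grp.enc) fun i => solveFor A (N i) (C i) (st i) (ID i) := by
  have H : HasGroup 𝓕 sz inp (fun i => (C i).n) fun i => (C i).d :=
    ⟨fun i => (C i).mem, hn, hC.snd.fst⟩
  refine Eff.bind H.uniform hC fun {J₁} π₁ y inp₁ _ hy w₁ => ?_
  have H₁ := H.weaken π₁ (w₁ H.desc)
  refine Eff.bind H₁.uniform hy fun {J₂} π₂ t inp₂ _ ht w₂ => ?_
  have H₂ := H₁.weaken π₂ (w₂ H₁.desc)
  refine Eff.bind H₂.uniform ht fun {J₃} π₃ z inp₃ _ hz w₃ => ?_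
  have E := Comp.toInstance (C := fun j => C (π₁ (π₂ (π₃ j)))) (fun j => hn _)
    (w₃ (w₂ (w₁ hC))) (w₃ (w₂ (w₁ hID))) (w₃ (w₂ hy)) (w₃ ht) hz
  refine Eff.bind (E.simGame A (fun j => hN _) (w₃ (w₂ (w₁ hst)))) hz
    fun {J₄} π₄ k inp₄ _ hk w₄ => ?_
  have E₄ := E.weaken π₄ (w₄ E.env)
  refine Eff.of_failure (fun j => (k j).1.d₃ ≠ (k j).2.d₃) ?_ fun j hj => if_neg hj
  set J₅ := {j // (k j).1.d₃ ≠ (k j).2.d₃}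
  have E₅ := E₄.reindex fun j : J₅ => j.1
  have hk' := hk.reindex fun j : J₅ => j.1
  have h₁ := hk'.fst
  have h₂ := hk'.snd
  refine Eff.congr (Eff.pure (v := fun j : J₅ => solve (z (π₄ j.1)) (k j.1)) ?_) fun j =>
    (if_pos j.2).symm
  exact E₅.group.pow (E₅.group.mul (E₅.group.mul h₁.fst (E₅.group.inv h₂.fst))
    (E₅.group.inv (E₅.group.pow (E₅.group.mul h₁.snd.fst (E₅.group.inv h₂.snd.fst)) E₅.z)))
    (E₅.group.zmodInv (E₅.group.zmodSub h₁.snd.snd h₂.snd.snd) fun j => sub_ne_zero.2 j.2)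

theorem solver_eff (A : Code) {N : I → ℕ} (hN : ∀ i, N i ≤ sz i) (hn : ∀ i, (C i).n ≤ sz i)
    (hC : Comp sz inp fun i => (C i).input) :
    Eff sz inp (fun i => (C i).grp.enc) fun i => solver A (N i) (C i) := by
  refine Eff.bind (Eff.call A ((hC.const (.num 0)).pair (hC.fst.pair hC.snd.fst))) hC
    fun {J₁} π₁ out inp₁ _ hout w₁ => ?_
  refine Eff.of_failure (fun j => ∃ st ID, out j = .pair st (.num (ZMod.val (n := (C (π₁ j)).grp.p)
    ID))) ?_ fun j hj => ?_
  · choose st ID h using fun j : {j // ∃ st ID, out j = .pair st (.num (ZMod.val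
      (n := (C (π₁ j)).grp.p) ID))} => j.2
    set J₂ := {j // ∃ st ID, out j = .pair st (.num (ZMod.val (n := (C (π₁ j)).grp.p) ID))}
    have hout' := (hout.reindex fun j : J₂ => j.1).congr h
    refine Eff.congr (solveFor_eff A (C := fun j : J₂ => C (π₁ j.1)) (fun j => hN (π₁ j.1))
      (fun j => hn _) ((w₁ hC).reindex _) hout'.fst hout'.snd) fun j => ?_
    rw [h j, solveAfter, decZ_eq_some.2 rfl]
    rfl
  · unfold solveAfter
    split
    · next st i hi =>
      split
      · next ID hID => exact absurd ⟨st, ID, by rw [hi, decZ_eq_some.1 hID]⟩ hj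
      · rfl
    · rfl

end

/-- The reduction is carried out by a program that runs under a polynomial clock. The steps of the
adversary in all the runs of the reduction, the rewound one included, are limited by
`2 * q.eval C.n`. -/
theorem exists_code_solver (𝓕 : BilinearFamily) (A : Code) (q : Polynomial ℕ) :
    ∃ (B : Code) (r : Polynomial ℕ), ∀ (C : Challenge 𝓕) (f : Data → ℝ≥0∞),
      ev (solver A (q.eval C.n) C) (fun v _ => f (C.grp.enc v)) (2 * q.eval C.n) ≤
        ev (B.eval C.input) (fun y _ => f y) (r.eval C.n) := by
  let s : Polynomial ℕ := Polynomial.X + Polynomial.C 2 * q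
  have hs : ∀ n, s.eval n = n + 2 * q.eval n := fun n => by simp [s]
  obtain ⟨Q, hQ⟩ := HasGroup.exists_enc_size_le 𝓕
  have hG : Bounded (fun C : Challenge 𝓕 => s.eval C.n) fun C => C.input.size := by
    obtain ⟨c, q', hc⟩ := 𝓕.mul_efficient
    refine ⟨Polynomial.X + q' + Polynomial.C 3 * Q + Polynomial.C 10, fun C => ?_⟩
    have h1 := (hc C.n C.d C.mem 1 1).size_le
    have h2 : (C.grp.enc C.X).size ≤ _ := hQ C.n C.d C.mem C.X
    have h3 : (C.grp.enc (C.X ^ C.a.val.val)).size ≤ _ := hQ C.n C.d C.mem (C.X ^ C.a.val.val)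
    have h4 : (C.grp.enc (C.X ^ C.b.val.val)).size ≤ _ := hQ C.n C.d C.mem (C.X ^ C.b.val.val)
    have h5 : C.n ≤ s.eval C.n := by rw [hs]; omega
    have h6 := polyEval_mono q' h5
    have h7 := polyEval_mono Q h5
    have h8 : Nat.size C.n ≤ C.n := Nat.size_le.2 C.n.lt_two_pow_self
    simp only [Data.size] at h1
    simp only [Challenge.input, BilinearFamily.desc, Data.size, Polynomial.eval_add,
      Polynomial.eval_mul, Polynomial.eval_X, Polynomial.eval_C]
    dsimp only at h6 h7
    omega
  obtain ⟨B, r, hB⟩ := solver_eff (sz := fun C : Challenge 𝓕 => s.eval C.n) A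
    (N := fun C => q.eval C.n) (fun C => by rw [hs]; omega) (fun C => by rw [hs]; omega)
    (Comp.id hG)
  refine ⟨B, Polynomial.C 2 * q + r.comp s, fun C f => ?_⟩
  have := (hB C).ev_le (2 * q.eval C.n) (by dsimp only; rw [hs]; omega) 0 (fun y _ => f y)
    fun y => monotone_const
  simpa [Polynomial.eval_comp] using this

/-! ### Vanishing randomness -/

section Units

variable {p : ℕ} [Fact p.Prime]

theorem sum_units_add (f : ZMod p → ℝ≥0∞) : ∑ e, f e = f 0 + ∑ u : (ZMod p)ˣ, f u := by
  classical
  rw [← Finset.add_sum_erase (Finset.univ : Finset (ZMod p)) f (Finset.mem_univ 0)]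
  congr 1
  symm
  refine Finset.sum_bij' (fun (u : (ZMod p)ˣ) _ => (u : ZMod p))
    (fun e he => Units.mk0 e (Finset.ne_of_mem_erase he)) ?_ ?_ ?_ ?_ ?_
  · exact fun u _ => Finset.mem_erase.2 ⟨u.ne_zero, Finset.mem_univ _⟩
  · exact fun _ _ => Finset.mem_univ _
  · exact fun u _ => Units.ext rfl
  · exact fun e _ => rfl
  · exact fun u _ => rfl

theorem sum_units_le {f : ZMod p → ℝ≥0∞} (hf : ∀ e, f e ≤ 1) :
    ∑ u : (ZMod p)ˣ, f u ≤ ((p - 1 : ℕ) : ℝ≥0∞) := by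
  refine (Finset.sum_le_sum (g := fun _ => (1 : ℝ≥0∞)) fun (u : (ZMod p)ˣ) _ => hf (u : ZMod p)).trans ?_
  simp [ZMod.card_units_eq_totient, Nat.totient_prime (Fact.out : p.Prime)]

theorem card_units_zmod : Fintype.card (ZMod p)ˣ = p - 1 := by
  rw [ZMod.card_units_eq_totient, Nat.totient_prime Fact.out]

theorem ex_units_le {f : ZMod p → ℝ≥0∞} (hf : ∀ e, f e ≤ 1) :
    ex (PMF.uniformOfFintype (ZMod p)ˣ) (fun u => f u) ≤
      ex (PMF.uniformOfFintype (ZMod p)) f + (p : ℝ≥0∞)⁻¹ := by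
  have hs := sum_units_le hf
  obtain ⟨m, hm⟩ : ∃ m, p = m + 2 :=
    ⟨p - 2, by have := (Fact.out : p.Prime).two_le; omega⟩
  rw [ex_uniform, ex_uniform, card_units_zmod, ZMod.card, sum_units_add]
  set s := ∑ u : (ZMod p)ˣ, f u
  have h1 : ((p - 1 : ℕ) : ℝ≥0∞) = m + 1 := by rw [hm]; norm_num
  have h2 : (p : ℝ≥0∞) = m + 1 + 1 := by rw [hm]; push_cast; ring
  rw [h1] at hs ⊢
  rw [h2]
  set M : ℝ≥0∞ := m + 1
  have hM : M ≠ ⊤ := by simp [M]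
  have hM0 : M ≠ 0 := by simp [M]
  calc M⁻¹ * s ≤ (M + 1)⁻¹ * (s + 1) := by
        rw [ENNReal.inv_mul_le_iff hM0 hM, mul_left_comm, ← ENNReal.div_eq_inv_mul,
          ENNReal.le_div_iff_mul_le (Or.inl (by simp)) (Or.inl (by simp [hM])), mul_comm]
        calc (M + 1) * s = M * s + s := by ring
          _ ≤ M * s + M := by gcongr
          _ = M * (s + 1) := by ring
    _ = (M + 1)⁻¹ * s + (M + 1)⁻¹ := by ring
    _ ≤ (M + 1)⁻¹ * (f 0 + s) + (M + 1)⁻¹ := by gcongr; exact le_add_self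

theorem ex_le_units {f : ZMod p → ℝ≥0∞} (hf : ∀ e, f e ≤ 1) :
    ex (PMF.uniformOfFintype (ZMod p)) f ≤
      ex (PMF.uniformOfFintype (ZMod p)ˣ) (fun u => f u) + (p : ℝ≥0∞)⁻¹ := by
  rw [ex_uniform, ex_uniform, card_units_zmod, ZMod.card, sum_units_add, mul_add, add_comm]
  gcongr
  · omega
  · exact mul_le_of_le_one_right' (hf 0)

end Units

variable {𝔾 : BilinearGroup}

theorem ex_blindKey_le (mpk : PublicKey 𝔾) (x : (ZMod 𝔾.p)ˣ) (ID : ZMod 𝔾.p) (R : 𝔾.G)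
    {f : Key 𝔾 → ℝ≥0∞} (hf : ∀ k, f k ≤ 1) :
    ex (blindKey mpk x ID R) f ≤ ex (keyDist mpk x ID R) f + 2 * (𝔾.p : ℝ≥0∞)⁻¹ := by
  have h1 : ex (blindKey mpk x ID R) f = ex (PMF.uniformOfFintype (ZMod 𝔾.p)ˣ) fun r =>
      ex (PMF.uniformOfFintype (ZMod 𝔾.p)ˣ) fun t => f (keyOf mpk x ID R r t) := by
    unfold blindKey
    simp only [ex_bind, ex_pure]
    rfl
  have h2 : ex (keyDist mpk x ID R) f = ex (PMF.uniformOfFintype (ZMod 𝔾.p)) fun r =>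
      ex (PMF.uniformOfFintype (ZMod 𝔾.p)) fun t => f (keyOf mpk x ID R r t) := by
    unfold keyDist
    simp only [ex_bind, ex_pure]
    exact ex_comm _ _ _
  rw [h1, h2, two_mul, ← add_assoc]
  calc _ ≤ ex (PMF.uniformOfFintype (ZMod 𝔾.p)ˣ) fun r =>
        ex (PMF.uniformOfFintype (ZMod 𝔾.p)) (fun t => f (keyOf mpk x ID R r t)) + (𝔾.p : ℝ≥0∞)⁻¹ :=
        ex_mono fun r => ex_units_le fun t => hf _
    _ = ex (PMF.uniformOfFintype (ZMod 𝔾.p)ˣ) (fun r =>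
        ex (PMF.uniformOfFintype (ZMod 𝔾.p)) (fun t => f (keyOf mpk x ID R r t))) +
          (𝔾.p : ℝ≥0∞)⁻¹ := by rw [ex_add, ex_const]
    _ ≤ _ := by
        gcongr
        exact ex_units_le (f := fun r => ex (PMF.uniformOfFintype (ZMod 𝔾.p)) fun t =>
          f (keyOf mpk x ID R r t)) fun r => ex_le_one fun t => hf _

open Classical in
/-- The key authority, except that the randomness of keys is drawn from all of `ZMod p`. This makes
the keys invariant under shifts of the randomness, as the simulation requires. -/
def pkgStep' (mpk : PublicKey 𝔾) (x : (ZMod 𝔾.p)ˣ) (S : ZMod 𝔾.p → Option (Session 𝔾)) :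
    Message 𝔾 → PMF (Data × (ZMod 𝔾.p → Option (Session 𝔾)))
  | .start ID R u =>
    match S ID with
    | none => do
      let c ← PMF.uniformOfFintype (ZMod 𝔾.p)
      pure (challengeReply c, Function.update S ID (some (.waiting R u c)))
    | some _ => pure (botReply, S)
  | .respond ID s s' =>
    match S ID with
    | some (.waiting R u c) =>
      if okamotoVerify mpk R u c s s' then do
        let k ← keyDist mpk x ID R
        pure (keyReply k, Function.update S ID (some .closed))
      else pure (botReply, Function.update S ID (some .closed))
    | _ => pure (botReply, S)
  | .output _ _ => pure (botReply, S)

theorem ex_pkgStep_le (mpk : PublicKey 𝔾) (x : (ZMod 𝔾.p)ˣ) (S : ZMod 𝔾.p → Option (Session 𝔾))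
    (msg : Message 𝔾) {f : Data × (ZMod 𝔾.p → Option (Session 𝔾)) → ℝ≥0∞} (hf : ∀ r, f r ≤ 1) :
    ex (pkgStep mpk x S (some msg)) f ≤ ex (pkgStep' mpk x S msg) f + 2 * (𝔾.p : ℝ≥0∞)⁻¹ := by
  cases msg with
  | start ID R u =>
    exact le_self_add
  | respond ID s s' =>
    rw [pkgStep, pkgStep']
    match S ID with
    | none => exact le_self_add
    | some .closed => exact le_self_add
    | some (.waiting R u c) =>
      dsimp only
      split_ifs
      · rw [ex_bind, ex_bind]
        exact ex_blindKey_le mpk x ID _ fun k => by rw [ex_pure]; exact hf _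
      · exact le_self_add
  | output k₁ k₂ => exact le_self_add

open Classical in
/-- The rest of the game after a message of the adversary, if `F` is the game from her next
activation on. -/
def continueWith (mpk : PublicKey 𝔾) (x : (ZMod 𝔾.p)ˣ) (IDstar : ZMod 𝔾.p)
    (F : (ZMod 𝔾.p → Option (Session 𝔾)) → Data → Data → Timed Bool)
    (S : ZMod 𝔾.p → Option (Session 𝔾)) (st : Data) : Message 𝔾 → Timed Bool
  | .output k₁ k₂ => pure (decide (Wins mpk IDstar k₁ k₂))
  | .start ID R u => sample (pkgStep' mpk x S (.start ID R u)) >>= fun r => F r.2 st r.1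
  | .respond ID s s' => sample (pkgStep' mpk x S (.respond ID s s')) >>= fun r => F r.2 st r.1

/-- The interaction of the adversary with the key authority whose randomness may vanish. -/
def play (A : Code) (mpk : PublicKey 𝔾) (x : (ZMod 𝔾.p)ˣ) (IDstar : ZMod 𝔾.p) :
    ℕ → (ZMod 𝔾.p → Option (Session 𝔾)) → Data → Data → Timed Bool
  | 0, _, _, _ => pure false
  | k + 1, S, st, m => do
    let out ← A.eval (.pair st m)
    match out with
    | .num _ => pure false
    | .pair st' m' =>
      match decMessage 𝔾 m' with
      | none => play A mpk x IDstar k S st' botReply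
      | some msg => continueWith mpk x IDstar (play A mpk x IDstar k) S st' msg

/-- The indicator of success. -/
def isTrue (b : Bool) (_ : ℕ) : ℝ≥0∞ := if b then 1 else 0

theorem isTrue_le_one (b : Bool) (k : ℕ) : isTrue b k ≤ 1 := by
  unfold isTrue
  split_ifs <;> simp

section

variable (A : Code) (mpk : PublicKey 𝔾) (x : (ZMod 𝔾.p)ˣ) (IDstar : ZMod 𝔾.p)

theorem ev_isTrue_le_one (m : Timed Bool) (k : ℕ) : ev m isTrue k ≤ 1 := ev_le_one isTrue_le_one

theorem ev_add_const_le {α : Type} (m : Timed α) (f : α → ℕ → ℝ≥0∞) (c : ℝ≥0∞) (k : ℕ) :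
    ev m (fun a k' => f a k' + c) k ≤ ev m f k + c := by
  rw [ev_add m f (fun _ _ => c)]
  gcongr
  exact ev_const_le m c k

/-- Randomness that may vanish changes each of the keys with probability at most `2 / p`. -/
theorem ev_interact_le (k : ℕ) (S : ZMod 𝔾.p → Option (Session 𝔾)) (st m : Data) (κ : ℕ) :
    ev (interact A mpk x IDstar k S st m) isTrue κ ≤
      ev (play A mpk x IDstar k S st m) isTrue κ + k * (2 * (𝔾.p : ℝ≥0∞)⁻¹) := by
  induction k generalizing S st m κ with
  | zero => simp [interact, play]
  | succ k ih =>
    rw [interact, play, ev_bind, ev_bind]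
    refine (ev_mono fun out κ' => ?_).trans (ev_add_const_le _ _ _ _)
    match out with
    | .num _ => exact le_self_add
    | .pair st' m' =>
      have key : ∀ msg : Message 𝔾,
          (ex (pkgStep mpk x S (some msg)) fun r =>
            ev (interact A mpk x IDstar k r.2 st' r.1) isTrue κ') ≤
          (ex (pkgStep' mpk x S msg) fun r => ev (play A mpk x IDstar k r.2 st' r.1) isTrue κ') +
            (k + 1 : ℕ) * (2 * (𝔾.p : ℝ≥0∞)⁻¹) := by
        intro msg
        refine (ex_pkgStep_le mpk x S msg fun r => ev_isTrue_le_one _ _).trans ?_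
        push_cast
        rw [add_mul, one_mul, ← add_assoc]
        gcongr
        refine (ex_mono fun r : Data × (ZMod 𝔾.p → Option (Session 𝔾)) =>
          ih r.2 st' r.1 κ').trans ?_
        rw [ex_add, ex_const]
      dsimp only
      cases hm : decMessage 𝔾 m' with
      | none =>
        simp only [ev_bind, ev_sample, pkgStep, ex_pure]
        refine (ih S st' botReply κ').trans ?_
        gcongr
        exact Nat.le_succ k
      | some msg =>
        cases msg with
        | output k₁ k₂ => exact le_self_add
        | start ID R u =>
          simp only [ev_bind, ev_sample, continueWith]
          exact key _
        | respond ID s s' =>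
          simp only [ev_bind, ev_sample, continueWith]
          exact key _

theorem ev_play_le_succ (k : ℕ) (S : ZMod 𝔾.p → Option (Session 𝔾)) (st m : Data) (κ : ℕ) :
    ev (play A mpk x IDstar k S st m) isTrue κ ≤
      ev (play A mpk x IDstar (k + 1) S st m) isTrue κ := by
  induction k generalizing S st m κ with
  | zero => simp [play, isTrue]
  | succ k ih =>
    rw [play, play, ev_bind, ev_bind]
    refine ev_mono fun out κ' => ?_
    match out with
    | .num _ => exact le_rfl
    | .pair st' m' =>
      dsimp only
      cases hm : decMessage 𝔾 m' with
      | none => exact ih _ _ _ _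
      | some msg =>
        cases msg with
        | output k₁ k₂ => exact le_rfl
        | start ID R u =>
          simp only [ev_bind, ev_sample, continueWith]
          exact ex_mono fun r => ih _ _ _ _
        | respond ID s s' =>
          simp only [ev_bind, ev_sample, continueWith]
          exact ex_mono fun r => ih _ _ _ _

theorem ev_play_mono (S : ZMod 𝔾.p → Option (Session 𝔾)) (st m : Data) (κ : ℕ) :
    Monotone fun k => ev (play A mpk x IDstar k S st m) isTrue κ :=
  monotone_nat_of_le_succ fun k => ev_play_le_succ A mpk x IDstar k S st m κ

theorem ev_continueWith_mono {F F' : (ZMod 𝔾.p → Option (Session 𝔾)) → Data → Data → Timed Bool}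
    {κ : ℕ} (h : ∀ S st m, ev (F S st m) isTrue κ ≤ ev (F' S st m) isTrue κ)
    (S : ZMod 𝔾.p → Option (Session 𝔾)) (st : Data) (msg : Message 𝔾) :
    ev (continueWith mpk x IDstar F S st msg) isTrue κ ≤
      ev (continueWith mpk x IDstar F' S st msg) isTrue κ := by
  cases msg with
  | output k₁ k₂ => exact le_rfl
  | start ID R u =>
    simp only [continueWith, ev_bind, ev_sample]
    exact ex_mono fun r => h _ _ _
  | respond ID s s' =>
    simp only [continueWith, ev_bind, ev_sample]
    exact ex_mono fun r => h _ _ _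

/-! ### From the game to its interruptions -/

/-- The status of a run as the key authority sees it. -/
def entrySession : Option (𝔾.G × 𝔾.G × ZMod 𝔾.p) → Session 𝔾
  | none => .closed
  | some (R, u, c) => .waiting R u c

/-- The table of all runs: the run for the target identity, and the others. -/
def sessions (IDstar : ZMod 𝔾.p) (L : Table 𝔾) (s : Option (Session 𝔾)) :
    ZMod 𝔾.p → Option (Session 𝔾) :=
  fun ID => if ID = IDstar then s else (L.find ID).map entrySession

/-- The phase of the run for the target identity. -/
def phase : Option (Session 𝔾) → Phase
  | none => .fresh
  | some (.waiting _ _ _) => .waiting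
  | some .closed => .closed

theorem sessions_self (L : Table 𝔾) (s : Option (Session 𝔾)) : sessions IDstar L s IDstar = s :=
  if_pos rfl

theorem update_sessions_self (L : Table 𝔾) (s s' : Option (Session 𝔾)) :
    Function.update (sessions IDstar L s) IDstar s' = sessions IDstar L s' := by
  funext ID
  by_cases h : ID = IDstar
  · subst h
    rw [Function.update_self, sessions_self]
  · rw [Function.update_of_ne h, sessions, sessions, if_neg h, if_neg h]

theorem update_sessions {IDstar ID : ZMod 𝔾.p} (h : ID ≠ IDstar) (L : Table 𝔾)
    (s : Option (Session 𝔾)) (e : Option (𝔾.G × 𝔾.G × ZMod 𝔾.p)) :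
    Function.update (sessions IDstar L s) ID (some (entrySession e)) =
      sessions IDstar ((ID, e) :: L) s := by
  funext ID'
  by_cases h' : ID' = ID
  · subst h'
    rw [Function.update_self, sessions, if_neg h, Table.find, if_pos rfl]
    rfl
  · rw [Function.update_of_ne h', sessions, sessions, Table.find, if_neg (Ne.symm h')]

theorem ex_pkgStep'_eq {L : Table 𝔾} {s : Option (Session 𝔾)} {msg : Message 𝔾}
    (h : ¬ (phase s).Halts IDstar msg) (f : Data × (ZMod 𝔾.p → Option (Session 𝔾)) → ℝ≥0∞) :
    ex (pkgStep' mpk x (sessions IDstar L s) msg) f =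
      ex (reply mpk x IDstar L msg) fun r => f (r.1, sessions IDstar r.2 s) := by
  cases msg with
  | output k₁ k₂ => rw [pkgStep', reply, ex_pure, ex_pure]
  | start ID R u =>
    rw [pkgStep', reply]
    by_cases hID : ID = IDstar
    · subst hID
      rw [if_pos rfl, sessions_self]
      match s, h with
      | none, h => exact absurd rfl h
      | some s, h => simp only [ex_pure]
    · rw [if_neg hID, show sessions IDstar L s ID = (L.find ID).map entrySession from if_neg hID]
      cases hf : L.find ID with
      | none =>
        simp only [Option.map_none, ex_bind, ex_pure, ← update_sessions hID]
        rfl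
      | some e => simp only [Option.map_some, ex_pure]
  | respond ID t t' =>
    rw [pkgStep', reply]
    by_cases hID : ID = IDstar
    · subst hID
      rw [if_pos rfl, sessions_self]
      match s, h with
      | none, h => simp only [ex_pure]
      | some .closed, h => simp only [ex_pure]
      | some (.waiting _ _ _), h => exact absurd rfl h
    · rw [if_neg hID, show sessions IDstar L s ID = (L.find ID).map entrySession from if_neg hID]
      match hf : L.find ID with
      | none => simp only [Option.map_none, ex_pure]
      | some none => simp only [Option.map_some, entrySession, ex_pure]
      | some (some (R, u, c)) =>
        simp only [Option.map_some, entrySession]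
        split_ifs
        · simp only [ex_bind, ex_pure, ← update_sessions hID]
          rfl
        · simp only [ex_pure, ← update_sessions hID]
          rfl

open Classical in
/-- The game is the simulated run up to an interruption, followed by the rest of the game. Up to the
interruption the replies of the key authority do not depend on the run for the target identity. -/
theorem ev_play_le_run (N k l : ℕ) (hk : k ≤ N) (hl : k ≤ l) (L : Table 𝔾)
    (s : Option (Session 𝔾)) (st m : Data) (κ : ℕ) :
    ev (play A mpk x IDstar k (sessions IDstar L s) st m) isTrue κ ≤
      ev (run A mpk x IDstar l (phase s) (L, st, m)) (fun τ κ' =>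
        if (phase s).Halts IDstar τ.2.2 then
          ev (continueWith mpk x IDstar (play A mpk x IDstar N) (sessions IDstar τ.1 s) τ.2.1
            τ.2.2) isTrue κ'
        else 0) κ := by
  induction k generalizing l L st m κ with
  | zero => simp [play, isTrue]
  | succ k ih =>
    obtain ⟨l, rfl⟩ : ∃ l', l = l' + 1 := ⟨l - 1, by omega⟩
    rw [play, run, iter, runStep_eq, ev_bind, ev_bind, ev_bind]
    refine ev_mono fun out κ' => ?_
    match out with
    | .num _ => simp [isTrue]
    | .pair st' m' =>
      dsimp only [afterOutput]
      rw [afterData]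
      cases hm : decMessage 𝔾 m' with
      | none =>
        rw [ev_pure]
        exact ih l (by omega) (by omega) L st' botReply κ'
      | some msg =>
        dsimp only
        rw [afterMessage]
        split_ifs with hh
        · rw [ev_pure, ev_pure, if_pos hh]
          exact ev_continueWith_mono mpk x IDstar (fun S st m =>
            ev_play_mono A mpk x IDstar S st m κ' (by omega : k ≤ N)) _ _ _
        · have key : (ex (pkgStep' mpk x (sessions IDstar L s) msg) fun r =>
              ev (play A mpk x IDstar k r.2 st' r.1) isTrue κ') ≤
              ex (reply mpk x IDstar L msg) fun r => ev (run A mpk x IDstar l (phase s)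
                (r.2, st', r.1)) (fun τ κ' => if (phase s).Halts IDstar τ.2.2 then
                  ev (continueWith mpk x IDstar (play A mpk x IDstar N) (sessions IDstar τ.1 s)
                    τ.2.1 τ.2.2) isTrue κ' else 0) κ' := by
            rw [ex_pkgStep'_eq mpk x IDstar hh]
            exact ex_mono fun r => ih l (by omega) (by omega) r.2 st' r.1 κ'
          simp only [ev_bind, ev_sample, ev_pure]
          cases msg with
          | output k₁ k₂ => exact absurd (by cases phase s <;> trivial) hh
          | start ID R u =>
            simp only [continueWith, ev_bind, ev_sample]
            exact key
          | respond ID t t' =>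
            simp only [continueWith, ev_bind, ev_sample]
            exact key

end

/-! ### Rewinding -/

theorem iter_clocked {S R : Type} {step : S → Timed (S ⊕ R)} (h : ∀ s, Clocked (step s)) (k : ℕ)
    (s : S) : Clocked (iter step k s) := by
  induction k generalizing s with
  | zero => exact Clocked.failure
  | succ k ih =>
    refine (h s).bind fun r => ?_
    match r with
    | .inl s' => exact ih s'
    | .inr r => exact Clocked.pure r

section

variable {𝔾 : BilinearGroup} (A : Code) (mpk : PublicKey 𝔾) (x : (ZMod 𝔾.p)ˣ) (IDstar : ZMod 𝔾.p)
  (N : ℕ)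

theorem runStep_clocked (ph : Phase) (σ : Table 𝔾 × Data × Data) :
    Clocked (runStep A mpk x IDstar ph σ) := by
  unfold runStep
  refine (A.eval_clocked _).bind fun out => ?_
  match out with
  | .num _ => exact Clocked.failure
  | .pair st m =>
    dsimp only
    cases decMessage 𝔾 m with
    | none => exact Clocked.pure _
    | some msg =>
      dsimp only
      split_ifs
      · exact Clocked.pure _
      · exact (Clocked.sample _).bind fun _ => Clocked.pure _

theorem run_clocked (ph : Phase) (σ : Table 𝔾 × Data × Data) :
    Clocked (run A mpk x IDstar N ph σ) :=
  iter_clocked (runStep_clocked A mpk x IDstar ph) N σ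

theorem simClosed_clocked (σ : Table 𝔾 × Data × Data) :
    Clocked (simClosed A mpk x IDstar N σ) := by
  refine (run_clocked A mpk x IDstar N _ σ).bind fun τ => ?_
  match τ with
  | (_, _, .output _ _) => exact Clocked.pure _
  | (_, _, .start _ _ _) => exact Clocked.failure
  | (_, _, .respond _ _ _) => exact Clocked.failure

theorem simExtract_clocked (tstar : ZMod 𝔾.p) (R u : 𝔾.G) (c s : ZMod 𝔾.p) (L₀ : Table 𝔾) (st₀ : Data)
    (L₁ : Table 𝔾) (st₁ : Data) :
    Clocked (simExtract A mpk x IDstar N tstar R u c s L₀ st₀ L₁ st₁) := by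
  refine (Clocked.sample _).bind fun c' => (run_clocked A mpk x IDstar N _ _).bind fun τ => ?_
  match τ with
  | (_, _, .output _ _) => exact Clocked.failure
  | (_, _, .start _ _ _) => exact Clocked.failure
  | (_, _, .respond _ _ _) =>
    dsimp only
    split_ifs
    · exact (Clocked.sample _).bind fun _ => simClosed_clocked A mpk x IDstar N _
    · exact Clocked.failure

theorem simWaiting_clocked (tstar : ZMod 𝔾.p) (R u : 𝔾.G) (L₀ : Table 𝔾) (st₀ : Data)
    (c : ZMod 𝔾.p) : Clocked (simWaiting A mpk x IDstar N tstar R u L₀ st₀ c) := by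
  refine (run_clocked A mpk x IDstar N _ _).bind fun τ => ?_
  match τ with
  | (_, _, .output _ _) => exact Clocked.pure _
  | (_, _, .start _ _ _) => exact Clocked.failure
  | (_, _, .respond _ _ _) =>
    dsimp only
    split_ifs
    · exact simExtract_clocked A mpk x IDstar N _ _ _ _ _ _ _ _ _
    · exact simClosed_clocked A mpk x IDstar N _

open Classical in
/-- The indicator of success of the two keys, which does not depend on the clock. -/
def winning (k : Key 𝔾 × Key 𝔾) (_ : ℕ) : ℝ≥0∞ := if Wins mpk IDstar k.1 k.2 then 1 else 0

theorem winning_le_one (k : Key 𝔾 × Key 𝔾) (κ : ℕ) : winning mpk IDstar k κ ≤ 1 := by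
  unfold winning
  split_ifs <;> simp

theorem winning_mono {m : Timed (Key 𝔾 × Key 𝔾)} (hm : Clocked m) :
    Monotone (ev m (winning mpk IDstar)) :=
  hm.mono fun _ _ _ _ => le_rfl

/-- The probability that the adversary wins the game from the given state of the runs and the
given message to her on. -/
def value (L : Table 𝔾) (s : Option (Session 𝔾)) (st m : Data) (κ : ℕ) : ℝ≥0∞ :=
  ev (play A mpk x IDstar N (sessions IDstar L s) st m) isTrue κ

theorem value_le_one (L : Table 𝔾) (s : Option (Session 𝔾)) (st m : Data) (κ : ℕ) :
    value A mpk x IDstar N L s st m κ ≤ 1 := ev_isTrue_le_one _ _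

/-- The probability that the adversary wins after the message at which the simulation is
interrupted. -/
def haltValue (s : Option (Session 𝔾)) (τ : Table 𝔾 × Data × Message 𝔾) (κ : ℕ) : ℝ≥0∞ :=
  ev (continueWith mpk x IDstar (play A mpk x IDstar N) (sessions IDstar τ.1 s) τ.2.1 τ.2.2)
    isTrue κ

theorem mul_value_le_run {s : Option (Session 𝔾)} {f : Table 𝔾 × Data × Message 𝔾 → ℕ → ℝ≥0∞}
    {κ : ℕ} {ρ : ℝ≥0∞} (L : Table 𝔾) (st m : Data) (h : ∀ τ κ', κ' ≤ κ →
      (phase s).Halts IDstar τ.2.2 → ρ * haltValue A mpk x IDstar N s τ κ' ≤ f τ κ') :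
    ρ * value A mpk x IDstar N L s st m κ ≤
      ev (run A mpk x IDstar N (phase s) (L, st, m)) f κ := by
  refine (mul_le_mul_right (ev_play_le_run A mpk x IDstar N N N le_rfl le_rfl L s st m κ) ρ).trans ?_
  rw [← ev_const_mul]
  refine ev_mono_reach fun τ κ' hr => ?_
  split_ifs with hh
  · exact h τ κ' ((run_clocked A mpk x IDstar N _ _).le hr) hh
  · simp

theorem value_le_run {s : Option (Session 𝔾)} {f : Table 𝔾 × Data × Message 𝔾 → ℕ → ℝ≥0∞} {κ : ℕ}
    (L : Table 𝔾) (st m : Data) (h : ∀ τ κ', (phase s).Halts IDstar τ.2.2 →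
      haltValue A mpk x IDstar N s τ κ' ≤ f τ κ') :
    value A mpk x IDstar N L s st m κ ≤
      ev (run A mpk x IDstar N (phase s) (L, st, m)) f κ := by
  rw [← one_mul (value A mpk x IDstar N L s st m κ)]
  refine mul_value_le_run A mpk x IDstar N L st m fun τ κ' _ hh => ?_
  rw [one_mul]
  exact h τ κ' hh

theorem haltValue_output (s : Option (Session 𝔾)) (L : Table 𝔾) (st : Data) (k₁ k₂ : Key 𝔾)
    (κ : ℕ) :
    haltValue A mpk x IDstar N s (L, st, .output k₁ k₂) κ = winning mpk IDstar (k₁, k₂) κ := by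
  by_cases h : Wins mpk IDstar k₁ k₂ <;> simp [haltValue, continueWith, isTrue, winning, h]

theorem haltValue_start (L : Table 𝔾) (st : Data) (R u : 𝔾.G) (κ : ℕ) :
    haltValue A mpk x IDstar N none (L, st, .start IDstar R u) κ =
      ex (PMF.uniformOfFintype (ZMod 𝔾.p)) fun c =>
        value A mpk x IDstar N L (some (.waiting R u c)) st (challengeReply c) κ := by
  simp only [haltValue, continueWith, ev_bind, ev_sample, pkgStep', sessions_self, ex_bind, ex_pure,
    update_sessions_self, value]

open Classical in
theorem haltValue_respond (L : Table 𝔾) (st : Data) (R u : 𝔾.G) (c s s' : ZMod 𝔾.p) (κ : ℕ) :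
    haltValue A mpk x IDstar N (some (.waiting R u c)) (L, st, .respond IDstar s s') κ =
      if okamotoVerify mpk R u c s s' then
        ex (keyDist mpk x IDstar R) fun k =>
          value A mpk x IDstar N L (some .closed) st (keyReply k) κ
      else value A mpk x IDstar N L (some .closed) st botReply κ := by
  simp only [haltValue, continueWith, ev_bind, ev_sample, pkgStep', sessions_self]
  split_ifs
  · simp only [ex_bind, ex_pure, update_sessions_self, value]
  · simp only [ex_pure, update_sessions_self, value]

theorem value_closed_le (L : Table 𝔾) (st m : Data) (κ : ℕ) :
    value A mpk x IDstar N L (some .closed) st m κ ≤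
      ev (simClosed A mpk x IDstar N (L, st, m)) (winning mpk IDstar) κ := by
  rw [simClosed, ev_bind]
  refine value_le_run A mpk x IDstar N L st m fun τ κ' hh => ?_
  match τ, hh with
  | (L', st', .output k₁ k₂), _ => rw [haltValue_output, ev_pure]

open Classical in
/-- The indicator of a correct answer to the challenge `c`. -/
def answers (R u : 𝔾.G) (c : ZMod 𝔾.p) : Message 𝔾 → ℝ≥0∞
  | .respond _ s s' => if okamotoVerify mpk R u c s s' then 1 else 0
  | _ => 0

theorem answers_le_one (R u : 𝔾.G) (c : ZMod 𝔾.p) (msg : Message 𝔾) :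
    answers mpk R u c msg ≤ 1 := by
  unfold answers
  split
  · split_ifs <;> simp
  · simp

/-- The probability that the adversary answers the challenge `c` correctly. -/
def answerProb (R u : 𝔾.G) (L₀ : Table 𝔾) (st₀ : Data) (κ : ℕ) (c : ZMod 𝔾.p) : ℝ≥0∞ :=
  ev (run A mpk x IDstar N .waiting (L₀, st₀, challengeReply c))
    (fun τ _ => answers mpk R u c τ.2.2) κ

theorem answerProb_le_one (R u : 𝔾.G) (L₀ : Table 𝔾) (st₀ : Data) (κ : ℕ) (c : ZMod 𝔾.p) :
    answerProb A mpk x IDstar N R u L₀ st₀ κ c ≤ 1 :=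
  ev_le_one fun _ _ => answers_le_one mpk _ _ _ _

/-- Without a correct answer, the simulation of the run for the target identity is perfect. -/
theorem value_waiting_le_add (tstar : ZMod 𝔾.p) (R u : 𝔾.G) (L₀ : Table 𝔾) (st₀ : Data)
    (c : ZMod 𝔾.p) (κ : ℕ) :
    value A mpk x IDstar N L₀ (some (.waiting R u c)) st₀ (challengeReply c) κ ≤
      ev (simWaiting A mpk x IDstar N tstar R u L₀ st₀ c) (winning mpk IDstar) κ +
        answerProb A mpk x IDstar N R u L₀ st₀ κ c := by
  rw [simWaiting, ev_bind, answerProb, ← ev_add]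
  refine value_le_run A mpk x IDstar N L₀ st₀ _ fun τ κ' hh => ?_
  match τ, hh with
  | (L', st', .output k₁ k₂), _ =>
    rw [haltValue_output, ev_pure]
    exact le_self_add
  | (L', st', .respond ID s s'), hh =>
    obtain rfl : ID = IDstar := hh
    rw [haltValue_respond]
    dsimp only [answers]
    split_ifs with hv
    · exact (ex_le_one fun k => value_le_one A mpk x ID N _ _ _ _ _).trans le_add_self
    · exact (value_closed_le A mpk x ID N _ _ _ _).trans le_self_add

open Classical in
/-- The probability that the adversary, after a rewinding, answers a challenge other than `c`
correctly. -/
def reanswerProb (R u : 𝔾.G) (L₀ : Table 𝔾) (st₀ : Data) (κ : ℕ) (c : ZMod 𝔾.p) : ℝ≥0∞ :=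
  ex (PMF.uniformOfFintype (ZMod 𝔾.p)) fun c' =>
    if c = c' then 0 else answerProb A mpk x IDstar N R u L₀ st₀ κ c'

theorem reanswerProb_le_one (R u : 𝔾.G) (L₀ : Table 𝔾) (st₀ : Data) (κ : ℕ) (c : ZMod 𝔾.p) :
    reanswerProb A mpk x IDstar N R u L₀ st₀ κ c ≤ 1 :=
  ex_le_one fun c' => by
    split_ifs
    · exact zero_le
    · exact answerProb_le_one A mpk x IDstar N _ _ _ _ _ _

theorem ex_uniform_eq {α : Type} [Fintype α] [Nonempty α] [DecidableEq α] (a : α) :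
    ex (PMF.uniformOfFintype α) (fun b => if a = b then 1 else 0) = (Fintype.card α : ℝ≥0∞)⁻¹ := by
  rw [ex_uniform]
  simp

theorem ex_answerProb_le (R u : 𝔾.G) (L₀ : Table 𝔾) (st₀ : Data) (κ : ℕ) (c : ZMod 𝔾.p) :
    ex (PMF.uniformOfFintype (ZMod 𝔾.p)) (answerProb A mpk x IDstar N R u L₀ st₀ κ) ≤
      reanswerProb A mpk x IDstar N R u L₀ st₀ κ c + (𝔾.p : ℝ≥0∞)⁻¹ := by
  classical
  have h := ex_uniform_eq c
  rw [ZMod.card] at h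
  rw [← h, reanswerProb, ← ex_add]
  refine ex_mono fun c' => ?_
  split_ifs
  · rw [zero_add]
    exact answerProb_le_one A mpk x IDstar N _ _ _ _ _ _
  · exact le_self_add

/-- A second correct answer opens the commitment. The key that is then computed has the
distribution of the key authority's, because the family number `tstar` is uniform. -/
theorem reanswerProb_mul_le (R u : 𝔾.G) (c s : ZMod 𝔾.p) (L₀ : Table 𝔾) (st₀ : Data)
    (L₁ : Table 𝔾) (st₁ : Data) {κ κ₁ : ℕ} (hκ : κ ≤ N) :
    reanswerProb A mpk x IDstar N R u L₀ st₀ κ c *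
      (ex (keyDist mpk x IDstar R) fun k =>
        value A mpk x IDstar N L₁ (some .closed) st₁ (keyReply k) κ₁) ≤
      ex (PMF.uniformOfFintype (ZMod 𝔾.p)) fun tstar =>
        ev (simExtract A mpk x IDstar N tstar R u c s L₀ st₀ L₁ st₁) (winning mpk IDstar)
          (κ₁ + N) := by
  classical
  set W := ex (keyDist mpk x IDstar R) fun k =>
        value A mpk x IDstar N L₁ (some .closed) st₁ (keyReply k) κ₁ with hW
  have hW' : ∀ κ', κ₁ ≤ κ' → ∀ t₀ : ZMod 𝔾.p, W ≤
      ex (PMF.uniformOfFintype (ZMod 𝔾.p)) fun tstar =>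
        ex (PMF.uniformOfFintype (ZMod 𝔾.p)) fun r =>
          ev (simClosed A mpk x IDstar N (L₁, st₁, keyReply (keyOf mpk x IDstar R r (tstar - t₀))))
            (winning mpk IDstar) κ' := by
    intro κ' hκ' t₀
    refine le_trans ?_ (ex_uniform_equiv (Equiv.subRight t₀) fun t =>
        ex (PMF.uniformOfFintype (ZMod 𝔾.p)) fun r =>
          ev (simClosed A mpk x IDstar N (L₁, st₁, keyReply (keyOf mpk x IDstar R r t)))
            (winning mpk IDstar) κ').ge
    rw [hW, keyDist]
    simp only [ex_bind, ex_pure]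
    exact ex_mono fun t => ex_mono fun r => (value_closed_le A mpk x IDstar N _ _ _ _).trans
      (winning_mono mpk IDstar (simClosed_clocked A mpk x IDstar N _) hκ')
  rw [mul_comm, reanswerProb, ← ex_const_mul]
  simp only [simExtract, ev_bind, ev_sample]
  rw [ex_comm]
  refine ex_mono fun c' => ?_
  rw [← ev_ex]
  -- The steps that are left when the clock of the rewound run is set to `κ`.
  have he : κ₁ + N = κ + (κ₁ + N - κ) := by omega
  rw [he]
  refine le_trans ?_ ((run_clocked A mpk x IDstar N _ _).shift _ κ _)
  by_cases hc : c = c'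
  · simp [hc]
  rw [if_neg hc, answerProb, ← ev_const_mul]
  refine ev_mono fun τ κ' => ?_
  match τ with
  | (_, _, .output _ _) => simp [answers]
  | (_, _, .start _ _ _) => simp [answers]
  | (_, _, .respond _ s₂ s₂') =>
    dsimp only [answers]
    by_cases hv : okamotoVerify mpk R u c' s₂ s₂'
    · simp only [if_pos hv, mul_one, if_pos (And.intro hv hc), ev_bind, ev_sample]
      exact hW' _ (by omega) _
    · simp [hv]

theorem reanswerProb_mul_value_le (R u : 𝔾.G) (L₀ : Table 𝔾) (st₀ : Data) (c : ZMod 𝔾.p)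
    {κ : ℕ} (hκ : κ ≤ N) :
    reanswerProb A mpk x IDstar N R u L₀ st₀ κ c *
      value A mpk x IDstar N L₀ (some (.waiting R u c)) st₀ (challengeReply c) κ ≤
      ex (PMF.uniformOfFintype (ZMod 𝔾.p)) fun tstar =>
        ev (simWaiting A mpk x IDstar N tstar R u L₀ st₀ c) (winning mpk IDstar) (κ + N) := by
  have hρ := reanswerProb_le_one A mpk x IDstar N R u L₀ st₀ κ c
  simp only [simWaiting, ev_bind]
  rw [← ev_ex]
  refine le_trans ?_ ((run_clocked A mpk x IDstar N _ _).shift _ κ N)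
  refine mul_value_le_run A mpk x IDstar N L₀ st₀ _ fun τ κ' _ hh => ?_
  match τ, hh with
  | (L', st', .output k₁ k₂), _ =>
    simp only [haltValue_output, ev_pure, ex_const]
    exact mul_le_of_le_one_left' hρ
  | (L', st', .respond ID s s'), hh =>
    obtain rfl : ID = IDstar := hh
    rw [haltValue_respond]
    dsimp only
    split_ifs with hv
    · exact reanswerProb_mul_le A mpk x ID N R u c s L₀ st₀ L' st' hκ
    · rw [ex_const]
      exact (mul_le_of_le_one_left' hρ).trans ((value_closed_le A mpk x ID N _ _ _ _).trans
        (winning_mono mpk ID (simClosed_clocked A mpk x ID N _) (Nat.le_add_right _ _)))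

/-- The rewinding succeeds if a correct answer is likely; if it is unlikely, no rewinding is
needed. -/
theorem mul_ex_value_waiting_le {ε : ℝ≥0∞} (hε : ε ≤ 1) (R u : 𝔾.G) (L₀ : Table 𝔾) (st₀ : Data)
    {κ : ℕ} (hκ : κ ≤ N) :
    ε * (ex (PMF.uniformOfFintype (ZMod 𝔾.p)) fun c =>
      value A mpk x IDstar N L₀ (some (.waiting R u c)) st₀ (challengeReply c) κ) ≤
      (ex (PMF.uniformOfFintype (ZMod 𝔾.p)) fun tstar =>
        ex (PMF.uniformOfFintype (ZMod 𝔾.p)) fun c =>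
          ev (simWaiting A mpk x IDstar N tstar R u L₀ st₀ c) (winning mpk IDstar) (κ + N)) +
        (ε ^ 2 + (𝔾.p : ℝ≥0∞)⁻¹) := by
  rw [ex_comm]
  set ρ := ex (PMF.uniformOfFintype (ZMod 𝔾.p)) (answerProb A mpk x IDstar N R u L₀ st₀ κ) with hρ
  rcases le_total ε ρ with h | h
  · rw [← ex_const_mul]
    calc _ ≤ ex (PMF.uniformOfFintype (ZMod 𝔾.p)) (fun c =>
          (ex (PMF.uniformOfFintype (ZMod 𝔾.p)) fun tstar =>
            ev (simWaiting A mpk x IDstar N tstar R u L₀ st₀ c) (winning mpk IDstar) (κ + N)) +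
              (𝔾.p : ℝ≥0∞)⁻¹) := by
          refine ex_mono fun c => ?_
          refine (mul_le_mul_left (h.trans (ex_answerProb_le A mpk x IDstar N R u L₀ st₀ κ c))
            _).trans ?_
          rw [add_mul]
          exact add_le_add (reanswerProb_mul_value_le A mpk x IDstar N R u L₀ st₀ c hκ)
            (mul_le_of_le_one_right' (value_le_one A mpk x IDstar N _ _ _ _ _))
      _ ≤ _ := by
          rw [ex_add, ex_const]
          gcongr
          exact le_add_self
  · calc _ ≤ ε * ex (PMF.uniformOfFintype (ZMod 𝔾.p)) (fun c =>
          (ex (PMF.uniformOfFintype (ZMod 𝔾.p)) fun tstar =>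
            ev (simWaiting A mpk x IDstar N tstar R u L₀ st₀ c) (winning mpk IDstar) (κ + N)) +
              answerProb A mpk x IDstar N R u L₀ st₀ κ c) := by
          gcongr
          refine ex_mono fun c => ?_
          conv_rhs => rw [← ex_const (PMF.uniformOfFintype (ZMod 𝔾.p))
            (answerProb A mpk x IDstar N R u L₀ st₀ κ c), ← ex_add]
          refine (ex_const (PMF.uniformOfFintype (ZMod 𝔾.p)) _).ge.trans (ex_mono fun tstar => ?_)
          refine (value_waiting_le_add A mpk x IDstar N tstar R u L₀ st₀ c κ).trans ?_
          gcongr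
          exact winning_mono mpk IDstar (simWaiting_clocked A mpk x IDstar N _ _ _ _ _ _)
            (Nat.le_add_right _ _)
      _ ≤ _ := by
          rw [ex_add, mul_add, ← add_assoc]
          refine le_trans (add_le_add (mul_le_of_le_one_left' hε) ?_) le_self_add
          rw [sq]
          exact mul_le_mul_right h ε

/-- The simulated game against the game. The `N` further steps of the simulation pay for the run of
the adversary that is abandoned after it has opened the commitment. -/
theorem mul_value_fresh_le {ε : ℝ≥0∞} (hε : ε ≤ 1) (st : Data) {κ : ℕ} (hκ : κ ≤ N) :
    ε * value A mpk x IDstar N [] none st (encPublicKey mpk) κ ≤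
      (ex (PMF.uniformOfFintype (ZMod 𝔾.p)) fun tstar =>
        ev (simGame A mpk x IDstar N tstar st) (winning mpk IDstar) (κ + N)) +
        (ε ^ 2 + (𝔾.p : ℝ≥0∞)⁻¹) := by
  simp only [simGame, ev_bind]
  rw [← ev_ex]
  refine le_trans ?_ (add_le_add_left ((run_clocked A mpk x IDstar N _ _).shift _ κ N) _)
  refine le_trans ?_ (ev_add_const_le _ _ _ _)
  refine mul_value_le_run A mpk x IDstar N [] st _ fun τ κ' hκ' hh => ?_
  match τ, hh with
  | (L', st', .output k₁ k₂), _ =>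
    simp only [haltValue_output, ev_pure, ex_const]
    exact (mul_le_of_le_one_left' hε).trans le_self_add
  | (L', st', .start ID R u), hh =>
    obtain rfl : ID = IDstar := hh
    rw [haltValue_start]
    simp only [ev_bind, ev_sample]
    exact mul_ex_value_waiting_le A mpk x ID N hε R u L' st' (hκ'.trans hκ)

end

/-! ### The keys of the adversary solve the challenge -/

section

variable {𝔾 : BilinearGroup}

theorem e_pow (X : 𝔾.G) (i j : ℕ) : 𝔾.e (X ^ i) (X ^ j) = 𝔾.e X X ^ (i * j) := by
  have := 𝔾.bilinear X X i j
  rwa [zpow_natCast, zpow_natCast, ← Nat.cast_mul, zpow_natCast] at this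

theorem pow_pairing_inj {X : 𝔾.G} (hX : X ≠ 1) {i j : ℕ} :
    𝔾.e X X ^ i = 𝔾.e X X ^ j ↔ (i : ZMod 𝔾.p) = j := by
  have ho : orderOf (𝔾.e X X) = 𝔾.p := orderOf_eq_prime
    (by rw [← 𝔾.card_GT]; exact pow_card_eq_one) (𝔾.nondegenerate X X hX hX)
  rw [pow_eq_pow_iff_modEq, ho, ZMod.natCast_eq_natCast_iff]

/-- The validity of a key in terms of the exponents of all the elements. -/
theorem Key.valid_iff {X : 𝔾.G} (hX : X ≠ 1) (a b y z d₁ d₂ d₃ ID : ZMod 𝔾.p) {Z : 𝔾.G}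
    (hZ : (X ^ a.val) ^ ID.val * Z = X ^ z.val) :
    Key.Valid ⟨X ^ a.val, X, X ^ y.val, Z, X ^ b.val⟩ ID ⟨X ^ d₁.val, X ^ d₂.val, d₃⟩ ↔
      d₁ = y * a + b * a * d₃ + z * d₂ := by
  have h1 : 𝔾.e (X ^ d₁.val) X = 𝔾.e X X ^ d₁.val := by
    have := e_pow X d₁.val 1
    rwa [pow_one, mul_one] at this
  rw [Key.Valid, hZ, h1, e_pow, e_pow, e_pow, ← pow_mul, ← pow_add, ← pow_add, pow_pairing_inj hX]
  simp only [Nat.cast_add, Nat.cast_mul, ZMod.natCast_zmod_val]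

/-- The public key with the given exponents. -/
def publicKeyOf (X : 𝔾.G) (ID a b y t z : ZMod 𝔾.p) : PublicKey 𝔾 :=
  ⟨X ^ a.val, X, X ^ y.val * ((X ^ b.val) ^ t.val)⁻¹, ((X ^ a.val) ^ ID.val)⁻¹ * X ^ z.val,
    X ^ b.val⟩

theorem Wins.solve_eq {X : 𝔾.G} (hX : X ≠ 1) {ID a b y t z : ZMod 𝔾.p} {k : Key 𝔾 × Key 𝔾}
    (h : Wins (publicKeyOf X ID a b y t z) ID k.1 k.2) :
    k.1.d₃ ≠ k.2.d₃ ∧ solve z k = X ^ (a * b).val := by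
  obtain ⟨⟨d₁, d₂, d₃⟩, ⟨d₁', d₂', d₃'⟩⟩ := k
  obtain ⟨h1, h2, h3⟩ := h
  have hv : ∀ k : Key 𝔾, trace (publicKeyOf X ID a b y t z) ID k ≠ none →
      k.Valid (publicKeyOf X ID a b y t z) ID := fun k hk => by
    by_contra hn
    exact hk (if_neg hn)
  have h1 := hv _ h1
  have h2 := hv _ h2
  rw [trace, trace, if_pos h1, if_pos h2] at h3
  have hd : d₃ ≠ d₃' := fun h => h3 (by rw [h])
  refine ⟨hd, ?_⟩
  obtain ⟨e₁, rfl⟩ := exists_pow_val hX d₁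
  obtain ⟨e₂, rfl⟩ := exists_pow_val hX d₂
  obtain ⟨e₁', rfl⟩ := exists_pow_val hX d₁'
  obtain ⟨e₂', rfl⟩ := exists_pow_val hX d₂'
  have hY : X ^ y.val * ((X ^ b.val) ^ t.val)⁻¹ = X ^ (y - b * t).val := by
    rw [sub_eq_add_neg, pow_val_add, pow_val_neg, pow_val_mul]
  have hZ : (X ^ a.val) ^ ID.val * (((X ^ a.val) ^ ID.val)⁻¹ * X ^ z.val) = X ^ z.val :=
    mul_inv_cancel_left _ _
  rw [publicKeyOf, hY, Key.valid_iff hX _ _ _ _ _ _ _ _ hZ] at h1 h2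
  have h4 : d₃ - d₃' ≠ 0 := sub_ne_zero.2 hd
  have h5 : a * b = (e₁ + -e₁' + -((e₂ + -e₂') * z)) * (d₃ - d₃')⁻¹ := by
    rw [eq_mul_inv_iff_mul_eq₀ h4, h1, h2]
    ring
  rw [solve, h5]
  simp only [pow_val_add, pow_val_neg, pow_val_mul]

/-! ### The distribution of the public key -/

open Classical in
/-- A random generator with a random power of it, in either order. -/
theorem ex_generator_pow (F : 𝔾.G → 𝔾.G → (ZMod 𝔾.p)ˣ → ℝ≥0∞) :
    (ex 𝔾.randGenerator fun g => ex (PMF.uniformOfFintype (ZMod 𝔾.p)ˣ) fun x =>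
      F g (g ^ x.val.val) x) =
    ex (PMF.uniformOfFintype {g : 𝔾.G // g ≠ 1}) fun X =>
      ex (PMF.uniformOfFintype (ZMod 𝔾.p)ˣ) fun a => F (X.1 ^ a.val.val) X.1 a⁻¹ := by
  have hinv : ∀ (u v : (ZMod 𝔾.p)ˣ) (g : 𝔾.G), u * v = 1 → (g ^ u.val.val) ^ v.val.val = g :=
    fun u v g huv => by
      rw [← pow_val_mul, ← Units.val_mul, huv, Units.val_one, pow_val_one]
  have hne : ∀ (u : (ZMod 𝔾.p)ˣ) (g : 𝔾.G), g ≠ 1 → g ^ u.val.val ≠ 1 := fun u g hg h => hg (by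
    rw [← hinv u u⁻¹ g (mul_inv_cancel u), h, one_pow])
  let π : (ZMod 𝔾.p)ˣ → {g : 𝔾.G // g ≠ 1} ≃ {g : 𝔾.G // g ≠ 1} := fun x =>
    { toFun := fun X => ⟨X.1 ^ (x⁻¹).val.val, hne _ _ X.2⟩
      invFun := fun g => ⟨g.1 ^ x.val.val, hne _ _ g.2⟩
      left_inv := fun X => Subtype.ext (hinv _ _ _ (inv_mul_cancel x))
      right_inv := fun g => Subtype.ext (hinv _ _ _ (mul_inv_cancel x)) }
  rw [ex_comm]
  conv_rhs => rw [ex_comm]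
  rw [← ex_uniform_equiv (Equiv.inv (ZMod 𝔾.p)ˣ)]
  congr 1
  funext x
  rw [BilinearGroup.randGenerator, ex_map, ← ex_uniform_equiv (π x⁻¹)]
  congr 1
  funext X
  simp only [π, Equiv.inv_apply, inv_inv, Equiv.coe_fn_mk]
  rw [hinv x x⁻¹ X.1 (mul_inv_cancel x)]

theorem ex_publicKey_le {g X : 𝔾.G} (hX : X ≠ 1) (ID t : ZMod 𝔾.p) {F : PublicKey 𝔾 → ℝ≥0∞}
    (hF : ∀ k, F k ≤ 1) :
    (ex (PMF.uniformOfFintype 𝔾.G) fun h => ex (PMF.uniformOfFintype 𝔾.G) fun Y =>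
      ex (PMF.uniformOfFintype 𝔾.G) fun Z => F ⟨g, X, Y, Z, h⟩) ≤
    (ex (PMF.uniformOfFintype (ZMod 𝔾.p)ˣ) fun b => ex (PMF.uniformOfFintype (ZMod 𝔾.p)) fun y =>
      ex (PMF.uniformOfFintype (ZMod 𝔾.p)) fun z =>
        F ⟨g, X, X ^ y.val * ((X ^ b.val.val) ^ t.val)⁻¹, (g ^ ID.val)⁻¹ * X ^ z.val,
          X ^ b.val.val⟩) + (𝔾.p : ℝ≥0∞)⁻¹ := by
  have h1 : ∀ c : 𝔾.G, Function.Bijective fun e : ZMod 𝔾.p => X ^ e.val * c := fun c =>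
    (Equiv.mulRight c).bijective.comp (pow_val_bijective hX)
  have h2 : ∀ c : 𝔾.G, Function.Bijective fun e : ZMod 𝔾.p => c * X ^ e.val := fun c =>
    (Equiv.mulLeft c).bijective.comp (pow_val_bijective hX)
  rw [← ex_uniform_bijective (pow_val_bijective hX)]
  refine (ex_le_units fun b => ex_le_one fun Y => ex_le_one fun Z => hF _).trans_eq ?_
  congr 2
  funext b
  rw [← ex_uniform_bijective (h1 ((X ^ b.val.val) ^ t.val)⁻¹)]
  congr 1
  funext y
  rw [← ex_uniform_bijective (h2 (g ^ ID.val)⁻¹)]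

open Classical in
/-- The public key of the reduction has the distribution of the real one, except that `h` is not
`1`. -/
theorem ex_setup_le (ID : ZMod 𝔾.p) {F : ZMod 𝔾.p → PublicKey 𝔾 → (ZMod 𝔾.p)ˣ → ℝ≥0∞}
    (hF : ∀ t k x, F t k x ≤ 1) :
    (ex (setup 𝔾) fun k => ex (PMF.uniformOfFintype (ZMod 𝔾.p)) fun t => F t k.1 k.2) ≤
      (ex (PMF.uniformOfFintype {g : 𝔾.G // g ≠ 1}) fun X =>
        ex (PMF.uniformOfFintype (ZMod 𝔾.p)ˣ) fun a => ex (PMF.uniformOfFintype (ZMod 𝔾.p)ˣ) fun b =>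
          ex (PMF.uniformOfFintype (ZMod 𝔾.p)) fun y => ex (PMF.uniformOfFintype (ZMod 𝔾.p)) fun t =>
            ex (PMF.uniformOfFintype (ZMod 𝔾.p)) fun z =>
              F t (publicKeyOf X.1 ID a b y t z) a⁻¹) + (𝔾.p : ℝ≥0∞)⁻¹ := by
  have h1 : (ex (setup 𝔾) fun k => ex (PMF.uniformOfFintype (ZMod 𝔾.p)) fun t => F t k.1 k.2) =
      ex 𝔾.randGenerator fun g => ex (PMF.uniformOfFintype (ZMod 𝔾.p)ˣ) fun x =>
        ex (PMF.uniformOfFintype (ZMod 𝔾.p)) fun t =>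
          ex (PMF.uniformOfFintype 𝔾.G) fun h => ex (PMF.uniformOfFintype 𝔾.G) fun Y =>
            ex (PMF.uniformOfFintype 𝔾.G) fun Z => F t ⟨g, g ^ x.val.val, Y, Z, h⟩ x := by
    simp only [setup, ex_bind, ex_pure,
      ex_comm (PMF.uniformOfFintype 𝔾.G) (PMF.uniformOfFintype (ZMod 𝔾.p)ˣ),
      ex_comm (PMF.uniformOfFintype 𝔾.G) (PMF.uniformOfFintype (ZMod 𝔾.p))]
  rw [h1, ex_generator_pow fun g X x => ex (PMF.uniformOfFintype (ZMod 𝔾.p)) fun t =>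
    ex (PMF.uniformOfFintype 𝔾.G) fun h => ex (PMF.uniformOfFintype 𝔾.G) fun Y =>
      ex (PMF.uniformOfFintype 𝔾.G) fun Z => F t ⟨g, X, Y, Z, h⟩ x]
  conv_rhs => rw [← ex_const (PMF.uniformOfFintype {g : 𝔾.G // g ≠ 1}) (𝔾.p : ℝ≥0∞)⁻¹, ← ex_add]
  refine ex_mono fun X => ?_
  conv_rhs => rw [← ex_const (PMF.uniformOfFintype (ZMod 𝔾.p)ˣ) (𝔾.p : ℝ≥0∞)⁻¹, ← ex_add]
  refine ex_mono fun a => ?_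
  refine (ex_mono fun t => ex_publicKey_le X.2 ID t fun k => hF t k a⁻¹).trans_eq ?_
  rw [ex_add, ex_const, ex_comm]
  congr 2
  funext b
  rw [ex_comm]
  rfl

end

/-! ### The reduction against the game -/

open Classical in
/-- The indicator of the solution of a challenge. -/
def solves (C : Challenge 𝓕) (v : C.grp.G) (_ : ℕ) : ℝ≥0∞ :=
  if v = C.X ^ (C.a * C.b).val.val then 1 else 0

theorem winning_le_solves (C : Challenge 𝓕) (ID y t z : ZMod C.grp.p) (k : Key C.grp × Key C.grp)
    (κ κ' : ℕ) : winning (C.toInstance ID y t z).mpk ID k κ ≤ ev (solveKeys z k) (solves C) κ' := by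
  unfold winning
  split_ifs with h
  · obtain ⟨h1, h2⟩ := Wins.solve_eq C.X_ne (show Wins (publicKeyOf C.X ID C.a C.b y t z) ID _ _ from h)
    rw [solveKeys, if_pos h1, ev_pure, solves, if_pos (by rw [h2, Units.val_mul])]
  · exact zero_le

theorem ex_simGame_le_solveFor (A : Code) (N : ℕ) (C : Challenge 𝓕) (st : Data) (ID : ZMod C.grp.p)
    (κ : ℕ) :
    (ex (PMF.uniformOfFintype (ZMod C.grp.p)) fun y =>
      ex (PMF.uniformOfFintype (ZMod C.grp.p)) fun t =>
        ex (PMF.uniformOfFintype (ZMod C.grp.p)) fun z =>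
          ev (simGame A (publicKeyOf C.X ID C.a C.b y t z) C.a⁻¹ ID N t st)
            (winning (publicKeyOf C.X ID C.a C.b y t z) ID) κ) ≤
      ev (solveFor A N C st ID) (solves C) κ := by
  simp only [solveFor, ev_bind, ev_sample]
  refine ex_mono fun y => ex_mono fun t => ex_mono fun z => le_trans ?_ (ev_bind _ _ _ _).ge
  exact ev_mono fun k κ' => winning_le_solves C ID y t z k κ' κ'

section

variable {𝔾 : BilinearGroup}

theorem ev_interact_le_value (A : Code) (mpk : PublicKey 𝔾) (x : (ZMod 𝔾.p)ˣ) (ID : ZMod 𝔾.p)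
    {N κ : ℕ} (hκ : κ ≤ N) (st m : Data) :
    ev (interact A mpk x ID κ (fun _ => none) st m) isTrue κ ≤
      value A mpk x ID N [] none st m κ + N * (2 * (𝔾.p : ℝ≥0∞)⁻¹) := by
  have h : (fun _ => none : ZMod 𝔾.p → Option (Session 𝔾)) = sessions ID [] none := by
    funext ID'
    simp [sessions, Table.find]
  refine (ev_interact_le A mpk x ID κ _ st m κ).trans ?_
  rw [h]
  gcongr
  exact ev_play_mono A mpk x ID _ st m κ hκ

open Classical in
theorem mul_ex_interact_le (A : Code) (ID : ZMod 𝔾.p) {N κ : ℕ} (hκ : κ ≤ N) (st : Data) {ε : ℝ≥0∞}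
    (hε : ε ≤ 1) :
    ε * (ex (setup 𝔾) fun k =>
      ev (interact A k.1 k.2 ID κ (fun _ => none) st (encPublicKey k.1)) isTrue κ) ≤
      (ex (PMF.uniformOfFintype {g : 𝔾.G // g ≠ 1}) fun X =>
        ex (PMF.uniformOfFintype (ZMod 𝔾.p)ˣ) fun a => ex (PMF.uniformOfFintype (ZMod 𝔾.p)ˣ) fun b =>
          ex (PMF.uniformOfFintype (ZMod 𝔾.p)) fun y => ex (PMF.uniformOfFintype (ZMod 𝔾.p)) fun t =>
            ex (PMF.uniformOfFintype (ZMod 𝔾.p)) fun z =>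
              ev (simGame A (publicKeyOf X.1 ID a b y t z) a⁻¹ ID N t st)
                (winning (publicKeyOf X.1 ID a b y t z) ID) (κ + N)) +
        (ε ^ 2 + (2 * N + 2) * (𝔾.p : ℝ≥0∞)⁻¹) := by
  have h1 : ∀ k : PublicKey 𝔾 × (ZMod 𝔾.p)ˣ,
      ε * ev (interact A k.1 k.2 ID κ (fun _ => none) st (encPublicKey k.1)) isTrue κ ≤
      (ex (PMF.uniformOfFintype (ZMod 𝔾.p)) fun t =>
        ev (simGame A k.1 k.2 ID N t st) (winning k.1 ID) (κ + N)) +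
        (ε ^ 2 + (2 * N + 1) * (𝔾.p : ℝ≥0∞)⁻¹) := fun k => by
    refine (mul_le_mul_right (ev_interact_le_value A k.1 k.2 ID hκ st _) ε).trans ?_
    rw [mul_add]
    refine (add_le_add (mul_value_fresh_le A k.1 k.2 ID N hε st hκ)
      (mul_le_of_le_one_left' hε)).trans_eq ?_
    ring
  rw [← ex_const_mul]
  refine (ex_mono h1).trans ?_
  rw [ex_add, ex_const]
  refine (add_le_add_left (ex_setup_le ID (F := fun t k x =>
    ev (simGame A k x ID N t st) (winning k ID) (κ + N))
      fun t k x => ev_le_one fun _ _ => winning_le_one k ID _ _) _).trans_eq ?_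
  ring

end

/-- The rest of the game after the adversary has announced the target identity. -/
def gameAfter (𝔾 : BilinearGroup) (A : Code) : Data → Timed Bool
  | .pair st (.num i) =>
    match decZ 𝔾 i with
    | some ID => do
      let keys ← sample (setup 𝔾)
      let k ← get
      interact A keys.1 keys.2 ID k (fun _ => none) st (encPublicKey keys.1)
    | none => pure false
  | _ => pure false

theorem ev_newKeyGame (A : Code) (n k : ℕ) :
    ev (𝓕.newKeyGame A n) isTrue k = ex (𝓕.gen n) fun d =>
      ev (A.eval (.pair (.num 0) (.pair (.num n) (𝓕.desc d))))
        (fun out => ev (gameAfter (𝓕.grp d) A out) isTrue) k := by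
  unfold BilinearFamily.newKeyGame
  rw [ev_bind, ev_sample]
  congr 1
  funext d
  rw [ev_bind]
  congr 1

open Classical in
theorem mul_gameAfter_le (A : Code) {n : ℕ} {d : Data} (hd : d ∈ (𝓕.gen n).support) (out : Data)
    {N κ : ℕ} (hκ : κ ≤ N) {ε : ℝ≥0∞} (hε : ε ≤ 1) :
    ε * ev (gameAfter (𝓕.grp d) A out) isTrue κ ≤
      (ex (PMF.uniformOfFintype {g : (𝓕.grp d).G // g ≠ 1}) fun X =>
        ex (PMF.uniformOfFintype (ZMod (𝓕.grp d).p)ˣ) fun a =>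
          ex (PMF.uniformOfFintype (ZMod (𝓕.grp d).p)ˣ) fun b =>
            ev (solveAfter A N (⟨n, d, hd, X.1, X.2, a, b⟩ : Challenge 𝓕) out)
              (solves ⟨n, d, hd, X.1, X.2, a, b⟩) (κ + N)) +
        (ε ^ 2 + (2 * N + 2) * ((𝓕.grp d).p : ℝ≥0∞)⁻¹) := by
  match out with
  | .num _ => simp [gameAfter, isTrue]
  | .pair _ (.pair _ _) => simp [gameAfter, isTrue]
  | .pair st (.num i) =>
    simp only [gameAfter, solveAfter]
    have hg : ∀ C : Challenge 𝓕, decZ C.grp i = decZ (𝓕.grp C.d) i := fun _ => rfl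
    simp only [hg]
    cases hi : decZ (𝓕.grp d) i with
    | none => simp [isTrue]
    | some ID =>
      simp only [ev_bind, ev_sample, ev_get]
      refine (mul_ex_interact_le A ID hκ st hε).trans (add_le_add_left ?_ _)
      exact ex_mono fun X => ex_mono fun a => ex_mono fun b =>
        ex_simGame_le_solveFor A N ⟨n, d, hd, X.1, X.2, a, b⟩ st ID (κ + N)

open Classical in
theorem mul_ev_game_le (A : Code) {n : ℕ} {d : Data} (hd : d ∈ (𝓕.gen n).support)
    (N : ℕ) {ε : ℝ≥0∞} (hε : ε ≤ 1) :
    ε * ev (A.eval (.pair (.num 0) (.pair (.num n) (𝓕.desc d))))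
        (fun out => ev (gameAfter (𝓕.grp d) A out) isTrue) N ≤
      (ex (PMF.uniformOfFintype {g : (𝓕.grp d).G // g ≠ 1}) fun X =>
        ex (PMF.uniformOfFintype (ZMod (𝓕.grp d).p)ˣ) fun a =>
          ex (PMF.uniformOfFintype (ZMod (𝓕.grp d).p)ˣ) fun b =>
            ev (solver A N (⟨n, d, hd, X.1, X.2, a, b⟩ : Challenge 𝓕))
              (solves ⟨n, d, hd, X.1, X.2, a, b⟩) (2 * N)) +
        (ε ^ 2 + (2 * N + 2) * ((𝓕.grp d).p : ℝ≥0∞)⁻¹) := by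
  simp only [solver, ev_bind]
  simp only [← ev_ex]
  rw [← ev_const_mul, two_mul]
  refine le_trans ?_ (add_le_add_left ((A.eval_clocked _).shift _ N N) _)
  refine le_trans ?_ (ev_add_const_le _ _ _ _)
  exact ev_mono_reach fun out κ hr => mul_gameAfter_le A hd out ((A.eval_clocked _).le hr) hε

/-- The advantages in the game and in the Diffie-Hellman experiment. -/
theorem exists_code_advantage (𝓕 : BilinearFamily) (A : Code) (q : Polynomial ℕ) :
    ∃ (B : Code) (r : Polynomial ℕ), ∀ (n : ℕ) (ε : ℝ≥0∞), ε ≤ 1 →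
      ε * (𝓕.newKeyGame A n).dist (q.eval n) (some true) ≤
        (𝓕.cdhGame B n).dist (r.eval n) (some true) +
          (ε ^ 2 + (2 * q.eval n + 2 : ℕ) * (2 ^ n : ℝ≥0∞)⁻¹) := by
  classical
  obtain ⟨B, r, hB⟩ := exists_code_solver 𝓕 A q
  refine ⟨B, r, fun n ε hε => ?_⟩
  have h1 : (𝓕.newKeyGame A n).dist (q.eval n) (some true) =
      ev (𝓕.newKeyGame A n) isTrue (q.eval n) := by
    rw [dist_some]
    congr 1
    funext b k
    cases b <;> simp [isTrue]
  have h2 : (𝓕.cdhGame B n).dist (r.eval n) (some true) =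
      ex (𝓕.gen n) fun d => ex (PMF.uniformOfFintype {g : (𝓕.grp d).G // g ≠ 1}) fun X =>
        ex (PMF.uniformOfFintype (ZMod (𝓕.grp d).p)ˣ) fun a =>
          ex (PMF.uniformOfFintype (ZMod (𝓕.grp d).p)ˣ) fun b =>
            ev (B.eval (.pair (.num n) (.pair (𝓕.desc d) (.pair ((𝓕.grp d).enc X.1)
              (.pair ((𝓕.grp d).enc (X.1 ^ a.val.val)) ((𝓕.grp d).enc (X.1 ^ b.val.val)))))))
              (fun y _ => if y = (𝓕.grp d).enc (X.1 ^ (a * b).val.val) then 1 else 0)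
              (r.eval n) := by
    rw [dist_some]
    simp [BilinearFamily.cdhGame, BilinearGroup.randGenerator, ex_map]
  rw [h1, h2, ev_newKeyGame, ← ex_const_mul]
  conv_rhs => rw [← ex_const (𝓕.gen n) (ε ^ 2 + (2 * q.eval n + 2 : ℕ) * (2 ^ n : ℝ≥0∞)⁻¹),
    ← ex_add]
  refine ex_mono_support fun d hd => ?_
  refine (mul_ev_game_le A hd (q.eval n) hε).trans (add_le_add ?_ ?_)
  · refine ex_mono fun X => ex_mono fun a => ex_mono fun b => ?_
    refine le_trans (ev_mono fun v k => le_of_eq ?_)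
      (hB ⟨n, d, hd, X.1, X.2, a, b⟩ fun y =>
        if y = (𝓕.grp d).enc (X.1 ^ (a * b).val.val) then 1 else 0)
    simp only [solves, (𝓕.grp d).enc_injective.eq_iff]
  · gcongr
    · push_cast
      exact le_rfl
    · exact_mod_cast (𝓕.order_gt n d hd).le

theorem dist_toReal_le_one {α : Type} (m : Timed α) (k : ℕ) (a : Option α) :
    (m.dist k a).toReal ≤ 1 :=
  ENNReal.toReal_mono ENNReal.one_ne_top (PMF.coe_le_one _ _)

/-- The square of the advantage is bounded: the probability `ε` in the reduction is taken to be
half the advantage. -/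
theorem exists_advantage_sq_le (𝓕 : BilinearFamily) (A : Code) (q : Polynomial ℕ) :
    ∃ (B : Code) (r : Polynomial ℕ), ∀ n : ℕ,
      𝓕.newKeyAdvantage A q n ^ 2 ≤
        4 * (𝓕.cdhAdvantage B r n + (2 * q.eval n + 2 : ℕ) * (2 ^ n : ℝ)⁻¹) := by
  obtain ⟨B, r, h⟩ := exists_code_advantage 𝓕 A q
  refine ⟨B, r, fun n => ?_⟩
  set α := 𝓕.newKeyAdvantage A q n with hα
  have h0 : 0 ≤ α := ENNReal.toReal_nonneg
  have h1 : α ≤ 1 := dist_toReal_le_one _ _ _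
  have hn := h n (ENNReal.ofReal (α / 2)) (by
    rw [ENNReal.ofReal_le_one]
    linarith)
  have hβ : (𝓕.cdhGame B n).dist (r.eval n) (some true) ≠ ⊤ := PMF.apply_ne_top _ _
  have hδ : ((2 * q.eval n + 2 : ℕ) * (2 ^ n : ℝ≥0∞)⁻¹) ≠ ⊤ :=
    ENNReal.mul_ne_top (ENNReal.natCast_ne_top _) (by simp)
  have hε : ENNReal.ofReal (α / 2) ^ 2 ≠ ⊤ := by simp
  have := ENNReal.toReal_mono (ENNReal.add_ne_top.2 ⟨hβ, ENNReal.add_ne_top.2 ⟨hε, hδ⟩⟩) hn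
  rw [ENNReal.toReal_add hβ (ENNReal.add_ne_top.2 ⟨hε, hδ⟩), ENNReal.toReal_add hε hδ,
    ENNReal.toReal_mul, ENNReal.toReal_mul, ENNReal.toReal_pow, ENNReal.toReal_inv,
    ENNReal.toReal_pow, ENNReal.toReal_natCast, ENNReal.toReal_ofReal (by linarith),
    ENNReal.toReal_ofNat] at this
  change α / 2 * α ≤ 𝓕.cdhAdvantage B r n + _ at this
  nlinarith

/-! ### Negligible functions -/

theorem Negligible.of_sq {f : ℕ → ℝ} (hf : ∀ n, 0 ≤ f n) (h : Negligible fun n => f n ^ 2) :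
    Negligible f := by
  intro m
  have h2 := h (2 * m)
  have h3 := h2.sqrt
  rw [Real.sqrt_zero] at h3
  refine h3.congr fun n => ?_
  rw [show (n : ℝ) ^ (2 * m) * f n ^ 2 = ((n : ℝ) ^ m * f n) ^ 2 by ring]
  exact Real.sqrt_sq (mul_nonneg (by positivity) (hf n))

theorem negligible_eval_mul_inv_two_pow (q : Polynomial ℕ) :
    Negligible fun n => (q.eval n : ℕ) * (2 ^ n : ℝ)⁻¹ := by
  have h : Negligible fun n => (2 ^ n : ℝ)⁻¹ := by
    intro m
    have := tendsto_pow_const_mul_const_pow_of_abs_lt_one m (r := (2 : ℝ)⁻¹) (by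
      rw [abs_of_pos (by norm_num)]
      norm_num)
    simpa only [inv_pow] using this
  have := Asymptotics.SuperpolynomialDecay.polynomial_mul h (q.map (Nat.castRingHom ℝ))
  refine this.congr fun n => ?_
  rw [Polynomial.eval_natCast_map]
  simp

end AIBE

end

theorem mainTheorem3 (𝓕 : AIBE.BilinearFamily) (hCDH : 𝓕.CDH)
    (A : AIBE.Code) (q : Polynomial ℕ) :
    AIBE.Negligible (𝓕.newKeyAdvantage A q) := by
  obtain ⟨B, r, h⟩ := AIBE.exists_advantage_sq_le 𝓕 A q
  have hβ : AIBE.Negligible fun n => 4 * (𝓕.cdhAdvantage B r n +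
      ((2 * q + 2 : Polynomial ℕ).eval n : ℕ) * (2 ^ n : ℝ)⁻¹) :=
    ((hCDH B r).add (AIBE.negligible_eval_mul_inv_two_pow _)).const_mul 4
  refine AIBE.Negligible.of_sq (fun n => ENNReal.toReal_nonneg)
    (hβ.trans_abs_le fun n => ?_)
  rw [abs_of_nonneg (sq_nonneg _)]
  refine le_trans ?_ (le_abs_self _)
  simpa using h n
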